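/- **Setting.** Let $\Omega$ be a square of side $2\pi$ with periodic boundary conditions. All functions are real-valued, $(f,g)=\int_\Omega fg\,d\mathbf x$, and $\|\cdot\|$ is the norm of $L^2_{per}(\Omega)$. With $\hat u_{sl}=\frac1{|\Omega|}\int_\Omega u\,e^{-isx_1-ilx_2}d\mathbf x$ put $$|u|_\rho^2=\sum_{s,l\in\mathbb Z}(s^2+l^2)^\rho|\hat u_{sl}|^2,\qquad \|u\|_\rho^2=\|u\|_{H^\rho}^2=\sum_{s,l\in\mathbb Z}(1+s^2+l^2)^\rho|\hat u_{sl}|^2,\qquad (-\Delta)^\beta u=\sum_{s,l\in\mathbb Z}(s^2+l^2)^\beta\hat u_{sl}e^{isx_1+ilx_2}.$$ Let $\kappa>0$, $1<\alpha\le2$, $\gamma_1,\gamma_2\ge0$, $T>0$, $m\ge0$. Let $F\in C^3(\mathbb R)$ be nonnegative, and let $E(w)=\int_\Omega F(w)\,d\mathbf x+C_0$, where the constant $C_0$ is such that $E(w)>0$ for all bounded $w$. (No global Lipschitz condition on $F'$ is imposed.) **Exact solution.** Let $u$ solve $$u_{tt}+\kappa(-\Delta)^{\alpha/2}u+\gamma_1(-\Delta)^{\alpha/2}u_t+\gamma_2u_t+F'(u)=0\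 \text{ in }\Omega\times(0,T],\qquad u(0)=u_0,\quad u_t(0)=v_0,$$ and put $v=u_t$ and $r(t)=\sqrt{E(u(t))}$. Assume that $u,u_t,u_{tt}$ (as functions of $t\in[0,T]$ with values in $L^2_{per}(\Omega)$) and $r,r_t,r_{tt}$ are absolutely continuous with integrable time derivatives, and that for some constant $L$ $$\|u_0\|_{H^m}+\|u\|_{H^m}+\|u_t\|_{H^m}+\|u\|_\alpha+\|u_t\|_\alpha+\|u_{tt}\|_\alpha+\|u_{ttt}\|_{\alpha/2}+|r|_{L^\infty(0,T)}+|r_t|_{L^\infty(0,T)}+|r_{tt}|_{L^\infty(0,T)}+|r_{ttt}|_{L^\infty(0,T)}\le L,$$ where the norms of $u,u_t,u_{tt}$ are suprema over $t\in[0,T]$ and that of $u_{ttt}$ is an essential supremum. **Scheme.** For integers $N,K\ge1$ let $\tau=T/K$, $t_n=n\tau$, let $X_N$ be the space of real-valued functions in $\mathrm{span}_{\mathbb C}\{e^{isx_1+ilx_2}:-N/2\le s,l\le N/2-1\}$, and let $P_N$ be the $L^2$-orthogonal projection onto $X_N$. Let $u_N^n,v_N^n\in X_N$ and $R^n\in\mathbb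 R$ ($0\le n\le K$) be a solution of the following scheme: $u_N^0=P_Nu_0$, $v_N^0=P_Nv_0$, $R^0=r(0)$; there are $\tilde u_N^{1/2},\tilde v_N^{1/2}\in X_N$ and $\tilde R^{1/2}\in\mathbb R$ with, for all $\psi,\varphi\in X_N$, $$\Big(\tfrac{\tilde u_N^{1/2}-u_N^0}{\tau/2},\psi\Big)=(\tilde v_N^{1/2},\psi),$$ $$\Big(\tfrac{\tilde v_N^{1/2}-v_N^0}{\tau/2},\varphi\Big)+\kappa((-\Delta)^{\alpha/2}\tilde u_N^{1/2},\varphi)+\gamma_1((-\Delta)^{\alpha/2}\tilde v_N^{1/2},\varphi)+\gamma_2(\tilde v_N^{1/2},\varphi)+\tilde R^{1/2}\Big(\tfrac{F'(u_N^0)}{\sqrt{E(u_N^0)}},\varphi\Big)=0,$$ $$\frac{\tilde R^{1/2}-R^0}{\tau/2}=\frac1{2\sqrt{E(u_N^0)}}\Big(F'(u_N^0),\tfrac{\tilde u_N^{1/2}-u_N^0}{\tau/2}\Big);$$ and for $0\le n\le K-1$, with $\tilde u_N^{n+1/2}=\frac{3u_N^n-u_N^{n-1}}2$ if $n\ge1$,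 $\delta_tw^{n+1/2}=\frac{w^{n+1}-w^n}\tau$, $\bar w^{n+1/2}=\frac{w^{n+1}+w^n}2$, and for all $\psi,\varphi\in X_N$, $$(\delta_tu_N^{n+1/2},\psi)=(\bar v_N^{n+1/2},\psi),$$ $$(\delta_tv_N^{n+1/2},\varphi)+\kappa((-\Delta)^{\alpha/2}\bar u_N^{n+1/2},\varphi)+\gamma_1((-\Delta)^{\alpha/2}\bar v_N^{n+1/2},\varphi)+\gamma_2(\bar v_N^{n+1/2},\varphi)+\bar R^{n+1/2}\Big(\tfrac{F'(\tilde u_N^{n+1/2})}{\sqrt{E(\tilde u_N^{n+1/2})}},\varphi\Big)=0,$$ $$\delta_tR^{n+1/2}=\frac1{2\sqrt{E(\tilde u_N^{n+1/2})}}\big(F'(\tilde u_N^{n+1/2}),\delta_tu_N^{n+1/2}\big).$$ **Theorem.** There is a constant $C>0$, independent of $N$ and $K$ (hence of $\tau$), such that for all integers $N,K\ge1$, every solution of the scheme and all $0\le n\le K$, with $u^n=u(t_n)$, $v^n=v(t_n)$, $r^n=r(t_n)$, $$\|u^n-u_N^n\|^2+\|v^n-v_N^n\|^2+|r^n-R^n|^2\le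 C(\tau^4+N^{-2m}),\qquad \kappa\,|u^n-u_N^n|_{\alpha/2}^2\le C(\tau^4+N^{\alpha-2m}).$$ -/

import Mathlib

open MeasureTheory Set Filter
open scoped ENNReal ContDiff

noncomputable section

namespace SAVWave

/-- The period is positive (needed for the measure on the circle). -/
instance factTwoPiPos : Fact (0 < 2 * Real.pi) := ⟨Real.two_pi_pos⟩

/-- The periodic square `(0, 2π) × (0, 2π)`; its `volume` has total mass `4π²`. -/
abbrev Torus : Type := AddCircle (2 * Real.pi) × AddCircle (2 * Real.pi)

/-- Real-valued `L²_per(Ω)`, with inner product `(f, g) = ∫_Ω f g dx` (not normalized) and its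
norm `‖f‖`. -/
abbrev L2per : Type := Lp ℝ 2 (volume : Measure Torus)

/-- The exponential `e^{i s x₁ + i l x₂}`, for `k = (s, l)`. -/
def expo (k : ℤ × ℤ) (x : Torus) : ℂ := fourier k.1 x.1 * fourier k.2 x.2

/-- The Fourier coefficient `û_{sl} = |Ω|⁻¹ ∫_Ω u e^{-i s x₁ - i l x₂} dx`. -/
def fcoef (f : L2per) (k : ℤ × ℤ) : ℂ :=
  ((4 * Real.pi ^ 2 : ℝ) : ℂ)⁻¹ * ∫ x : Torus, (f x : ℂ) * (starRingEnd ℂ) (expo k x)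

/-- `s² + l²` for `k = (s, l)`. -/
def freqSq (k : ℤ × ℤ) : ℝ := (k.1 : ℝ) ^ 2 + (k.2 : ℝ) ^ 2

/-- The norm `‖f‖_r` of `H^r_per(Ω)`, with value `∞` when `f` is not in `H^r_per(Ω)`. -/
def sobNorm (r : ℝ) (f : L2per) : ℝ≥0∞ :=
  (∑' k : ℤ × ℤ, ENNReal.ofReal ((1 + freqSq k) ^ r * ‖fcoef f k‖ ^ 2)) ^ (1 / 2 : ℝ)

/-- The semi-norm `|f|_r` of `H^r_per(Ω)`, with value `∞` when the series diverges. -/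
def sobSemi (r : ℝ) (f : L2per) : ℝ≥0∞ :=
  (∑' k : ℤ × ℤ, ENNReal.ofReal (freqSq k ^ r * ‖fcoef f k‖ ^ 2)) ^ (1 / 2 : ℝ)

open Classical in
/-- The fractional Laplacian `(-Δ)^β f = ∑ (s² + l²)^β f̂_{sl} e^{i s x₁ + i l x₂}`: the element of
`L²_per` with the Fourier coefficients `(s² + l²)^β f̂_{sl}`. (It exists exactly for
`f ∈ H^{2β}_per`, the domain of the operator; the value off the domain is irrelevant.) -/
def fracLap (β : ℝ) (f : L2per) : L2per :=
  if h : ∃ g : L2per, ∀ k, fcoef g k = ((freqSq k ^ β : ℝ) : ℂ) * fcoef f k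
  then h.choose else 0

/-- The functional `E(w) = ∫_Ω F(w) dx + C₀`. -/
def energyE (F : ℝ → ℝ) (C₀ : ℝ) (w : L2per) : ℝ := (∫ x : Torus, F (w x)) + C₀

/-- `(F'(w), φ) = ∫_Ω F'(w) φ dx`. -/
def pairF' (F : ℝ → ℝ) (w φ : L2per) : ℝ := ∫ x : Torus, deriv F (w x) * φ x

/-- `f` is absolutely continuous on `[0, T]` and `g` is its (almost everywhere, equivalently weak)
time derivative. -/
def IsTimeDeriv {E : Type*} [NormedAddCommGroup E] [NormedSpace ℝ E]
    (T : ℝ) (f g : ℝ → E) : Prop :=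
  IntervalIntegrable g volume 0 T ∧ ∀ t ∈ Icc 0 T, f t = f 0 + ∫ s in (0 : ℝ)..t, g s

/-- `u` solves the generalized wave equation
`u_tt + κ (-Δ)^{α/2} u + γ₁ (-Δ)^{α/2} u_t + γ₂ u_t + F'(u) = 0` on `Ω × (0, T]` with initial data
`u(0) = φ₀`, `u_t(0) = φ₁`; the time derivatives of `u` are `ut`, `utt`. -/
structure IsExactSolution (κ α γ₁ γ₂ : ℝ) (F : ℝ → ℝ) (T : ℝ) (φ₀ φ₁ : L2per)
    (u ut utt : ℝ → L2per) : Prop where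
  deriv_u : IsTimeDeriv T u ut
  deriv_ut : IsTimeDeriv T ut utt
  pde : ∀ t ∈ Ioc 0 T, ∀ᵐ x : Torus,
    (utt t) x + κ * (fracLap (α / 2) (u t)) x + γ₁ * (fracLap (α / 2) (ut t)) x
      + γ₂ * (ut t) x + deriv F ((u t) x) = 0
  init_u : u 0 = φ₀
  init_ut : ut 0 = φ₁

/-- The supremum over `t ∈ [0, T]` of the `H^s_per(Ω)` norm of `w(t)`. -/
def supNorm (T s : ℝ) (w : ℝ → L2per) : ℝ≥0∞ := ⨆ t ∈ Icc 0 T, sobNorm s (w t)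

/-- The essential supremum over `t ∈ (0, T)` of the `H^s_per(Ω)` norm of `w(t)`. -/
def essSupNorm (T s : ℝ) (w : ℝ → L2per) : ℝ≥0∞ :=
  essSup (fun t => sobNorm s (w t)) (volume.restrict (Ioo 0 T))

/-- The norm of `L^∞(0, T)`. -/
def linfNorm (T : ℝ) (q : ℝ → ℝ) : ℝ≥0∞ := eLpNorm q ∞ (volume.restrict (Ioo 0 T))

/-- The regularity bound, with constant `L`, on the solution `u` and on `r`. -/
def RegularityBound (m α T L : ℝ) (φ₀ : L2per) (u ut utt uttt : ℝ → L2per)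
    (r rt rtt rttt : ℝ → ℝ) : Prop :=
  sobNorm m φ₀ + supNorm T m u
    + linfNorm T r + linfNorm T rt + linfNorm T rtt + linfNorm T rttt
    + supNorm T m ut + supNorm T α u + supNorm T α ut + supNorm T α utt
    + essSupNorm T (α / 2) uttt ≤ ENNReal.ofReal L

/-- The index set `-N/2 ≤ s, l ≤ N/2 - 1` (inequalities between real numbers). -/
def IsMode (N : ℕ) (k : ℤ × ℤ) : Prop :=
  (-(N : ℝ) / 2 ≤ k.1 ∧ (k.1 : ℝ) ≤ (N : ℝ) / 2 - 1) ∧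
  (-(N : ℝ) / 2 ≤ k.2 ∧ (k.2 : ℝ) ≤ (N : ℝ) / 2 - 1)

/-- The real-valued functions in `X_N = span {e^{i s x₁ + i l x₂} : -N/2 ≤ s, l ≤ N/2 - 1}`. -/
def XN (N : ℕ) : Set L2per :=
  {f | ∃ S ∈ Submodule.span ℂ (expo '' {k | IsMode N k}), ∀ᵐ x : Torus, (f x : ℂ) = S x}

/-- `p = P_N w`, the `L²`-orthogonal projection of `w` onto `X_N`. -/
def IsProj (N : ℕ) (w p : L2per) : Prop := p ∈ XN N ∧ ∀ ψ ∈ XN N, inner ℝ (w - p) ψ = 0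

/-- The explicit argument `ũ_N^{n+1/2}` of the nonlinear terms: the output `uh` of the starting
step for `n = 0`, and the extrapolation `(3 u_N^n - u_N^{n-1}) / 2` for `n ≥ 1`. -/
def extrap (uh : L2per) (uN : ℕ → L2per) : ℕ → L2per
  | 0 => uh
  | n + 1 => (1 / 2 : ℝ) • ((3 : ℝ) • uN (n + 1) - uN n)

/-- The starting half step (backward Euler), with output `uh = ũ_N^{1/2}`, `vh = ṽ_N^{1/2}`,
`Rh = R̃^{1/2}`, from the values `u0 = u_N^0`, `v0 = v_N^0`, `R0`. -/
structure IsStartStep (κ α γ₁ γ₂ : ℝ) (F : ℝ → ℝ) (C₀ τ : ℝ) (N : ℕ)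
    (u0 v0 : L2per) (R0 : ℝ) (uh vh : L2per) (Rh : ℝ) : Prop where
  mem_u : uh ∈ XN N
  mem_v : vh ∈ XN N
  eq_u : ∀ ψ ∈ XN N, inner ℝ ((τ / 2)⁻¹ • (uh - u0)) ψ = inner ℝ vh ψ
  eq_v : ∀ φ ∈ XN N,
    inner ℝ ((τ / 2)⁻¹ • (vh - v0)) φ + κ * inner ℝ (fracLap (α / 2) uh) φ
      + γ₁ * inner ℝ (fracLap (α / 2) vh) φ + γ₂ * inner ℝ vh φ
      + Rh * (pairF' F u0 φ / √(energyE F C₀ u0)) = 0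
  eq_R : (Rh - R0) / (τ / 2)
      = 1 / (2 * √(energyE F C₀ u0)) * pairF' F u0 ((τ / 2)⁻¹ • (uh - u0))

/-- One step of the main scheme (averages over the two time levels), from `(u, v, R)` to
`(u', v', R')`, with `w` as the argument of the nonlinear terms. -/
structure IsMainStep (κ α γ₁ γ₂ : ℝ) (F : ℝ → ℝ) (C₀ τ : ℝ) (N : ℕ) (w : L2per)
    (u v : L2per) (R : ℝ) (u' v' : L2per) (R' : ℝ) : Prop where
  eq_u : ∀ ψ ∈ XN N, inner ℝ (τ⁻¹ • (u' - u)) ψ = inner ℝ ((1 / 2 : ℝ) • (v' + v)) ψ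
  eq_v : ∀ φ ∈ XN N,
    inner ℝ (τ⁻¹ • (v' - v)) φ
      + κ * inner ℝ (fracLap (α / 2) ((1 / 2 : ℝ) • (u' + u))) φ
      + γ₁ * inner ℝ (fracLap (α / 2) ((1 / 2 : ℝ) • (v' + v))) φ
      + γ₂ * inner ℝ ((1 / 2 : ℝ) • (v' + v)) φ
      + (R' + R) / 2 * (pairF' F w φ / √(energyE F C₀ w)) = 0
  eq_R : (R' - R) / τ
      = 1 / (2 * √(energyE F C₀ w)) * pairF' F w (τ⁻¹ • (u' - u))

/-- `(u_N^n, v_N^n, R^n)`, `0 ≤ n ≤ K`, is a solution of the fully discrete SAV Fourier spectral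
scheme with time step `τ` and initial data `u0`, `v0`, `r0`. -/
structure IsSAVSolution (κ α γ₁ γ₂ : ℝ) (F : ℝ → ℝ) (C₀ τ : ℝ) (K N : ℕ)
    (u0 v0 : L2per) (r0 : ℝ) (uN vN : ℕ → L2per) (R : ℕ → ℝ) : Prop where
  mem_u : ∀ n ≤ K, uN n ∈ XN N
  mem_v : ∀ n ≤ K, vN n ∈ XN N
  init_u : IsProj N u0 (uN 0)
  init_v : IsProj N v0 (vN 0)
  init_R : R 0 = r0
  steps : ∃ (uh vh : L2per) (Rh : ℝ),
    IsStartStep κ α γ₁ γ₂ F C₀ τ N (uN 0) (vN 0) (R 0) uh vh Rh ∧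
    ∀ n < K, IsMainStep κ α γ₁ γ₂ F C₀ τ N (extrap uh uN n)
      (uN n) (vN n) (R n) (uN (n + 1)) (vN (n + 1)) (R (n + 1))

end SAVWave

end

open SAVWave

/-! The scheme is compared with the projected solution: put f = P_N u - u_N, g = P_N v - v_N, q = r
- R. Integrating the exact equation over a time step leaves trapezoidal defects of size O(τ³),
because the scheme uses averages of the two time levels. Testing the error equations with the
average of g gives exact differences of squares (`linear_step_le`). Together with the equation for q
this bounds the growth of the error energy over a step (`ExactData.exists_step_le`), and a Gronwall
argument gives an error of size τ² + N^{-m}. All this requires the arguments of F' to stay bounded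
in L^∞, since F' is only locally Lipschitz.

That bound is the main difficulty. The discrete energy law controls u_N unconditionally, but only in
H^{α/2} with α/2 ≤ 1, which does not embed into L^∞ in dimension two; an inverse inequality would
couple τ to N. Instead the scheme is tested with (-Δ)^{1/2} of the averaged velocity, which controls
u_N in order (1+α)/2 > 1. The force term then costs half a derivative of F'(w). For w bounded and in
H^{α/2}, translates of w by θ differ from w by O(θ^{α/2}) in L²; so do those of F'(w), and since α/2
> 1/2 a dyadic sum over θ bounds the semi-norm of order 1/2 (`SemiBound.norm_shift_sub_le`,
`exists_sum_abs_le`, `exists_pairF'_half_bound`). This gives `exists_high_regularity`, as long as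
the arguments are bounded by some fixed M'.

The loop is closed by induction on the time level in `ExactData.exists_error_le`. The extrapolated
argument involves only earlier levels. There the error is small in L² and merely bounded in the
higher norm, so the embedding |f| ≤ C‖f‖ + ηB with η small (`exists_sup_bound`) makes it at most 1
pointwise. Thus the next argument is again bounded by M', if τ² + N^{-m} is below a fixed threshold.
Above the threshold, or for N < 4, the energy law alone bounds the error by a constant, which
suffices. -/

namespace SAVWave

/-! ### Fourier series on the torus: Parseval, Riesz–Fischer, absolutely convergent series. -/

noncomputable section

/-- The exponential `expo k` as a continuous map on the torus. -/
def expoC (k : ℤ × ℤ) : C(Torus, ℂ) where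
  toFun x := expo k x
  continuous_toFun := by unfold expo; fun_prop

@[simp] lemma expoC_apply (k : ℤ × ℤ) (x : Torus) : expoC k x = expo k x := rfl

lemma expo_add (j k : ℤ × ℤ) (x : Torus) : expo (j + k) x = expo j x * expo k x := by
  simp only [expo, Prod.fst_add, Prod.snd_add, fourier_add]; ring

lemma expo_neg (k : ℤ × ℤ) (x : Torus) : expo (-k) x = (starRingEnd ℂ) (expo k x) := by
  simp only [expo, Prod.fst_neg, Prod.snd_neg, fourier_neg, map_mul]

lemma expo_zero (x : Torus) : expo 0 x = 1 := by
  simp [expo]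

lemma norm_expo (k : ℤ × ℤ) (x : Torus) : ‖expo k x‖ = 1 := by
  have h : ∀ (n : ℤ) (y : AddCircle (2 * Real.pi)), ‖(fourier n y : ℂ)‖ = 1 :=
    fun n y => Circle.norm_coe _
  rw [expo, norm_mul, h, h, mul_one]

lemma continuous_expo (k : ℤ × ℤ) : Continuous (expo k) := (expoC k).continuous

lemma integral_fourier_circle (n : ℤ) :
    ∫ x : AddCircle (2 * Real.pi), (fourier n x : ℂ) = if n = 0 then ((2 * Real.pi : ℝ) : ℂ) else 0 := by
  split_ifs with h
  · subst h
    have : ∀ x : AddCircle (2 * Real.pi), (fourier 0 x : ℂ) = 1 := fun x => fourier_zero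
    simp only [this]
    simp [Measure.real, AddCircle.measure_univ, Real.pi_pos.le]
  · exact integral_eq_zero_of_add_right_eq_neg (fourier_add_half_inv_index h Real.two_pi_pos)

lemma integral_expo (k : ℤ × ℤ) :
    ∫ x : Torus, expo k x = if k = 0 then ((4 * Real.pi ^ 2 : ℝ) : ℂ) else 0 := by
  unfold expo
  rw [Measure.volume_eq_prod,
    integral_prod_mul (fun x => (fourier k.1 x : ℂ)) (fun x => (fourier k.2 x : ℂ)),
    integral_fourier_circle, integral_fourier_circle]
  rcases k with ⟨a, b⟩
  by_cases ha : a = 0 <;> by_cases hb : b = 0 <;> simp [ha, hb]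
  ring

lemma integral_expo_mul_conj (j k : ℤ × ℤ) :
    ∫ x : Torus, expo j x * (starRingEnd ℂ) (expo k x)
      = if j = k then ((4 * Real.pi ^ 2 : ℝ) : ℂ) else 0 := by
  have : ∀ x, expo j x * (starRingEnd ℂ) (expo k x) = expo (j - k) x := by
    intro x; rw [sub_eq_add_neg, expo_add, expo_neg]
  simp only [this, integral_expo, sub_eq_zero]

/-- The star subalgebra of continuous functions on the torus generated by the exponentials. -/
def expoSubalgebra : StarSubalgebra ℂ C(Torus, ℂ) where
  toSubalgebra := Algebra.adjoin ℂ (range expoC)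
  star_mem' := by
    change Algebra.adjoin ℂ (range expoC) ≤ star (Algebra.adjoin ℂ (range expoC))
    refine Algebra.adjoin_le ?_
    rintro _ ⟨n, rfl⟩
    refine Algebra.subset_adjoin ⟨-n, ?_⟩
    ext1 x
    simp only [expoC_apply, expo_neg, starRingEnd_apply, ContinuousMap.star_apply]

lemma expoSubalgebra_coe :
    Subalgebra.toSubmodule expoSubalgebra.toSubalgebra = Submodule.span ℂ (range expoC) := by
  apply Algebra.adjoin_eq_span_of_subset
  refine .trans (fun x ↦ Submonoid.closure_induction (fun _ ↦ id) ⟨0, ?_⟩ ?_) Submodule.subset_span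
  · ext z
    simp [expo_zero]
  · rintro _ _ _ _ ⟨m, rfl⟩ ⟨n, rfl⟩
    refine ⟨m + n, ?_⟩
    ext z
    simp [expo_add]

lemma expoSubalgebra_separatesPoints : expoSubalgebra.SeparatesPoints := by
  intro x y hxy
  have key : x.1 ≠ y.1 ∨ x.2 ≠ y.2 := by
    by_contra! h
    exact hxy (Prod.ext h.1 h.2)
  rcases key with h | h
  · refine ⟨_, ⟨expoC (1, 0), Algebra.subset_adjoin ⟨(1, 0), rfl⟩, rfl⟩, ?_⟩
    contrapose! h
    have h' : (fourier 1 x.1 : ℂ) = fourier 1 y.1 := by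
      simpa [expo] using h
    rw [fourier_one, fourier_one] at h'
    exact AddCircle.injective_toCircle Real.two_pi_pos.ne' (Circle.ext h')
  · refine ⟨_, ⟨expoC (0, 1), Algebra.subset_adjoin ⟨(0, 1), rfl⟩, rfl⟩, ?_⟩
    contrapose! h
    have h' : (fourier 1 x.2 : ℂ) = fourier 1 y.2 := by
      simpa [expo] using h
    rw [fourier_one, fourier_one] at h'
    exact AddCircle.injective_toCircle Real.two_pi_pos.ne' (Circle.ext h')

/-- Stone–Weierstrass: the exponentials are closed under products and conjugation, and the modes (1,
0) and (0, 1) separate points. -/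
lemma span_expoC_closure_eq_top : (Submodule.span ℂ (range expoC)).topologicalClosure = ⊤ := by
  rw [← expoSubalgebra_coe]
  exact congr_arg (Subalgebra.toSubmodule <| StarSubalgebra.toSubalgebra ·)
    (ContinuousMap.starSubalgebra_topologicalClosure_eq_top_of_separatesPoints _
      expoSubalgebra_separatesPoints)

/-- Complex-valued square-integrable functions on the torus. -/
abbrev L2C : Type := Lp ℂ 2 (volume : Measure Torus)

/-- The `L²`-normalized exponentials. -/
def expoLp (k : ℤ × ℤ) : L2C :=
  ((2 * Real.pi : ℝ) : ℂ)⁻¹ • ContinuousMap.toLp (E := ℂ) 2 volume ℂ (expoC k)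

lemma two_pi_cast_ne : ((2 * Real.pi : ℝ) : ℂ) ≠ 0 :=
  Complex.ofReal_ne_zero.mpr Real.two_pi_pos.ne'

lemma orthonormal_expoLp : Orthonormal ℂ expoLp := by
  rw [orthonormal_iff_ite]
  intro m n
  simp only [expoLp, inner_smul_left, inner_smul_right, ContinuousMap.inner_toLp, expoC_apply,
    integral_expo_mul_conj]
  have := two_pi_cast_ne
  by_cases h : m = n
  · simp only [h, if_true, map_inv₀, Complex.conj_ofReal]
    field_simp
    push_cast
    ring
  · rw [if_neg (fun h' => h h'.symm), if_neg h]; simp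

/-- Uniform density passes to L² because continuous functions are dense there; the normalizing
factor does not change the span. -/
lemma span_expoLp_closure_eq_top : (Submodule.span ℂ (range expoLp)).topologicalClosure = ⊤ := by
  have h1 : (Submodule.span ℂ
      (range fun k => ContinuousMap.toLp (E := ℂ) 2 (volume : Measure Torus) ℂ
        (expoC k))).topologicalClosure = ⊤ := by
    simpa only [Submodule.map_span, ContinuousLinearMap.coe_coe, ← range_comp, Function.comp_def]
      using (ContinuousMap.toLp_denseRange ℂ (volume : Measure Torus) ℂ
        (by simp : (2 : ℝ≥0∞) ≠ ⊤)).topologicalClosure_map_submodule span_expoC_closure_eq_top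
  rw [← h1]
  congr 1
  apply le_antisymm
  · rw [Submodule.span_le]
    rintro _ ⟨k, rfl⟩
    exact Submodule.smul_mem _ _ (Submodule.subset_span ⟨k, rfl⟩)
  · rw [Submodule.span_le]
    rintro _ ⟨k, rfl⟩
    have : ContinuousMap.toLp (E := ℂ) 2 (volume : Measure Torus) ℂ (expoC k)
        = ((2 * Real.pi : ℝ) : ℂ) • expoLp k := by
      rw [expoLp, smul_smul, mul_inv_cancel₀ two_pi_cast_ne, one_smul]
    simp only [this]
    exact Submodule.smul_mem _ _ (Submodule.subset_span ⟨k, rfl⟩)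

/-- The Hilbert basis of normalized exponentials of the space of square-integrable functions. -/
def expoBasis : HilbertBasis (ℤ × ℤ) ℂ L2C :=
  HilbertBasis.mk orthonormal_expoLp span_expoLp_closure_eq_top.ge

lemma coe_expoBasis : ⇑expoBasis = expoLp := HilbertBasis.coe_mk _ _

/-- A real square-integrable function as a complex one. -/
def toC (f : L2per) : L2C := Complex.ofRealCLM.compLp f

lemma coeFn_toC (f : L2per) : ∀ᵐ x : Torus, toC f x = (f x : ℂ) := by
  filter_upwards [ContinuousLinearMap.coeFn_compLp Complex.ofRealCLM f] with x hx
  rw [toC, hx]; rfl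

lemma inner_toC (f g : L2per) : inner ℂ (toC f) (toC g) = ((inner ℝ f g : ℝ) : ℂ) := by
  rw [L2.inner_def, L2.inner_def, ← integral_complex_ofReal]
  apply integral_congr_ae
  filter_upwards [coeFn_toC f, coeFn_toC g] with x hf hg
  rw [hf, hg]; simp

lemma inner_expoLp (g : L2C) (k : ℤ × ℤ) :
    inner ℂ (expoLp k) g
      = ((2 * Real.pi : ℝ) : ℂ)⁻¹ * ∫ x : Torus, g x * (starRingEnd ℂ) (expo k x) := by
  rw [expoLp, inner_smul_left, L2.inner_def, map_inv₀, Complex.conj_ofReal]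
  congr 1
  apply integral_congr_ae
  filter_upwards [ContinuousMap.coeFn_toLp (p := 2) (𝕜 := ℂ) (volume : Measure Torus) (expoC k)]
    with x hx
  rw [hx]; simp

lemma inner_expoLp_toC (f : L2per) (k : ℤ × ℤ) :
    inner ℂ (expoLp k) (toC f) = ((2 * Real.pi : ℝ) : ℂ) * fcoef f k := by
  rw [inner_expoLp, fcoef]
  have : ∫ x : Torus, toC f x * (starRingEnd ℂ) (expo k x)
      = ∫ x : Torus, (f x : ℂ) * (starRingEnd ℂ) (expo k x) := by
    apply integral_congr_ae
    filter_upwards [coeFn_toC f] with x hx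
    rw [hx]
  rw [this, ← mul_assoc]
  congr 1
  have := two_pi_cast_ne
  push_cast at this ⊢
  field_simp
  ring

/-- **Parseval's identity**. -/
lemma hasSum_inner (f g : L2per) :
    HasSum (fun k => 4 * Real.pi ^ 2 * (fcoef f k * (starRingEnd ℂ) (fcoef g k)).re)
      (inner ℝ f g) := by
  have h := expoBasis.hasSum_inner_mul_inner (toC g) (toC f)
  rw [inner_toC, real_inner_comm, coe_expoBasis] at h
  have h2 := Complex.hasSum_re h
  rw [Complex.ofReal_re] at h2
  refine h2.congr_fun ?_
  intro k
  rw [← inner_conj_symm (toC g), inner_expoLp_toC, inner_expoLp_toC, map_mul, Complex.conj_ofReal]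
  rw [show ((2 * Real.pi : ℝ) : ℂ) * (starRingEnd ℂ) (fcoef g k) * (((2 * Real.pi : ℝ) : ℂ)
    * fcoef f k) = ((4 * Real.pi ^ 2 : ℝ) : ℂ) * (fcoef f k * (starRingEnd ℂ) (fcoef g k)) by
      push_cast; ring, Complex.re_ofReal_mul]

lemma hasSum_norm_sq (f : L2per) :
    HasSum (fun k => 4 * Real.pi ^ 2 * ‖fcoef f k‖ ^ 2) (‖f‖ ^ 2) := by
  have h := hasSum_inner f f
  rw [real_inner_self_eq_norm_sq] at h
  refine h.congr_fun fun k => ?_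
  rw [Complex.mul_conj, Complex.ofReal_re, Complex.normSq_eq_norm_sq]

lemma summable_norm_sq_fcoef (f : L2per) : Summable fun k => ‖fcoef f k‖ ^ 2 := by
  have := (hasSum_norm_sq f).summable
  rwa [summable_mul_left_iff (by positivity)] at this

lemma toC_injective : Function.Injective toC := by
  intro f g h
  apply Lp.ext
  filter_upwards [coeFn_toC f, coeFn_toC g] with x hf hg
  rw [h, hg] at hf
  exact_mod_cast hf.symm

/-- Completeness of the exponentials. Identities between the operators below are checked coefficient
by coefficient through it. -/
lemma fcoef_injective {f g : L2per} (h : ∀ k, fcoef f k = fcoef g k) : f = g := by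
  apply toC_injective
  apply expoBasis.repr.injective
  apply lp.ext
  funext k
  rw [HilbertBasis.repr_apply_apply, HilbertBasis.repr_apply_apply, coe_expoBasis,
    inner_expoLp_toC, inner_expoLp_toC, h]

lemma fcoef_add (f g : L2per) (k : ℤ × ℤ) : fcoef (f + g) k = fcoef f k + fcoef g k := by
  have h : toC (f + g) = toC f + toC g := by
    apply Lp.ext
    filter_upwards [coeFn_toC (f + g), Lp.coeFn_add (toC f) (toC g), coeFn_toC f, coeFn_toC g,
      Lp.coeFn_add f g] with x h1 h2 h3 h4 h5
    rw [h1, h2, Pi.add_apply, h3, h4, h5]; simp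
  apply mul_left_cancel₀ two_pi_cast_ne
  rw [mul_add, ← inner_expoLp_toC, ← inner_expoLp_toC, ← inner_expoLp_toC, h, inner_add_right]

lemma fcoef_smul (c : ℝ) (f : L2per) (k : ℤ × ℤ) : fcoef (c • f) k = (c : ℂ) * fcoef f k := by
  have h : toC (c • f) = (c : ℂ) • toC f := by
    apply Lp.ext
    filter_upwards [coeFn_toC (c • f), Lp.coeFn_smul (c : ℂ) (toC f), coeFn_toC f,
      Lp.coeFn_smul c f] with x h1 h2 h3 h4
    rw [h1, h2, Pi.smul_apply, h3, h4]; simp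
  apply mul_left_cancel₀ two_pi_cast_ne
  rw [mul_left_comm, ← inner_expoLp_toC, ← inner_expoLp_toC, h, inner_smul_right]

lemma fcoef_sub (f g : L2per) (k : ℤ × ℤ) : fcoef (f - g) k = fcoef f k - fcoef g k := by
  have := fcoef_add f ((-1 : ℝ) • g) k
  rw [fcoef_smul] at this
  rw [show f - g = f + (-1 : ℝ) • g by rw [neg_one_smul, sub_eq_add_neg], this]
  push_cast; ring

lemma fcoef_neg (f : L2per) (k : ℤ × ℤ) : fcoef f (-k) = (starRingEnd ℂ) (fcoef f k) := by
  unfold fcoef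
  rw [map_mul, map_inv₀, Complex.conj_ofReal, ← integral_conj]
  simp [expo_neg]

/-- **Riesz–Fischer theorem** for real-valued functions. -/
lemma exists_fcoef_eq (c : ℤ × ℤ → ℂ) (hc : ∀ k, c (-k) = (starRingEnd ℂ) (c k))
    (hs : Summable fun k => ‖c k‖ ^ 2) : ∃ f : L2per, ∀ k, fcoef f k = c k := by
  have hmem : Memℓp (fun k => ((2 * Real.pi : ℝ) : ℂ) * c k) 2 := by
    apply memℓp_gen
    have : (fun k => ‖((2 * Real.pi : ℝ) : ℂ) * c k‖ ^ (2 : ℝ≥0∞).toReal)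
        = fun k => (2 * Real.pi) ^ 2 * ‖c k‖ ^ 2 := by
      funext k
      rw [norm_mul, Complex.norm_real, Real.norm_of_nonneg Real.two_pi_pos.le]
      simp [mul_pow]
    rw [this]
    exact hs.mul_left _
  set g : L2C := expoBasis.repr.symm ⟨_, hmem⟩ with hg
  have hcoef : ∀ k, ∫ x : Torus, g x * (starRingEnd ℂ) (expo k x)
      = ((4 * Real.pi ^ 2 : ℝ) : ℂ) * c k := by
    intro k
    have h1 : expoBasis.repr g k = ((2 * Real.pi : ℝ) : ℂ) * c k := by
      rw [hg, LinearIsometryEquiv.apply_symm_apply]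
    rw [HilbertBasis.repr_apply_apply, coe_expoBasis, inner_expoLp] at h1
    have := two_pi_cast_ne
    rw [inv_mul_eq_iff_eq_mul₀ this] at h1
    rw [h1]; push_cast; ring
  have hgint : Integrable (fun x => g x) (volume : Measure Torus) :=
    (Lp.memLp g).integrable (by norm_num)
  -- It is not necessary to show that g is real: its real part has the coefficients (c k + conj (c
  -- (-k))) / 2, which equal c k by `hc`.
  refine ⟨Complex.reCLM.compLp g, fun k => ?_⟩
  have hi : ∀ j, Integrable (fun x => g x * (starRingEnd ℂ) (expo j x)) (volume : Measure Torus) :=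
    fun j => hgint.mul_bdd (c := 1)
      ((Complex.continuous_conj.comp (continuous_expo j)).aestronglyMeasurable)
      (ae_of_all _ fun x => by rw [RCLike.norm_conj, norm_expo])
  have h2 : ∫ x : Torus, ((Complex.reCLM.compLp g) x : ℂ) * (starRingEnd ℂ) (expo k x)
      = ((4 * Real.pi ^ 2 : ℝ) : ℂ) * c k := by
    have h3 : ∀ᵐ x : Torus, ((Complex.reCLM.compLp g) x : ℂ) * (starRingEnd ℂ) (expo k x)
        = (1 / 2 : ℂ) * (g x * (starRingEnd ℂ) (expo k x)
          + (starRingEnd ℂ) (g x * (starRingEnd ℂ) (expo (-k) x))) := by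
      filter_upwards [ContinuousLinearMap.coeFn_compLp Complex.reCLM g] with x hx
      rw [hx, expo_neg, Complex.reCLM_apply, Complex.re_eq_add_conj]
      simp only [map_mul, Complex.conj_conj]
      ring
    rw [integral_congr_ae h3, integral_const_mul, integral_add (hi k), integral_conj, hcoef, hcoef,
      hc]
    · simp only [map_mul, Complex.conj_conj, Complex.conj_ofReal]; ring
    · exact (Complex.conjCLE.toContinuousLinearMap.integrable_comp (hi (-k)))
  rw [fcoef, h2, inv_mul_cancel_left₀]
  exact Complex.ofReal_ne_zero.mpr (by positivity)

/-- A function with absolutely summable Fourier coefficients is the sum of its Fourier series. -/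
lemma ae_eq_tsum_fourier (f : L2per) (hf : Summable fun k => ‖fcoef f k‖) :
    ∀ᵐ x : Torus, (f x : ℂ) = ∑' k, fcoef f k * expo k x := by
  have hs : Summable fun k => fcoef f k • expoC k := by
    apply Summable.of_norm
    refine hf.of_nonneg_of_le (fun _ => norm_nonneg _) fun k => ?_
    rw [norm_smul]
    refine mul_le_of_le_one_right (norm_nonneg _) ?_
    exact (ContinuousMap.norm_le _ zero_le_one).mpr fun x => (norm_expo k x).le
  obtain ⟨G, hG⟩ := hs
  have h1 := hG.map (ContinuousMap.toLp (E := ℂ) 2 (volume : Measure Torus) ℂ)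
    (ContinuousMap.toLp (E := ℂ) 2 (volume : Measure Torus) ℂ).continuous
  have h2 := expoBasis.hasSum_repr (toC f)
  -- The series converges uniformly to G, hence in L², where its sum is already known to be f.
  have h3 : ContinuousMap.toLp (E := ℂ) 2 (volume : Measure Torus) ℂ G = toC f := by
    refine h1.unique (h2.congr_fun fun k => ?_)
    rw [HilbertBasis.repr_apply_apply, coe_expoBasis, inner_expoLp_toC, expoLp, smul_smul,
      Function.comp_apply, map_smul]
    congr 1
    have := two_pi_cast_ne
    field_simp
  filter_upwards [coeFn_toC f,
    ContinuousMap.coeFn_toLp (p := 2) (𝕜 := ℂ) (volume : Measure Torus) G] with x hx hx2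
  rw [← hx, ← h3, hx2]
  have := hG.map (ContinuousMap.evalCLM ℂ x) (ContinuousMap.evalCLM ℂ x).continuous
  exact (this.tsum_eq).symm

lemma ae_abs_le_tsum (f : L2per) (hf : Summable fun k => ‖fcoef f k‖) :
    ∀ᵐ x : Torus, |f x| ≤ ∑' k, ‖fcoef f k‖ := by
  filter_upwards [ae_eq_tsum_fourier f hf] with x hx
  have : |f x| = ‖(f x : ℂ)‖ := by rw [Complex.norm_real]; rfl
  rw [this, hx]
  have h : ∀ k, ‖fcoef f k * expo k x‖ = ‖fcoef f k‖ := fun k => by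
    rw [norm_mul, norm_expo, mul_one]
  refine (norm_tsum_le_tsum_norm (by simpa only [h] using hf)).trans ?_
  simp only [h, le_refl]

end

end SAVWave

/-! ### Truncated Fourier multipliers and the space X_N. -/

namespace SAVWave

noncomputable section

lemma freqSq_nonneg (k : ℤ × ℤ) : 0 ≤ freqSq k := by unfold freqSq; positivity

lemma freqSq_neg (k : ℤ × ℤ) : freqSq (-k) = freqSq k := by simp [freqSq]

lemma freqSq_zero_iff (k : ℤ × ℤ) : freqSq k = 0 ↔ k = 0 := by
  constructor
  · intro h
    unfold freqSq at h
    have h1 : (k.1 : ℝ) = 0 := by nlinarith [sq_nonneg (k.1 : ℝ), sq_nonneg (k.2 : ℝ)]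
    have h2 : (k.2 : ℝ) = 0 := by nlinarith [sq_nonneg (k.1 : ℝ), sq_nonneg (k.2 : ℝ)]
    exact Prod.ext (by exact_mod_cast h1) (by exact_mod_cast h2)
  · rintro rfl; simp [freqSq]

lemma one_le_freqSq {k : ℤ × ℤ} (hk : k ≠ 0) : 1 ≤ freqSq k := by
  have h0 : freqSq k = ((k.1 ^ 2 + k.2 ^ 2 : ℤ) : ℝ) := by simp [freqSq]
  have h1 : 0 < freqSq k := lt_of_le_of_ne (freqSq_nonneg k)
    (fun h => hk ((freqSq_zero_iff k).1 h.symm))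
  rw [h0] at h1 ⊢
  exact_mod_cast h1

/-- The modes occurring in real-valued functions of `XN N`. -/
def SymMode (N : ℕ) (k : ℤ × ℤ) : Prop := IsMode N k ∧ IsMode N (-k)

lemma symMode_neg {N : ℕ} {k : ℤ × ℤ} : SymMode N (-k) ↔ SymMode N k := by
  unfold SymMode; rw [neg_neg, and_comm]

lemma symMode_iff {N : ℕ} {k : ℤ × ℤ} :
    SymMode N k ↔ |(k.1 : ℝ)| ≤ (N : ℝ) / 2 - 1 ∧ |(k.2 : ℝ)| ≤ (N : ℝ) / 2 - 1 := by
  simp only [SymMode, IsMode, abs_le, Prod.fst_neg, Prod.snd_neg, Int.cast_neg]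
  constructor
  · rintro ⟨⟨⟨_, _⟩, _, _⟩, ⟨_, _⟩, _, _⟩
    refine ⟨⟨?_, ?_⟩, ?_, ?_⟩ <;> linarith
  · rintro ⟨⟨_, _⟩, _, _⟩
    refine ⟨⟨⟨?_, ?_⟩, ?_, ?_⟩, ⟨?_, ?_⟩, ?_, ?_⟩ <;> linarith

/-- Since N/2 - 1 ≥ N/4 for N ≥ 4; this is the origin of the restriction N ≥ 4 in the error
analysis. -/
lemma le_freqSq_of_not_symMode {N : ℕ} (hN : 4 ≤ N) {k : ℤ × ℤ} (h : ¬ SymMode N k) :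
    ((N : ℝ) / 4) ^ 2 ≤ freqSq k := by
  rw [symMode_iff, not_and_or, not_le, not_le] at h
  have hN' : (4 : ℝ) ≤ N := by exact_mod_cast hN
  unfold freqSq
  rcases h with h | h
  · have : ((N : ℝ) / 4) ^ 2 ≤ (k.1 : ℝ) ^ 2 := by
      rw [sq_le_sq, abs_of_nonneg (by positivity : (0 : ℝ) ≤ N / 4)]; linarith
    nlinarith [sq_nonneg (k.2 : ℝ)]
  · have : ((N : ℝ) / 4) ^ 2 ≤ (k.2 : ℝ) ^ 2 := by
      rw [sq_le_sq, abs_of_nonneg (by positivity : (0 : ℝ) ≤ N / 4)]; linarith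
    nlinarith [sq_nonneg (k.1 : ℝ)]

lemma finite_symMode (N : ℕ) : {k | SymMode N k}.Finite := by
  refine (((finite_Icc (-(N : ℤ)) N).prod (finite_Icc (-(N : ℤ)) N))).subset ?_
  intro k hk
  have hN : (0 : ℝ) ≤ N := Nat.cast_nonneg N
  rw [mem_ofPred_eq, symMode_iff, abs_le, abs_le] at hk
  obtain ⟨⟨h1, h2⟩, h3, h4⟩ := hk
  refine ⟨⟨?_, ?_⟩, ?_, ?_⟩
  · have : -(N : ℝ) ≤ k.1 := by linarith
    exact_mod_cast this
  · have : (k.1 : ℝ) ≤ N := by linarith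
    exact_mod_cast this
  · have : -(N : ℝ) ≤ k.2 := by linarith
    exact_mod_cast this
  · have : (k.2 : ℝ) ≤ N := by linarith
    exact_mod_cast this

lemma exists_symMode_of_finset (S : Finset (ℤ × ℤ)) : ∃ N, ∀ k ∈ S, SymMode N k := by
  refine ⟨2 * (∑ k ∈ S, (k.1.natAbs + k.2.natAbs) + 1), fun k hk => ?_⟩
  have h := Finset.single_le_sum (f := fun k : ℤ × ℤ => k.1.natAbs + k.2.natAbs)
    (fun _ _ => Nat.zero_le _) hk
  have h' : ((k.1.natAbs : ℝ) + k.2.natAbs)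
      ≤ ((∑ k ∈ S, (k.1.natAbs + k.2.natAbs) : ℕ) : ℝ) := by exact_mod_cast h
  rw [Nat.cast_natAbs, Nat.cast_natAbs, Int.cast_abs, Int.cast_abs] at h'
  rw [symMode_iff, Nat.cast_mul, Nat.cast_add]
  have := abs_nonneg (k.1 : ℝ)
  have := abs_nonneg (k.2 : ℝ)
  push_cast at h' ⊢
  constructor <;> linarith

lemma norm_sq_le_of_fcoef {f : L2per} {c : ℤ × ℤ → ℝ} (hc : Summable c)
    (h : ∀ k, ‖fcoef f k‖ ^ 2 ≤ c k) : ‖f‖ ^ 2 ≤ 4 * Real.pi ^ 2 * ∑' k, c k := by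
  rw [← (hasSum_norm_sq f).tsum_eq, tsum_mul_left]
  gcongr
  · exact summable_norm_sq_fcoef f
  · exact h _

lemma norm_le_of_fcoef_le {f g : L2per} (h : ∀ k, ‖fcoef f k‖ ≤ ‖fcoef g k‖) : ‖f‖ ≤ ‖g‖ := by
  refine le_of_sq_le_sq ?_ (norm_nonneg g)
  rw [← (hasSum_norm_sq g).tsum_eq, tsum_mul_left]
  exact norm_sq_le_of_fcoef (summable_norm_sq_fcoef g)
    fun k => pow_le_pow_left₀ (norm_nonneg _) (h k) 2

open Classical in
/-- The symbol of the truncated fractional Laplacian. -/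
def modeMul (N : ℕ) (β : ℝ) (k : ℤ × ℤ) : ℝ := if SymMode N k then freqSq k ^ β else 0

lemma modeMul_of_mem {N : ℕ} {k : ℤ × ℤ} (h : SymMode N k) (β : ℝ) :
    modeMul N β k = freqSq k ^ β := if_pos h

lemma modeMul_of_not_mem {N : ℕ} {k : ℤ × ℤ} (h : ¬ SymMode N k) (β : ℝ) :
    modeMul N β k = 0 := if_neg h

lemma modeMul_nonneg (N : ℕ) (β : ℝ) (k : ℤ × ℤ) : 0 ≤ modeMul N β k := by
  unfold modeMul
  split_ifs
  · exact Real.rpow_nonneg (freqSq_nonneg k) β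
  · exact le_rfl

lemma modeMul_neg (N : ℕ) (β : ℝ) (k : ℤ × ℤ) : modeMul N β (-k) = modeMul N β k := by
  by_cases h : SymMode N k
  · rw [modeMul_of_mem h, modeMul_of_mem (symMode_neg.2 h), freqSq_neg]
  · rw [modeMul_of_not_mem h, modeMul_of_not_mem (mt symMode_neg.1 h)]

lemma exists_modeMul_le (N : ℕ) (β : ℝ) : ∃ C, 0 ≤ C ∧ ∀ k, modeMul N β k ≤ C := by
  refine ⟨∑ k ∈ (finite_symMode N).toFinset, modeMul N β k,
    Finset.sum_nonneg fun k _ => modeMul_nonneg N β k, fun k => ?_⟩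
  by_cases h : SymMode N k
  · exact Finset.single_le_sum (fun k _ => modeMul_nonneg N β k) (by simpa using h)
  · rw [modeMul_of_not_mem h]
    exact Finset.sum_nonneg fun k _ => modeMul_nonneg N β k

lemma exists_fcoef_eq_mul (N : ℕ) (β : ℝ) (f : L2per) :
    ∃ g : L2per, ∀ k, fcoef g k = (modeMul N β k : ℂ) * fcoef f k := by
  apply exists_fcoef_eq
  · intro k
    rw [modeMul_neg, fcoef_neg, map_mul, Complex.conj_ofReal]
  · obtain ⟨C, hC0, hC⟩ := exists_modeMul_le N β
    refine ((summable_norm_sq_fcoef f).mul_left (C ^ 2)).of_nonneg_of_le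
      (fun k => by positivity) fun k => ?_
    rw [norm_mul, mul_pow, Complex.norm_real, Real.norm_of_nonneg (modeMul_nonneg N β k)]
    gcongr
    · exact modeMul_nonneg N β k
    · exact hC k

/-- The operator `(-Δ)^β P_N`, a continuous linear map. -/
def specOp (N : ℕ) (β : ℝ) : L2per →L[ℝ] L2per :=
  LinearMap.mkContinuousOfExistsBound
    { toFun := fun f => (exists_fcoef_eq_mul N β f).choose
      map_add' := fun f g => fcoef_injective fun k => by
        rw [fcoef_add]
        simp only [(exists_fcoef_eq_mul N β _).choose_spec]
        rw [fcoef_add, mul_add]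
      map_smul' := fun c f => fcoef_injective fun k => by
        rw [RingHom.id_apply, fcoef_smul]
        simp only [(exists_fcoef_eq_mul N β _).choose_spec]
        rw [fcoef_smul]; ring }
    (by
      obtain ⟨C, hC0, hC⟩ := exists_modeMul_le N β
      refine ⟨C, fun f => ?_⟩
      rw [← abs_of_nonneg hC0, ← Real.norm_eq_abs, ← norm_smul]
      refine norm_le_of_fcoef_le fun k => ?_
      simp only [LinearMap.coe_mk, AddHom.coe_mk, (exists_fcoef_eq_mul N β _).choose_spec]
      rw [fcoef_smul, norm_mul, norm_mul, Complex.norm_real, Complex.norm_real,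
        Real.norm_of_nonneg hC0, Real.norm_of_nonneg (modeMul_nonneg N β k)]
      gcongr
      exact hC k)

lemma fcoef_specOp (N : ℕ) (β : ℝ) (f : L2per) (k : ℤ × ℤ) :
    fcoef (specOp N β f) k = (modeMul N β k : ℂ) * fcoef f k :=
  (exists_fcoef_eq_mul N β f).choose_spec k

/-- The signs of the exponents matter only at the zero mode, where powers of `freqSq 0 = 0` are
added. Because 0 ^ 0 = 1, the mean survives in `specOp N 0`, which is therefore P_N. -/
lemma specOp_specOp {N : ℕ} {β γ : ℝ} (hβ : 0 ≤ β) (hγ : 0 ≤ γ) (f : L2per) :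
    specOp N β (specOp N γ f) = specOp N (β + γ) f := by
  refine fcoef_injective fun k => ?_
  rw [fcoef_specOp, fcoef_specOp, fcoef_specOp, ← mul_assoc, ← Complex.ofReal_mul]
  congr 2
  by_cases h : SymMode N k
  · rw [modeMul_of_mem h, modeMul_of_mem h, modeMul_of_mem h,
      Real.rpow_add_of_nonneg (freqSq_nonneg k) hβ hγ]
  · rw [modeMul_of_not_mem h, modeMul_of_not_mem h, modeMul_of_not_mem h, zero_mul]

lemma inner_specOp_left (N : ℕ) (β : ℝ) (f g : L2per) :
    inner ℝ (specOp N β f) g = inner ℝ f (specOp N β g) := by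
  refine (hasSum_inner _ _).unique ((hasSum_inner _ _).congr_fun fun k => ?_)
  rw [fcoef_specOp, fcoef_specOp, map_mul, Complex.conj_ofReal]
  congr 2
  ring

/-- The range -N/2, ..., N/2 - 1 is not symmetric. For a real function the coefficients at k and -k
are conjugate, so a mode whose opposite is missing cannot occur. -/
lemma fcoef_of_mem_XN {N : ℕ} {f : L2per} (hf : f ∈ XN N) {k : ℤ × ℤ} (hk : ¬ SymMode N k) :
    fcoef f k = 0 := by
  obtain ⟨S, hS, hfS⟩ := hf
  have key : ∀ j, ¬ IsMode N j → fcoef f j = 0 := by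
    intro j hj
    have h1 : ∫ x : Torus, (f x : ℂ) * (starRingEnd ℂ) (expo j x)
        = ∫ x : Torus, S x * (starRingEnd ℂ) (expo j x) := by
      apply integral_congr_ae
      filter_upwards [hfS] with x hx
      rw [hx]
    have h2 : Continuous S ∧ ∫ x : Torus, S x * (starRingEnd ℂ) (expo j x) = 0 := by
      clear h1 hfS
      have hc : Continuous fun x => (starRingEnd ℂ) (expo j x) :=
        Complex.continuous_conj.comp (continuous_expo j)
      have hint : ∀ g : Torus → ℂ, Continuous g →
          Integrable (fun x => g x * (starRingEnd ℂ) (expo j x)) (volume : Measure Torus) :=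
        fun g hg => (hg.mul hc).integrable_of_hasCompactSupport
          (HasCompactSupport.of_compactSpace _)
      induction hS using Submodule.span_induction with
      | mem x hx =>
        obtain ⟨i, hi, rfl⟩ := hx
        refine ⟨continuous_expo i, ?_⟩
        rw [integral_expo_mul_conj, if_neg]
        rintro rfl
        exact hj hi
      | zero => exact ⟨continuous_zero, by simp⟩
      | add x y _ _ hx hy =>
        refine ⟨hx.1.add hy.1, ?_⟩
        simp only [Pi.add_apply, add_mul]
        rw [integral_add (hint x hx.1) (hint y hy.1), hx.2, hy.2, add_zero]
      | smul c x _ hx =>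
        refine ⟨hx.1.const_smul c, ?_⟩
        simp only [Pi.smul_apply, smul_eq_mul, mul_assoc]
        rw [integral_const_mul, hx.2, mul_zero]
    rw [fcoef, h1, h2.2, mul_zero]
  by_cases h : IsMode N k
  · have h' : ¬ IsMode N (-k) := fun h' => hk ⟨h, h'⟩
    have := key _ h'
    rw [fcoef_neg] at this
    simpa using this
  · exact key k h

/-- Describes X_N as the fixed space of a linear map, from which its closure properties are
immediate. -/
lemma mem_XN_iff {N : ℕ} {f : L2per} : f ∈ XN N ↔ specOp N 0 f = f := by
  constructor
  · intro hf
    refine fcoef_injective fun k => ?_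
    rw [fcoef_specOp]
    by_cases h : SymMode N k
    · rw [modeMul_of_mem h, Real.rpow_zero]; simp
    · rw [modeMul_of_not_mem h, fcoef_of_mem_XN hf h]; simp
  · intro hf
    have h0 : ∀ k, ¬ SymMode N k → fcoef f k = 0 := by
      intro k hk
      rw [← hf, fcoef_specOp, modeMul_of_not_mem hk]; simp
    have hz : ∀ k ∉ (finite_symMode N).toFinset, fcoef f k = 0 := fun k hk =>
      h0 k (by simpa using hk)
    have hs : Summable fun k => ‖fcoef f k‖ :=
      summable_of_ne_finset_zero (s := (finite_symMode N).toFinset) fun k hk => by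
        rw [hz k hk, norm_zero]
    refine ⟨fun x => ∑ k ∈ (finite_symMode N).toFinset, fcoef f k * expo k x, ?_, ?_⟩
    · have : (fun x => ∑ k ∈ (finite_symMode N).toFinset, fcoef f k * expo k x)
          = ∑ k ∈ (finite_symMode N).toFinset, fcoef f k • expo k := by
        funext x; simp
      rw [this]
      refine Submodule.sum_mem _ fun k hk => Submodule.smul_mem _ _ (Submodule.subset_span ⟨k, ?_, rfl⟩)
      have : SymMode N k := by simpa using hk
      exact this.1
    · filter_upwards [ae_eq_tsum_fourier f hs] with x hx
      rw [hx]
      exact tsum_eq_sum fun k hk => by rw [hz k hk, zero_mul]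

lemma specOp_mem_XN (N : ℕ) {β : ℝ} (hβ : 0 ≤ β) (f : L2per) : specOp N β f ∈ XN N := by
  rw [mem_XN_iff, specOp_specOp le_rfl hβ, zero_add]

lemma specOp_zero_of_mem {N : ℕ} {f : L2per} (hf : f ∈ XN N) : specOp N 0 f = f :=
  mem_XN_iff.1 hf

lemma add_mem_XN {N : ℕ} {f g : L2per} (hf : f ∈ XN N) (hg : g ∈ XN N) : f + g ∈ XN N := by
  rw [mem_XN_iff] at *; rw [map_add, hf, hg]

lemma sub_mem_XN {N : ℕ} {f g : L2per} (hf : f ∈ XN N) (hg : g ∈ XN N) : f - g ∈ XN N := by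
  rw [mem_XN_iff] at *; rw [map_sub, hf, hg]

lemma smul_mem_XN {N : ℕ} (c : ℝ) {f : L2per} (hf : f ∈ XN N) : c • f ∈ XN N := by
  rw [mem_XN_iff] at *; rw [map_smul, hf]

lemma eq_of_inner_eq {N : ℕ} {f g : L2per} (hf : f ∈ XN N) (hg : g ∈ XN N)
    (h : ∀ ψ ∈ XN N, inner ℝ f ψ = inner ℝ g ψ) : f = g := by
  have h1 := h _ (sub_mem_XN hf hg)
  rw [← sub_eq_zero, ← inner_sub_left, inner_self_eq_zero, sub_eq_zero] at h1
  exact h1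

lemma IsProj.eq {N : ℕ} {w p : L2per} (h : IsProj N w p) : p = specOp N 0 w := by
  refine eq_of_inner_eq h.1 (specOp_mem_XN N le_rfl w) fun ψ hψ => ?_
  have := h.2 ψ hψ
  rw [inner_sub_left, sub_eq_zero] at this
  rw [← this, inner_specOp_left, specOp_zero_of_mem hψ]

lemma norm_specOp_zero_le (N : ℕ) (f : L2per) : ‖specOp N 0 f‖ ≤ ‖f‖ := by
  refine norm_le_of_fcoef_le fun k => ?_
  rw [fcoef_specOp]
  by_cases h : SymMode N k
  · rw [modeMul_of_mem h, Real.rpow_zero]; simp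
  · rw [modeMul_of_not_mem h]; simp

lemma fracLap_spec {β : ℝ} {f : L2per}
    (h : ∃ g : L2per, ∀ k, fcoef g k = ((freqSq k ^ β : ℝ) : ℂ) * fcoef f k) (k : ℤ × ℤ) :
    fcoef (fracLap β f) k = ((freqSq k ^ β : ℝ) : ℂ) * fcoef f k := by
  rw [fracLap, dif_pos h]
  exact h.choose_spec k

lemma fracLap_of_mem_XN {N : ℕ} {f : L2per} (hf : f ∈ XN N) (β : ℝ) :
    fracLap β f = specOp N β f := by
  have h : ∀ k, fcoef (specOp N β f) k = ((freqSq k ^ β : ℝ) : ℂ) * fcoef f k := by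
    intro k
    rw [fcoef_specOp]
    by_cases hk : SymMode N k
    · rw [modeMul_of_mem hk]
    · rw [fcoef_of_mem_XN hf hk]; simp
  refine fcoef_injective fun k => ?_
  rw [fracLap_spec ⟨_, h⟩, h]

/-- The operator is moved onto the test function, which has only finitely many modes; f itself need
only lie in the domain. -/
lemma inner_fracLap {N : ℕ} {β : ℝ} {f φ : L2per}
    (h : ∃ g : L2per, ∀ k, fcoef g k = ((freqSq k ^ β : ℝ) : ℂ) * fcoef f k) (hφ : φ ∈ XN N) :
    inner ℝ (fracLap β f) φ = inner ℝ f (specOp N β φ) := by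
  refine (hasSum_inner _ _).unique ((hasSum_inner _ _).congr_fun fun k => ?_)
  rw [fracLap_spec h, fcoef_specOp, map_mul, Complex.conj_ofReal]
  by_cases hk : SymMode N k
  · rw [modeMul_of_mem hk]; congr 2; ring
  · rw [fcoef_of_mem_XN hφ hk]; simp

lemma norm_sq_specOp (N : ℕ) (β : ℝ) (f : L2per) :
    HasSum (fun k => 4 * Real.pi ^ 2 * (modeMul N β k ^ 2 * ‖fcoef f k‖ ^ 2))
      (‖specOp N β f‖ ^ 2) := by
  refine (hasSum_norm_sq _).congr_fun fun k => ?_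
  rw [fcoef_specOp, norm_mul, mul_pow, Complex.norm_real, Real.norm_of_nonneg (modeMul_nonneg N β k)]

/-- `f` has a finite semi-norm of order `2β`, at most `B` in the unnormalized scaling. -/
def SemiBound (β B : ℝ) (f : L2per) : Prop := ∀ N, ‖specOp N β f‖ ≤ B

lemma SemiBound.nonneg {β B : ℝ} {f : L2per} (h : SemiBound β B f) : 0 ≤ B :=
  (norm_nonneg _).trans (h 0)

lemma rpow_two_mul_freqSq (k : ℤ × ℤ) (β : ℝ) : (freqSq k ^ β) ^ 2 = freqSq k ^ (2 * β) := by
  rw [← Real.rpow_natCast, ← Real.rpow_mul (freqSq_nonneg k)]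
  congr 1; push_cast; ring

/-- A finite set of modes is contained in `SymMode N` for some N, so bounds uniform in N control all
partial sums. -/
lemma SemiBound.sum_le {β B : ℝ} {f : L2per} (h : SemiBound β B f) (S : Finset (ℤ × ℤ)) :
    ∑ k ∈ S, freqSq k ^ (2 * β) * ‖fcoef f k‖ ^ 2 ≤ B ^ 2 / (4 * Real.pi ^ 2) := by
  obtain ⟨N, hN⟩ := exists_symMode_of_finset S
  rw [le_div_iff₀' (by positivity), Finset.mul_sum]
  have h1 := sum_le_hasSum S (fun k _ => by positivity) (norm_sq_specOp N β f)
  have h2 : ‖specOp N β f‖ ^ 2 ≤ B ^ 2 := pow_le_pow_left₀ (norm_nonneg _) (h N) 2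
  refine le_trans (le_of_eq ?_) (h1.trans h2)
  refine Finset.sum_congr rfl fun k hk => ?_
  rw [modeMul_of_mem (hN k hk), rpow_two_mul_freqSq]

lemma SemiBound.summable {β B : ℝ} {f : L2per} (h : SemiBound β B f) :
    Summable fun k => freqSq k ^ (2 * β) * ‖fcoef f k‖ ^ 2 :=
  summable_of_sum_le (fun k => mul_nonneg (Real.rpow_nonneg (freqSq_nonneg k) _) (sq_nonneg _))
    h.sum_le

lemma SemiBound.exists_fracLap {β B : ℝ} {f : L2per} (h : SemiBound β B f) :
    ∃ g : L2per, ∀ k, fcoef g k = ((freqSq k ^ β : ℝ) : ℂ) * fcoef f k := by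
  apply exists_fcoef_eq
  · intro k
    rw [freqSq_neg, fcoef_neg, map_mul, Complex.conj_ofReal]
  · refine h.summable.congr fun k => ?_
    rw [norm_mul, mul_pow, Complex.norm_real,
      Real.norm_of_nonneg (Real.rpow_nonneg (freqSq_nonneg k) _), rpow_two_mul_freqSq]

/-- Every mode of f is already present at level N; another truncation can only remove some. -/
lemma SemiBound.of_mem_XN {N : ℕ} {β B : ℝ} {f : L2per} (hf : f ∈ XN N)
    (h : ‖specOp N β f‖ ≤ B) : SemiBound β B f := by
  intro N'
  refine le_trans (norm_le_of_fcoef_le fun k => ?_) h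
  rw [fcoef_specOp, fcoef_specOp]
  by_cases hk : SymMode N k
  · rw [modeMul_of_mem hk, norm_mul, norm_mul]
    gcongr
    by_cases hk' : SymMode N' k
    · rw [modeMul_of_mem hk']
    · rw [modeMul_of_not_mem hk']; simp
  · rw [fcoef_of_mem_XN hf hk]; simp

end

end SAVWave

/-! ### Sobolev norms: projection errors and the embedding into L^∞. -/

namespace SAVWave

noncomputable section

/-- L is not assumed nonnegative; `ENNReal.ofReal L` only sees `max L 0`, which therefore appears in
all bounds below. -/
lemma sobNorm_le_iff_tsum {ρ L : ℝ} {f : L2per} (h : sobNorm ρ f ≤ ENNReal.ofReal L) :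
    ∑' k : ℤ × ℤ, ENNReal.ofReal ((1 + freqSq k) ^ ρ * ‖fcoef f k‖ ^ 2)
      ≤ ENNReal.ofReal ((max L 0) ^ 2) := by
  have h1 := ENNReal.rpow_le_rpow h (by norm_num : (0 : ℝ) ≤ 2)
  rw [sobNorm, ← ENNReal.rpow_mul] at h1
  norm_num at h1
  refine h1.trans (le_of_eq ?_)
  rw [ENNReal.ofReal_pow (le_max_right _ _)]
  congr 1
  rcases le_total L 0 with hL | hL
  · rw [max_eq_right hL, ENNReal.ofReal_of_nonpos hL, ENNReal.ofReal_zero]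
  · rw [max_eq_left hL]

lemma sobolev_nonneg (ρ : ℝ) (f : L2per) (k : ℤ × ℤ) :
    0 ≤ (1 + freqSq k) ^ ρ * ‖fcoef f k‖ ^ 2 :=
  mul_nonneg (Real.rpow_nonneg (by linarith [freqSq_nonneg k]) _) (sq_nonneg _)

lemma summable_of_sobNorm_le {ρ L : ℝ} {f : L2per} (h : sobNorm ρ f ≤ ENNReal.ofReal L) :
    Summable fun k => (1 + freqSq k) ^ ρ * ‖fcoef f k‖ ^ 2 := by
  have h1 := ne_top_of_le_ne_top ENNReal.ofReal_ne_top (sobNorm_le_iff_tsum h)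
  refine (ENNReal.summable_toReal h1).congr fun k => ?_
  rw [ENNReal.toReal_ofReal (sobolev_nonneg ρ f k)]

lemma tsum_le_of_sobNorm_le {ρ L : ℝ} {f : L2per} (h : sobNorm ρ f ≤ ENNReal.ofReal L) :
    ∑' k : ℤ × ℤ, (1 + freqSq k) ^ ρ * ‖fcoef f k‖ ^ 2 ≤ (max L 0) ^ 2 := by
  have h1 := sobNorm_le_iff_tsum h
  rwa [← ENNReal.ofReal_tsum_of_nonneg (sobolev_nonneg ρ f) (summable_of_sobNorm_le h),
    ENNReal.ofReal_le_ofReal_iff (sq_nonneg _)] at h1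

lemma norm_le_of_sobNorm_le' {ρ L c : ℝ} (hc : 0 ≤ c) {f g : L2per}
    (h : sobNorm ρ f ≤ ENNReal.ofReal L)
    (hg : ∀ k, ‖fcoef g k‖ ^ 2 ≤ c ^ 2 * ((1 + freqSq k) ^ ρ * ‖fcoef f k‖ ^ 2)) :
    ‖g‖ ≤ c * (2 * Real.pi * max L 0) := by
  have hp := Real.pi_pos
  have hL : 0 ≤ max L 0 := le_max_right _ _
  refine le_of_sq_le_sq ?_ (by positivity)
  refine (norm_sq_le_of_fcoef ((summable_of_sobNorm_le h).mul_left (c ^ 2)) hg).trans ?_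
  rw [tsum_mul_left]
  have := tsum_le_of_sobNorm_le h
  calc 4 * Real.pi ^ 2 * (c ^ 2 * ∑' k : ℤ × ℤ, (1 + freqSq k) ^ ρ * ‖fcoef f k‖ ^ 2)
      ≤ 4 * Real.pi ^ 2 * (c ^ 2 * (max L 0) ^ 2) := by gcongr
    _ = _ := by ring

lemma semiBound_of_sobNorm_le {ρ L β : ℝ} (hβ : 0 ≤ β) (hβρ : 2 * β ≤ ρ) {f : L2per}
    (h : sobNorm ρ f ≤ ENNReal.ofReal L) : SemiBound β (2 * Real.pi * max L 0) f := by
  intro N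
  rw [← one_mul (2 * Real.pi * max L 0)]
  refine norm_le_of_sobNorm_le' zero_le_one h fun k => ?_
  rw [fcoef_specOp, norm_mul, mul_pow, Complex.norm_real, Real.norm_of_nonneg (modeMul_nonneg N β k),
    one_pow, one_mul]
  gcongr
  have hk := freqSq_nonneg k
  by_cases hN : SymMode N k
  · rw [modeMul_of_mem hN, rpow_two_mul_freqSq]
    calc freqSq k ^ (2 * β) ≤ (1 + freqSq k) ^ (2 * β) := by
          apply Real.rpow_le_rpow hk (by linarith) (by linarith)
      _ ≤ _ := Real.rpow_le_rpow_of_exponent_le (by linarith) hβρ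
  · rw [modeMul_of_not_mem hN, zero_pow two_ne_zero]; positivity

lemma norm_le_of_sobNorm_le {ρ L : ℝ} (hρ : 0 ≤ ρ) {f : L2per}
    (h : sobNorm ρ f ≤ ENNReal.ofReal L) : ‖f‖ ≤ 2 * Real.pi * max L 0 := by
  rw [← one_mul (2 * Real.pi * max L 0)]
  refine norm_le_of_sobNorm_le' zero_le_one h fun k => ?_
  rw [one_pow, one_mul]
  refine le_mul_of_one_le_left (sq_nonneg _) (Real.one_le_rpow ?_ hρ)
  linarith [freqSq_nonneg k]

lemma quarter_rpow {N : ℕ} (hN : 4 ≤ N) (x : ℝ) :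
    ((N : ℝ) / 4) ^ x = 4 ^ (-x) * (N : ℝ) ^ x := by
  rw [Real.div_rpow (Nat.cast_nonneg N) (by norm_num), Real.rpow_neg (by norm_num)]
  field_simp

/-- The projection error in `H^ρ`, mode by mode. -/
lemma freqSq_rpow_le_of_not_symMode {N : ℕ} (hN : 4 ≤ N) {k : ℤ × ℤ} (hk : ¬ SymMode N k)
    {ρ m : ℝ} (hm : 0 ≤ m) (hρm : ρ ≤ m) :
    freqSq k ^ ρ ≤ 4 ^ (2 * m - 2 * ρ) * (N : ℝ) ^ (2 * ρ - 2 * m) * (1 + freqSq k) ^ m := by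
  have h1 := le_freqSq_of_not_symMode hN hk
  have hN' : (4 : ℝ) ≤ N := by exact_mod_cast hN
  have h0 : 0 < ((N : ℝ) / 4) ^ 2 := by positivity
  have hk0 : 0 < freqSq k := h0.trans_le h1
  -- The exponent ρ - m is nonpositive, so the lower bound (N/4)² on the frequency turns into the
  -- decay N^{2ρ-2m}.
  have h2 : freqSq k ^ (ρ - m) ≤ (((N : ℝ) / 4) ^ 2) ^ (ρ - m) :=
    Real.rpow_le_rpow_of_nonpos h0 h1 (by linarith)
  have h3 : (((N : ℝ) / 4) ^ 2) ^ (ρ - m) = 4 ^ (2 * m - 2 * ρ) * (N : ℝ) ^ (2 * ρ - 2 * m) := by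
    rw [← Real.rpow_natCast, ← Real.rpow_mul (by positivity), quarter_rpow hN]
    congr 2 <;> push_cast <;> ring
  calc freqSq k ^ ρ = freqSq k ^ (ρ - m) * freqSq k ^ m := by
        rw [← Real.rpow_add hk0]; congr 1; ring
    _ ≤ _ := by
        rw [← h3]
        gcongr
        linarith

/-- Only modes with |k| ≥ N/4 are left, and there (1 + |k|²)^m dominates (N/4)^{2m}; hence the
factor 4^m. -/
lemma norm_sub_specOp_zero_le {N : ℕ} (hN : 4 ≤ N) {m L : ℝ} (hm : 0 ≤ m) {f : L2per}
    (h : sobNorm m f ≤ ENNReal.ofReal L) :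
    ‖f - specOp N 0 f‖ ≤ 4 ^ m * (2 * Real.pi * max L 0) * (N : ℝ) ^ (-m) := by
  have hN' : (0 : ℝ) < N := by
    have : (4 : ℝ) ≤ N := by exact_mod_cast hN
    linarith
  rw [mul_right_comm]
  refine norm_le_of_sobNorm_le' (by positivity) h fun k => ?_
  rw [fcoef_sub, fcoef_specOp]
  by_cases hk : SymMode N k
  · rw [modeMul_of_mem hk, Real.rpow_zero]
    have := sobolev_nonneg m f k
    simp only [Complex.ofReal_one, one_mul, sub_self, norm_zero]
    rw [zero_pow two_ne_zero]
    positivity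
  · rw [modeMul_of_not_mem hk]
    simp only [Complex.ofReal_zero, zero_mul, sub_zero]
    rw [← mul_assoc]
    refine le_mul_of_one_le_left (sq_nonneg _) ?_
    have := freqSq_rpow_le_of_not_symMode hN hk (ρ := 0) hm hm
    rw [Real.rpow_zero] at this
    refine this.trans (le_of_eq ?_)
    congr 1
    rw [mul_pow, ← Real.rpow_natCast, ← Real.rpow_mul (by norm_num), ← Real.rpow_natCast,
      ← Real.rpow_mul hN'.le]
    congr 2 <;> push_cast <;> ring

lemma sobSemi_sq (ρ : ℝ) (f : L2per) :
    sobSemi ρ f ^ 2 = ∑' k : ℤ × ℤ, ENNReal.ofReal (freqSq k ^ ρ * ‖fcoef f k‖ ^ 2) := by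
  rw [sobSemi, ← ENNReal.rpow_natCast, ← ENNReal.rpow_mul]
  norm_num

/-- The semi-norm of the difference of `f` and an element of `X_N`. -/
lemma sobSemi_sub_sq_le {N : ℕ} (hN : 4 ≤ N) {m L ρ : ℝ} (hm : 0 ≤ m) (hρm : ρ ≤ m)
    {f w : L2per} (hw : w ∈ XN N) (h : sobNorm m f ≤ ENNReal.ofReal L) :
    sobSemi ρ (f - w) ^ 2 ≤ ENNReal.ofReal ((4 * Real.pi ^ 2)⁻¹ * ‖specOp N (ρ / 2) (f - w)‖ ^ 2
      + 4 ^ (2 * m - 2 * ρ) * (N : ℝ) ^ (2 * ρ - 2 * m) * (max L 0) ^ 2) := by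
  have hp := Real.pi_pos
  have h1 := ((norm_sq_specOp N (ρ / 2) (f - w)).mul_left (4 * Real.pi ^ 2)⁻¹)
  set c : ℝ := 4 ^ (2 * m - 2 * ρ) * (N : ℝ) ^ (2 * ρ - 2 * m) with hc
  have hc0 : 0 ≤ c := by positivity
  have h2 := (summable_of_sobNorm_le h).hasSum.mul_left c
  have h3 := h1.add h2
  -- On symmetric modes the truncated operator sees everything; on the others w vanishes and only
  -- the tail of f remains.
  have hle : ∀ k, freqSq k ^ ρ * ‖fcoef (f - w) k‖ ^ 2
      ≤ (4 * Real.pi ^ 2)⁻¹ * (4 * Real.pi ^ 2 * (modeMul N (ρ / 2) k ^ 2 * ‖fcoef (f - w) k‖ ^ 2))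
        + c * ((1 + freqSq k) ^ m * ‖fcoef f k‖ ^ 2) := by
    intro k
    rw [inv_mul_cancel_left₀ (by positivity)]
    have hs := sobolev_nonneg m f k
    by_cases hk : SymMode N k
    · rw [modeMul_of_mem hk, rpow_two_mul_freqSq, mul_div_cancel₀ ρ two_ne_zero]
      exact le_add_of_nonneg_right (by positivity)
    · rw [modeMul_of_not_mem hk, fcoef_sub, fcoef_of_mem_XN hw hk, sub_zero, ← mul_assoc]
      have := freqSq_rpow_le_of_not_symMode hN hk hm hρm
      rw [← hc] at this
      have h5 : freqSq k ^ ρ * ‖fcoef f k‖ ^ 2 ≤ c * (1 + freqSq k) ^ m * ‖fcoef f k‖ ^ 2 := by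
        gcongr
      simpa using h5
  have h0 : ∀ k, 0 ≤ freqSq k ^ ρ * ‖fcoef (f - w) k‖ ^ 2 := fun k =>
    mul_nonneg (Real.rpow_nonneg (freqSq_nonneg k) _) (sq_nonneg _)
  have hs := h3.summable.of_nonneg_of_le h0 hle
  rw [sobSemi_sq, ← ENNReal.ofReal_tsum_of_nonneg h0 hs]
  apply ENNReal.ofReal_le_ofReal
  calc ∑' k, freqSq k ^ ρ * ‖fcoef (f - w) k‖ ^ 2 ≤ _ := hs.tsum_le_tsum hle h3.summable
    _ = _ := h3.tsum_eq
    _ ≤ _ := by gcongr; exact tsum_le_of_sobNorm_le h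

/-- Convergence of `∑ |k|^{-2σ}` over the planar lattice for `σ > 1`. -/
lemma summable_freqSq_rpow {σ : ℝ} (hσ : 1 < σ) :
    Summable fun k : ℤ × ℤ => freqSq k ^ (-σ) := by
  -- Comparison with the lattice sum in the sup norm, which is dominated by the Euclidean one.
  have h1 : Summable fun x : Fin 2 → ℤ => ‖x‖ ^ (-(2 * σ)) :=
    EisensteinSeries.summable_one_div_norm_rpow (k := 2 * σ) (by linarith)
  have h2 := (finTwoArrowEquiv ℤ).symm.summable_iff.2 h1
  refine h2.of_nonneg_of_le (fun k => Real.rpow_nonneg (freqSq_nonneg k) _) fun k => ?_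
  simp only [Function.comp_apply]
  have hn : ‖(finTwoArrowEquiv ℤ).symm k‖ ^ 2 ≤ freqSq k := by
    have : ‖(finTwoArrowEquiv ℤ).symm k‖ ≤ Real.sqrt (freqSq k) := by
      rw [pi_norm_le_iff_of_nonneg (Real.sqrt_nonneg _)]
      intro i
      apply Real.le_sqrt_of_sq_le
      rw [Int.norm_eq_abs, sq_abs]
      fin_cases i <;> simp [freqSq] <;> positivity
    calc _ ≤ Real.sqrt (freqSq k) ^ 2 := by gcongr
      _ = _ := Real.sq_sqrt (freqSq_nonneg k)
  by_cases hk : k = 0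
  · subst hk
    -- At the origin both terms vanish, because 0 ^ x = 0 for every real x ≠ 0.
    have h0 : (finTwoArrowEquiv ℤ).symm (0 : ℤ × ℤ) = 0 := by ext i; fin_cases i <;> rfl
    rw [h0, norm_zero, (freqSq_zero_iff 0).2 rfl, Real.zero_rpow (by linarith),
      Real.zero_rpow (by linarith)]
  · have hpos : 0 < ‖(finTwoArrowEquiv ℤ).symm k‖ := by
      rw [norm_pos_iff]
      intro h
      apply hk
      have := (finTwoArrowEquiv ℤ).symm.injective.eq_iff.1 (h.trans (by ext i; fin_cases i <;> rfl :
        (0 : Fin 2 → ℤ) = (finTwoArrowEquiv ℤ).symm (0 : ℤ × ℤ)))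
      exact this
    rw [show -(2 * σ) = ((2 : ℕ) : ℝ) * (-σ) by push_cast; ring, Real.rpow_mul (norm_nonneg _),
      Real.rpow_natCast]
    exact Real.rpow_le_rpow_of_nonpos (by positivity) hn (by linarith)

/-- A Sobolev embedding with a small constant in front of the highest-order semi-norm. -/
lemma exists_sup_bound {σ : ℝ} (hσ : 1 < σ) {η : ℝ} (hη : 0 < η) :
    ∃ C, 0 ≤ C ∧ ∀ (f : L2per) (B : ℝ), SemiBound (σ / 2) B f →
      ∀ᵐ x : Torus, |f x| ≤ C * ‖f‖ + η * B := by
  have hs := summable_freqSq_rpow hσ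
  -- Outside a finite set S the weights |k|^{-2σ} sum to less than η². The modes in S are paid for
  -- by the L² norm, and only the remaining ones by the semi-norm.
  obtain ⟨S, hS⟩ := (summable_iff_vanishing_norm.1 hs) (η ^ 2) (by positivity)
  classical
  -- The zero mode is put with the finite part: the splitting below multiplies by a power of `freqSq
  -- k` and by its inverse.
  set S' : Finset (ℤ × ℤ) := insert 0 S
  refine ⟨∑ k ∈ S', 1, by positivity, fun f B hB => ?_⟩
  have hp := Real.pi_pos
  have hB0 := hB.nonneg
  have hcoef : ∀ k, ‖fcoef f k‖ ≤ ‖f‖ := by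
    intro k
    refine le_of_sq_le_sq ?_ (norm_nonneg _)
    have h1 := le_hasSum (hasSum_norm_sq f) k (fun _ _ => by positivity)
    refine le_trans ?_ h1
    refine le_mul_of_one_le_left (sq_nonneg _) ?_
    nlinarith [Real.pi_gt_three]
  have hfin : ∀ U : Finset (ℤ × ℤ), ∑ k ∈ U, ‖fcoef f k‖ ≤ (∑ k ∈ S', 1) * ‖f‖ + η * B := by
    intro U
    have hsplit : ∑ k ∈ U, ‖fcoef f k‖ ≤ ∑ k ∈ S', ‖fcoef f k‖ + ∑ k ∈ U \ S', ‖fcoef f k‖ := by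
      rw [← Finset.sum_union (Finset.disjoint_sdiff)]
      apply Finset.sum_le_sum_of_subset_of_nonneg
      · intro k hk; by_cases h : k ∈ S' <;> simp [h, hk]
      · intro _ _ _; exact norm_nonneg _
    refine hsplit.trans (add_le_add ?_ ?_)
    · rw [Finset.sum_mul]
      exact Finset.sum_le_sum fun k _ => by rw [one_mul]; exact hcoef k
    · have hne : ∀ k ∈ U \ S', k ≠ 0 := by
        intro k hk h
        simp [S', h] at hk
      have h1 : ∑ k ∈ U \ S', ‖fcoef f k‖
          = ∑ k ∈ U \ S', freqSq k ^ (-(σ / 2)) * (freqSq k ^ (σ / 2) * ‖fcoef f k‖) := by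
        refine Finset.sum_congr rfl fun k hk => ?_
        have : 0 < freqSq k := by linarith [one_le_freqSq (hne k hk)]
        rw [← mul_assoc, ← Real.rpow_add this, neg_add_cancel, Real.rpow_zero, one_mul]
      rw [h1]
      refine le_of_sq_le_sq ?_ (by positivity)
      -- Cauchy–Schwarz: one factor gives η², the other B². The factor 4π² from Parseval is simply
      -- dropped, being at least 1.
      refine (Finset.sum_mul_sq_le_sq_mul_sq _ _ _).trans ?_
      rw [mul_pow]
      have h2 : ∑ k ∈ U \ S', (freqSq k ^ (-(σ / 2))) ^ 2 ≤ η ^ 2 := by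
        have hd : Disjoint (U \ S') S :=
          (Finset.sdiff_disjoint (s := S')).mono_right (Finset.subset_insert _ _)
        have := (le_abs_self _).trans (hS _ hd).le
        refine le_trans (le_of_eq ?_) this
        refine Finset.sum_congr rfl fun k _ => ?_
        rw [rpow_two_mul_freqSq]; congr 1; ring
      have h3 : ∑ k ∈ U \ S', (freqSq k ^ (σ / 2) * ‖fcoef f k‖) ^ 2 ≤ B ^ 2 := by
        have h4 := hB.sum_le (U \ S')
        have h5 : B ^ 2 / (4 * Real.pi ^ 2) ≤ B ^ 2 := by
          apply div_le_self (sq_nonneg _)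
          nlinarith [Real.pi_gt_three]
        refine le_trans (le_of_eq ?_) (h4.trans h5)
        refine Finset.sum_congr rfl fun k _ => ?_
        rw [mul_pow, rpow_two_mul_freqSq]
      gcongr
  have hsum : Summable fun k => ‖fcoef f k‖ :=
    summable_of_sum_le (fun _ => norm_nonneg _) hfin
  filter_upwards [ae_abs_le_tsum f hsum] with x hx
  exact hx.trans (hsum.tsum_le_of_sum_le hfin)

end

end SAVWave

/-! ### Translations: Sobolev semi-norms and Hölder continuity in the mean. -/

namespace SAVWave

noncomputable section

instance isAddRightInvariant_torus : (volume : Measure Torus).IsAddRightInvariant :=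
  inferInstanceAs (Measure.IsAddRightInvariant
    ((volume : Measure (AddCircle (2 * Real.pi))).prod volume))

lemma measurePreserving_shift (h : Torus) :
    MeasurePreserving (fun x : Torus => x + h) volume volume :=
  measurePreserving_add_right volume h

/-- The translate `x ↦ f (x + h)`. -/
def shift (h : Torus) (f : L2per) : L2per :=
  Lp.compMeasurePreserving (fun x : Torus => x + h) (measurePreserving_shift h) f

lemma coeFn_shift (h : Torus) (f : L2per) : ∀ᵐ x : Torus, shift h f x = f (x + h) :=
  Lp.coeFn_compMeasurePreserving f (measurePreserving_shift h)

lemma expo_add_right (k : ℤ × ℤ) (x h : Torus) : expo k (x + h) = expo k x * expo k h := by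
  have key : ∀ (n : ℤ) (y z : AddCircle (2 * Real.pi)),
      (fourier n (y + z) : ℂ) = fourier n y * fourier n z := by
    intro n y z
    rw [fourier_apply, fourier_apply, fourier_apply, zsmul_add, AddCircle.toCircle_add]
    exact Circle.coe_mul _ _
  simp only [expo, Prod.fst_add, Prod.snd_add, key]
  ring

lemma fcoef_shift (h : Torus) (f : L2per) (k : ℤ × ℤ) :
    fcoef (shift h f) k = expo k h * fcoef f k := by
  have h1 : ∫ x : Torus, (shift h f x : ℂ) * (starRingEnd ℂ) (expo k x)
      = ∫ x : Torus, expo k h * ((f (x + h) : ℂ) * (starRingEnd ℂ) (expo k (x + h))) := by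
    apply integral_congr_ae
    filter_upwards [coeFn_shift h f] with x hx
    have h2 : expo k h * (starRingEnd ℂ) (expo k h) = 1 := by
      rw [Complex.mul_conj, Complex.normSq_eq_norm_sq, norm_expo]; simp
    rw [hx, expo_add_right, map_mul]
    linear_combination (-(f (x + h) : ℂ) * (starRingEnd ℂ) (expo k x)) * h2
  rw [fcoef, h1, integral_const_mul,
    integral_add_right_eq_self (fun x => (f x : ℂ) * (starRingEnd ℂ) (expo k x)), fcoef]
  ring

lemma hasSum_norm_shift_sub (h : Torus) (f : L2per) :
    HasSum (fun k => 4 * Real.pi ^ 2 * (‖expo k h - 1‖ ^ 2 * ‖fcoef f k‖ ^ 2))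
      (‖shift h f - f‖ ^ 2) := by
  refine (hasSum_norm_sq _).congr_fun fun k => ?_
  rw [fcoef_sub, fcoef_shift, ← sub_one_mul, norm_mul, mul_pow]

/-- A one-parameter family of translations on which the exponential of mode `k` has the
frequency `c k`. -/
structure ShiftLine (H : ℝ → Torus) (c : ℤ × ℤ → ℤ) : Prop where
  norm_sq : ∀ k θ, ‖expo k (H θ) - 1‖ ^ 2 = 2 - 2 * Real.cos (c k * θ)
  le_freq : ∀ k, (c k : ℝ) ^ 2 ≤ freqSq k

lemma norm_sq_fourier_sub_one (n : ℤ) (θ : ℝ) :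
    ‖(fourier n (θ : AddCircle (2 * Real.pi)) : ℂ) - 1‖ ^ 2 = 2 - 2 * Real.cos (n * θ) := by
  rw [fourier_coe_apply]
  have h : 2 * (Real.pi : ℂ) * Complex.I * n * θ / ((2 * Real.pi : ℝ) : ℂ)
      = ((n * θ : ℝ) : ℂ) * Complex.I := by
    have : (Real.pi : ℂ) ≠ 0 := Complex.ofReal_ne_zero.mpr Real.pi_ne_zero
    push_cast
    field_simp
  rw [h, ← Complex.normSq_eq_norm_sq, Complex.normSq_apply]
  simp only [Complex.sub_re, Complex.sub_im, Complex.exp_ofReal_mul_I_re,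
    Complex.exp_ofReal_mul_I_im, Complex.one_re, Complex.one_im]
  nlinarith [Real.sin_sq_add_cos_sq (n * θ)]

lemma shiftLine_fst : ShiftLine (fun θ => ((θ : AddCircle (2 * Real.pi)), 0)) Prod.fst where
  norm_sq k θ := by
    rw [← norm_sq_fourier_sub_one, expo, fourier_eval_zero, mul_one]
  le_freq k := by unfold freqSq; nlinarith [sq_nonneg (k.2 : ℝ)]

lemma shiftLine_snd : ShiftLine (fun θ => (0, (θ : AddCircle (2 * Real.pi)))) Prod.snd where
  norm_sq k θ := by
    rw [← norm_sq_fourier_sub_one, expo, fourier_eval_zero, one_mul]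
  le_freq k := by unfold freqSq; nlinarith [sq_nonneg (k.1 : ℝ)]

/-- Interpolates between the bounds x² and 4, according to whether x² ≤ 1. -/
lemma two_sub_two_cos_le {a : ℝ} (ha0 : 0 ≤ a) (ha1 : a ≤ 1) (x : ℝ) :
    2 - 2 * Real.cos x ≤ 4 * (x ^ 2) ^ a := by
  rcases le_total (x ^ 2) 1 with h | h
  · have h1 : x ^ 2 ≤ (x ^ 2) ^ a := by
      rcases eq_or_lt_of_le (sq_nonneg x) with h0 | h0
      · rw [← h0]; exact Real.rpow_nonneg le_rfl a
      · calc x ^ 2 = (x ^ 2) ^ (1 : ℝ) := (Real.rpow_one _).symm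
          _ ≤ _ := Real.rpow_le_rpow_of_exponent_ge h0 h ha1
    have h2 := Real.one_sub_sq_div_two_le_cos (x := x)
    nlinarith [sq_nonneg x]
  · have h1 : 1 ≤ (x ^ 2) ^ a := Real.one_le_rpow h ha0
    nlinarith [Real.neg_one_le_cos x]

/-- By Parseval a translation by θ multiplies the squared modulus of the coefficient at k by 2 - 2
cos(c k θ) in the difference, and this is at most 4 θ^{2a} |k|^{2a}. -/
lemma SemiBound.norm_shift_sub_le {H : ℝ → Torus} {c : ℤ × ℤ → ℤ} (hH : ShiftLine H c)
    {a B : ℝ} (ha0 : 0 ≤ a) (ha1 : a ≤ 1) {f : L2per} (hf : SemiBound (a / 2) B f) {θ : ℝ}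
    (hθ : 0 ≤ θ) : ‖shift (H θ) f - f‖ ≤ 2 * B * θ ^ a := by
  have hB := hf.nonneg
  have hp := Real.pi_pos
  refine le_of_sq_le_sq ?_ (by positivity)
  have hθa : (2 * B * θ ^ a) ^ 2 = 4 * (θ ^ 2) ^ a * B ^ 2 := by
    rw [← Real.rpow_natCast θ 2, ← Real.rpow_mul hθ, mul_comm ((2 : ℕ) : ℝ) a, Real.rpow_mul hθ,
      Real.rpow_natCast]
    ring
  rw [hθa]
  refine hasSum_le_of_sum_le (hasSum_norm_shift_sub (H θ) f) fun S => ?_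
  have h1 := hf.sum_le S
  rw [le_div_iff₀ (by positivity)] at h1
  have h2 : ∀ k, ‖expo k (H θ) - 1‖ ^ 2 * ‖fcoef f k‖ ^ 2
      ≤ 4 * (θ ^ 2) ^ a * (freqSq k ^ (2 * (a / 2)) * ‖fcoef f k‖ ^ 2) := by
    intro k
    rw [← mul_assoc]
    gcongr
    rw [hH.norm_sq, mul_div_cancel₀ a two_ne_zero]
    refine (two_sub_two_cos_le ha0 ha1 _).trans ?_
    rw [mul_pow, Real.mul_rpow (sq_nonneg _) (sq_nonneg _)]
    have : ((c k : ℝ) ^ 2) ^ a ≤ freqSq k ^ a :=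
      Real.rpow_le_rpow (sq_nonneg _) (hH.le_freq k) ha0
    have h3 : 0 ≤ (θ ^ 2) ^ a := by positivity
    nlinarith
  rw [← Finset.mul_sum]
  calc 4 * Real.pi ^ 2 * ∑ k ∈ S, ‖expo k (H θ) - 1‖ ^ 2 * ‖fcoef f k‖ ^ 2
      ≤ 4 * Real.pi ^ 2 * ∑ k ∈ S, 4 * (θ ^ 2) ^ a *
          (freqSq k ^ (2 * (a / 2)) * ‖fcoef f k‖ ^ 2) := by
        gcongr 4 * Real.pi ^ 2 * ?_
        exact Finset.sum_le_sum fun k _ => h2 k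
    _ = 4 * (θ ^ 2) ^ a *
          ((∑ k ∈ S, freqSq k ^ (2 * (a / 2)) * ‖fcoef f k‖ ^ 2) * (4 * Real.pi ^ 2)) := by
        rw [← Finset.mul_sum]; ring
    _ ≤ _ := by gcongr

/-- A single term suffices. If 2^j ≤ |n| < 2^{j+1}, the angle |n|π/2^{j+1} lies between π/2 and π,
so its cosine is nonpositive and the term is at least 2^{j+1}. -/
lemma abs_le_sum_dyadic (n : ℤ) {J : ℕ} (hJ : Nat.log 2 n.natAbs < J) :
    |(n : ℝ)| ≤ ∑ j ∈ Finset.range J, 2 ^ j * (2 - 2 * Real.cos (n * (Real.pi / 2 ^ (j + 1)))) := by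
  have hnn : ∀ j ∈ Finset.range J,
      0 ≤ (2 : ℝ) ^ j * (2 - 2 * Real.cos (n * (Real.pi / 2 ^ (j + 1)))) := fun j _ =>
    mul_nonneg (by positivity) (by linarith [Real.cos_le_one (n * (Real.pi / 2 ^ (j + 1)))])
  by_cases hn : n = 0
  · subst hn
    simp
  refine le_trans ?_ (Finset.single_le_sum hnn (Finset.mem_range.2 hJ))
  set j := Nat.log 2 n.natAbs
  have hp := Real.pi_pos
  have h1 : (2 : ℝ) ^ j ≤ |(n : ℝ)| := by
    have := Nat.pow_log_le_self 2 (x := n.natAbs) (by simpa using hn)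
    have h : ((2 ^ j : ℕ) : ℝ) ≤ (n.natAbs : ℝ) := by exact_mod_cast this
    rw [Nat.cast_natAbs, Int.cast_abs] at h
    simpa using h
  have h2 : |(n : ℝ)| < 2 ^ (j + 1) := by
    have := Nat.lt_pow_succ_log_self (b := 2) (by norm_num) n.natAbs
    have h : (n.natAbs : ℝ) < ((2 ^ (j + 1) : ℕ) : ℝ) := by exact_mod_cast this
    rw [Nat.cast_natAbs, Int.cast_abs] at h
    simpa using h
  have h3 : Real.cos (n * (Real.pi / 2 ^ (j + 1))) ≤ 0 := by
    rw [← Real.cos_abs, abs_mul, abs_of_pos (by positivity : 0 < Real.pi / 2 ^ (j + 1))]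
    apply Real.cos_nonpos_of_pi_div_two_le_of_le
    · calc Real.pi / 2 = 2 ^ j * (Real.pi / 2 ^ (j + 1)) := by rw [pow_succ]; field_simp
        _ ≤ _ := by gcongr
    · calc |(n : ℝ)| * (Real.pi / 2 ^ (j + 1)) ≤ 2 ^ (j + 1) * (Real.pi / 2 ^ (j + 1)) := by gcongr
        _ = Real.pi := by field_simp
        _ ≤ _ := by linarith
  calc |(n : ℝ)| ≤ 2 ^ j * 2 := by rw [← pow_succ]; exact h2.le
    _ ≤ _ := by gcongr; linarith

/-- Directional Hölder continuity in the mean controls a directional Sobolev semi-norm. -/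
lemma exists_sum_abs_le {a : ℝ} (ha : 1 / 2 < a) :
    ∃ C, 0 ≤ C ∧ ∀ (H : ℝ → Torus) (c : ℤ × ℤ → ℤ), ShiftLine H c → ∀ (f : L2per) (D : ℝ),
      (∀ θ, 0 ≤ θ → ‖shift (H θ) f - f‖ ≤ D * θ ^ a) →
      ∀ S : Finset (ℤ × ℤ), ∑ k ∈ S, |(c k : ℝ)| * (4 * Real.pi ^ 2 * ‖fcoef f k‖ ^ 2)
        ≤ C * D ^ 2 := by
  -- The ratio of the dyadic series: the weight 2^j times the squared Hölder factor 2^{-2aj}. It is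
  -- below 1 exactly because a > 1/2, and this makes the constant independent of the number J of
  -- scales.
  set q : ℝ := 2 ^ (1 - 2 * a) with hq
  have hq1 : q < 1 := Real.rpow_lt_one_of_one_lt_of_neg (by norm_num) (by linarith)
  have hq0 : 0 < q := by positivity
  have hp := Real.pi_pos
  refine ⟨(Real.pi / 2) ^ (2 * a) * (1 - q)⁻¹,
    mul_nonneg (by positivity) (inv_nonneg.2 (by linarith)), fun H c hH f D hD S => ?_⟩
  set J := ∑ k ∈ S, Nat.log 2 (c k).natAbs + 1
  have hJ : ∀ k ∈ S, Nat.log 2 (c k).natAbs < J := fun k hk =>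
    Nat.lt_succ_of_le (Finset.single_le_sum (f := fun k => Nat.log 2 (c k).natAbs)
      (fun _ _ => Nat.zero_le _) hk)
  calc ∑ k ∈ S, |(c k : ℝ)| * (4 * Real.pi ^ 2 * ‖fcoef f k‖ ^ 2)
      ≤ ∑ k ∈ S, (∑ j ∈ Finset.range J, 2 ^ j * (2 - 2 * Real.cos (c k * (Real.pi / 2 ^ (j + 1)))))
          * (4 * Real.pi ^ 2 * ‖fcoef f k‖ ^ 2) := by
        refine Finset.sum_le_sum fun k hk => ?_
        gcongr
        exact abs_le_sum_dyadic _ (hJ k hk)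
    _ = ∑ j ∈ Finset.range J, 2 ^ j * ∑ k ∈ S, 4 * Real.pi ^ 2 *
          (‖expo k (H (Real.pi / 2 ^ (j + 1))) - 1‖ ^ 2 * ‖fcoef f k‖ ^ 2) := by
        simp only [hH.norm_sq, Finset.sum_mul, Finset.mul_sum]
        rw [Finset.sum_comm]
        refine Finset.sum_congr rfl fun j _ => Finset.sum_congr rfl fun k _ => ?_
        ring
    _ ≤ ∑ j ∈ Finset.range J, 2 ^ j * (D ^ 2 * ((Real.pi / 2 ^ (j + 1)) ^ a) ^ 2) := by
        refine Finset.sum_le_sum fun j _ => ?_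
        gcongr
        refine (sum_le_hasSum S (fun k _ => by positivity)
          (hasSum_norm_shift_sub (H (Real.pi / 2 ^ (j + 1))) f)).trans ?_
        rw [← mul_pow]
        exact pow_le_pow_left₀ (norm_nonneg _) (hD _ (by positivity)) 2
    _ = ((Real.pi / 2) ^ (2 * a) * ∑ j ∈ Finset.range J, q ^ j) * D ^ 2 := by
        rw [Finset.mul_sum, Finset.sum_mul]
        refine Finset.sum_congr rfl fun j _ => ?_
        have h1 : ((Real.pi / 2 ^ (j + 1)) ^ a) ^ 2
            = (Real.pi / 2) ^ (2 * a) * ((2 : ℝ) ^ (2 * a))⁻¹ ^ j := by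
          have : Real.pi / 2 ^ (j + 1) = (Real.pi / 2) * (2 : ℝ)⁻¹ ^ j := by
            rw [inv_pow, pow_succ]; field_simp
          rw [this, ← Real.rpow_natCast, ← Real.rpow_mul (by positivity),
            Real.mul_rpow (by positivity) (by positivity), ← Real.rpow_natCast (2 : ℝ)⁻¹ j,
            ← Real.rpow_mul (by positivity), mul_comm a, mul_comm (j : ℝ), Real.rpow_mul
            (by positivity) _ (j : ℝ), Real.rpow_natCast, Real.inv_rpow (by norm_num)]
          push_cast; rfl
        have h2 : q = 2 * ((2 : ℝ) ^ (2 * a))⁻¹ := by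
          rw [hq, Real.rpow_sub (by norm_num), Real.rpow_one, div_eq_mul_inv]
        rw [h1, h2, mul_pow]
        ring
    _ ≤ _ := by
        gcongr
        exact ((summable_geometric_of_lt_one hq0.le hq1).sum_le_tsum _
          (fun _ _ => by positivity)).trans (tsum_geometric_of_lt_one hq0.le hq1).le

end

end SAVWave

/-! ### Nonlinear terms on bounded sets. -/

namespace SAVWave

noncomputable section

/-- `f` is essentially bounded by `M`. -/
def AEBound (M : ℝ) (f : L2per) : Prop := ∀ᵐ x : Torus, |f x| ≤ M

lemma integrable_mul_L2 (f g : L2per) : Integrable (fun x => f x * g x) (volume : Measure Torus) := by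
  have := L2.integrable_inner (𝕜 := ℝ) g f
  simpa using this

lemma inner_eq_integral (f g : L2per) : inner ℝ f g = ∫ x : Torus, f x * g x := by
  rw [L2.inner_def]
  simp [mul_comm]

lemma exists_comp {g : ℝ → ℝ} (hg : Continuous g) {M : ℝ} {w : L2per} (hw : AEBound M w) :
    ∃ f : L2per, ∀ᵐ x : Torus, f x = g (w x) := by
  obtain ⟨C, hC⟩ := isCompact_Icc.exists_bound_of_continuousOn (hg.continuousOn (s := Icc (-M) M))
  have hm : AEStronglyMeasurable (fun x => g (w x)) (volume : Measure Torus) :=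
    hg.comp_aestronglyMeasurable (Lp.aestronglyMeasurable w)
  have hL : MemLp (fun x => g (w x)) 2 (volume : Measure Torus) :=
    MemLp.of_bound hm C (by
      filter_upwards [hw] with x hx
      exact hC _ (abs_le.1 hx))
  exact ⟨hL.toLp, hL.coeFn_toLp⟩

lemma AEBound.integrable_comp {g : ℝ → ℝ} (hg : Continuous g) {M : ℝ} {w : L2per}
    (hw : AEBound M w) : Integrable (fun x => g (w x)) (volume : Measure Torus) := by
  obtain ⟨f, hf⟩ := exists_comp hg hw
  exact ((Lp.memLp f).integrable (by norm_num)).congr hf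

/-- If `|h| ≤ C |f| |g|` then `|∫ h| ≤ C ‖f‖ ‖g‖`. -/
lemma abs_integral_le_mul {h : Torus → ℝ} {f g : L2per} {C : ℝ} (hC : 0 ≤ C)
    (hh : ∀ᵐ x : Torus, |h x| ≤ C * (|f x| * |g x|)) :
    |∫ x : Torus, h x| ≤ C * (‖f‖ * ‖g‖) := by
  have hi : Integrable (fun x => |f x| * |g x|) (volume : Measure Torus) := by
    simpa only [abs_mul] using (integrable_mul_L2 f g).abs
  have h1 : |∫ x : Torus, h x| ≤ ∫ x : Torus, C * (|f x| * |g x|) :=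
    norm_integral_le_of_norm_le (f := h) (hi.const_mul C) hh
  refine h1.trans ?_
  rw [integral_const_mul]
  gcongr
  have hf : MemLp (fun x => |f x|) 2 (volume : Measure Torus) := (Lp.memLp f).abs
  have hg : MemLp (fun x => |g x|) 2 (volume : Measure Torus) := (Lp.memLp g).abs
  have h2 : ∫ x : Torus, |f x| * |g x| = inner ℝ (hf.toLp) (hg.toLp) := by
    rw [inner_eq_integral]
    apply integral_congr_ae
    filter_upwards [hf.coeFn_toLp, hg.coeFn_toLp] with x h1 h2
    rw [h1, h2]
  rw [h2]
  refine (real_inner_le_norm _ _).trans (le_of_eq ?_)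
  have hn : ∀ (f : L2per) (hf : MemLp (fun x => |f x|) 2 (volume : Measure Torus)),
      ‖hf.toLp (fun x => |f x|)‖ = ‖f‖ := by
    intro f hf
    have : ∀ᵐ x : Torus, ‖hf.toLp (fun x => |f x|) x‖ = ‖f x‖ := by
      filter_upwards [hf.coeFn_toLp] with x hx
      rw [hx, Real.norm_eq_abs, abs_abs, Real.norm_eq_abs]
    exact le_antisymm (Lp.norm_le_norm_of_ae_le (this.mono fun _ h => h.le))
      (Lp.norm_le_norm_of_ae_le (this.mono fun _ h => h.ge))
  rw [hn, hn]

/-- The constant function. -/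
def constL2 (c : ℝ) : L2per := Lp.const 2 (volume : Measure Torus) c

lemma coeFn_constL2 (c : ℝ) : ∀ᵐ x : Torus, constL2 c x = c := Lp.coeFn_const ..

lemma exists_const_bound {g : ℝ → ℝ} (hg : Continuous g) (M : ℝ) :
    ∃ C, 0 ≤ C ∧ ∀ x, |x| ≤ M → |g x| ≤ C := by
  obtain ⟨C, hC⟩ := isCompact_Icc.exists_bound_of_continuousOn (hg.continuousOn (s := Icc (-M) M))
  exact ⟨max C 0, le_max_right _ _, fun x hx => (hC x (abs_le.1 hx)).trans (le_max_left _ _)⟩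

/-- A continuously differentiable function is Lipschitz on bounded intervals. -/
lemma exists_lipschitz_bound {g : ℝ → ℝ} (hg : ContDiff ℝ 1 g) (M : ℝ) :
    ∃ C, 0 ≤ C ∧ ∀ x y, |x| ≤ M → |y| ≤ M → |g x - g y| ≤ C * |x - y| := by
  obtain ⟨C, hC0, hC⟩ := exists_const_bound (hg.continuous_deriv le_rfl) M
  refine ⟨C, hC0, fun x y hx hy => ?_⟩
  exact (convex_Icc (-M) M).norm_image_sub_le_of_norm_deriv_le
    (fun z _ => (hg.differentiable one_ne_zero) z) (fun z hz => hC z (abs_le.2 hz))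
    (abs_le.1 hy) (abs_le.1 hx)

/-- Taylor's formula of first order, uniformly on bounded intervals. -/
lemma exists_taylor_bound {g : ℝ → ℝ} (hg : ContDiff ℝ 2 g) (M : ℝ) :
    ∃ C, 0 ≤ C ∧ ∀ x y, |x| ≤ M → |y| ≤ M → |g x - g y - deriv g y * (x - y)| ≤ C * |x - y| ^ 2 := by
  have hg1 : ContDiff ℝ 1 (deriv g) := by
    have : ContDiff ℝ (1 + 1) g := by norm_num; exact hg
    exact ((contDiff_succ_iff_deriv).1 this).2.2
  obtain ⟨C, hC0, hC⟩ := exists_lipschitz_bound hg1 M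
  have hd : Differentiable ℝ g := hg.differentiable two_ne_zero
  refine ⟨C, hC0, fun x y hx hy => ?_⟩
  have hsub : uIcc y x ⊆ Icc (-M) M :=
    (ordConnected_Icc).uIcc_subset (abs_le.1 hy) (abs_le.1 hx)
  -- Mean value inequality for g minus its linear part at y, whose derivative is O(|x - y|) between
  -- y and x.
  have h := (convex_uIcc y x).norm_image_sub_le_of_norm_hasDerivWithin_le
    (f := fun z => g z - deriv g y * z) (f' := fun z => deriv g z - deriv g y) (C := C * |x - y|)
    (x := y) (y := x)
    (fun z _ => by
      have := ((hd z).hasDerivAt.sub ((hasDerivAt_id z).const_mul (deriv g y))).hasDerivWithinAt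
        (s := uIcc y x)
      rw [mul_one] at this
      exact this)
    (fun z hz => by
      refine (hC z y (abs_le.2 (hsub hz)) hy).trans ?_
      exact mul_le_mul_of_nonneg_left (abs_sub_left_of_mem_uIcc hz) hC0)
    left_mem_uIcc right_mem_uIcc
  calc |g x - g y - deriv g y * (x - y)| = ‖g x - deriv g y * x - (g y - deriv g y * y)‖ := by
        rw [Real.norm_eq_abs]; congr 1; ring
    _ ≤ C * |x - y| * ‖x - y‖ := h
    _ = _ := by rw [Real.norm_eq_abs]; ring

section nonlinear

variable {F : ℝ → ℝ} {C₀ : ℝ}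

lemma contDiff_deriv {g : ℝ → ℝ} {n : ℕ} (hg : ContDiff ℝ (n + 1) g) : ContDiff ℝ n (deriv g) :=
  ((contDiff_succ_iff_deriv).1 hg).2.2

/-- `pairF'` is the inner product with `F'(w)`. -/
lemma pairF'_eq_inner {w f : L2per} (hf : ∀ᵐ x : Torus, f x = deriv F (w x)) (φ : L2per) :
    pairF' F w φ = inner ℝ f φ := by
  rw [inner_eq_integral, pairF']
  apply integral_congr_ae
  filter_upwards [hf] with x hx
  rw [hx]

/-- The linear functional `φ ↦ (F'(w), φ) / √E(w)`. -/
def forceF (F : ℝ → ℝ) (C₀ : ℝ) (w φ : L2per) : ℝ := pairF' F w φ / √(energyE F C₀ w)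

/-- Uniform positivity of the energy on bounded sets. -/
lemma exists_energyE_pos (hF : Continuous F)
    (hE : ∀ w : L2per, (∃ M : ℝ, ∀ᵐ x : Torus, |w x| ≤ M) → 0 < energyE F C₀ w) {M : ℝ}
    (hM : 0 ≤ M) : ∃ e, 0 < e ∧ ∀ w : L2per, AEBound M w → e ≤ energyE F C₀ w := by
  -- Positivity at one function is enough: if c minimizes F on [-M, M], then the constant c has the
  -- least energy among functions bounded by M.
  obtain ⟨c, hc, hmin⟩ := isCompact_Icc.exists_isMinOn (nonempty_Icc.2 (by linarith : -M ≤ M))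
    hF.continuousOn
  refine ⟨energyE F C₀ (constL2 c), hE _ ⟨|c|, ?_⟩, fun w hw => ?_⟩
  · filter_upwards [coeFn_constL2 c] with x hx
    rw [hx]
  · unfold energyE
    gcongr 1
    refine integral_mono_ae ?_ (hw.integrable_comp hF) ?_
    · have : AEBound |c| (constL2 c) := by
        filter_upwards [coeFn_constL2 c] with x hx
        rw [hx]
      exact this.integrable_comp hF
    · filter_upwards [hw, coeFn_constL2 c] with x hx h2
      rw [h2]
      exact hmin (abs_le.1 hx)

/-- Local boundedness and Lipschitz continuity of the nonlinear terms. -/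
lemma exists_force_bounds (hF : ContDiff ℝ 3 F)
    (hE : ∀ w : L2per, (∃ M : ℝ, ∀ᵐ x : Torus, |w x| ≤ M) → 0 < energyE F C₀ w) {M : ℝ}
    (hM : 0 ≤ M) : ∃ C, 0 ≤ C ∧
      (∀ w, AEBound M w → ∀ φ, |pairF' F w φ| ≤ C * ‖φ‖) ∧
      (∀ w, AEBound M w → ∀ φ, |forceF F C₀ w φ| ≤ C * ‖φ‖) ∧
      (∀ w w', AEBound M w → AEBound M w' → ∀ φ,
        |pairF' F w φ - pairF' F w' φ| ≤ C * (‖w - w'‖ * ‖φ‖)) ∧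
      (∀ w w', AEBound M w → AEBound M w' → ∀ φ,
        |forceF F C₀ w φ - forceF F C₀ w' φ| ≤ C * (‖w - w'‖ * ‖φ‖)) := by
  have hF1 : ContDiff ℝ 1 F := hF.of_le (by norm_num)
  have hF' : ContDiff ℝ 2 (deriv F) := contDiff_deriv (by exact_mod_cast hF)
  have hF'1 : ContDiff ℝ 1 (deriv F) := hF'.of_le (by norm_num)
  obtain ⟨C1, hC1, h1⟩ := exists_const_bound hF'.continuous M
  obtain ⟨C2, hC2, h2⟩ := exists_lipschitz_bound hF1 M
  obtain ⟨C3, hC3, h3⟩ := exists_lipschitz_bound hF'1 M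
  obtain ⟨e, he, hEe⟩ := exists_energyE_pos hF.continuous hE hM
  -- The norm of the constant 1; pairing with it turns an L¹ bound into an L² bound.
  set P := ‖constL2 1‖
  have hp : 0 ≤ P := norm_nonneg _
  set s := √e with hs
  have hs0 : 0 < s := Real.sqrt_pos.2 he
  have hsE : ∀ w, AEBound M w → s ≤ √(energyE F C₀ w) := fun w hw => Real.sqrt_le_sqrt (hEe w hw)
  have hint : ∀ w, AEBound M w → ∀ φ : L2per,
      Integrable (fun x => deriv F (w x) * φ x) (volume : Measure Torus) := by
    intro w hw φ
    obtain ⟨f, hf⟩ := exists_comp hF'.continuous hw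
    refine (integrable_mul_L2 f φ).congr ?_
    filter_upwards [hf] with x hx
    rw [hx]
  have A : ∀ w, AEBound M w → ∀ φ, |pairF' F w φ| ≤ C1 * P * ‖φ‖ := by
    intro w hw φ
    rw [mul_assoc]
    refine abs_integral_le_mul hC1 ?_
    filter_upwards [hw, coeFn_constL2 1] with x hx hc
    rw [hc, abs_mul, abs_one, one_mul]
    gcongr
    exact h1 _ hx
  have B : ∀ w w', AEBound M w → AEBound M w' → ∀ φ,
      |pairF' F w φ - pairF' F w' φ| ≤ C3 * (‖w - w'‖ * ‖φ‖) := by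
    intro w w' hw hw' φ
    rw [pairF', pairF', ← integral_sub (hint w hw φ) (hint w' hw' φ)]
    refine abs_integral_le_mul hC3 ?_
    filter_upwards [hw, hw', Lp.coeFn_sub w w'] with x hx hx' hsub
    rw [hsub, ← sub_mul, abs_mul, ← mul_assoc]
    gcongr
    exact h3 _ _ hx hx'
  have D : ∀ w w', AEBound M w → AEBound M w' →
      |√(energyE F C₀ w) - √(energyE F C₀ w')| ≤ C2 * P / s * ‖w - w'‖ := by
    intro w w' hw hw'
    have hd : |energyE F C₀ w - energyE F C₀ w'| ≤ C2 * (‖w - w'‖ * P) := by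
      rw [energyE, energyE, add_sub_add_right_eq_sub,
        ← integral_sub (hw.integrable_comp hF.continuous) (hw'.integrable_comp hF.continuous)]
      refine abs_integral_le_mul hC2 ?_
      filter_upwards [hw, hw', Lp.coeFn_sub w w', coeFn_constL2 1] with x hx hx' hsub hc
      rw [hsub, hc, abs_one, mul_one]
      exact h2 _ _ hx hx'
    have e1 := he.le.trans (hEe w hw)
    have e2 := he.le.trans (hEe w' hw')
    -- Lipschitz continuity of the square root, via the conjugate factor and the uniform lower bound
    -- s on √E.
    have hprod : (√(energyE F C₀ w) - √(energyE F C₀ w')) * (√(energyE F C₀ w) + √(energyE F C₀ w'))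
        = energyE F C₀ w - energyE F C₀ w' := by
      rw [mul_comm, ← sq_sub_sq, Real.sq_sqrt e1, Real.sq_sqrt e2]
    have hge : s ≤ √(energyE F C₀ w) + √(energyE F C₀ w') :=
      (hsE w hw).trans (le_add_of_nonneg_right (Real.sqrt_nonneg _))
    rw [div_mul_eq_mul_div, le_div_iff₀ hs0]
    calc _ ≤ |√(energyE F C₀ w) - √(energyE F C₀ w')| *
          |√(energyE F C₀ w) + √(energyE F C₀ w')| := by
          gcongr; exact hge.trans (le_abs_self _)
      _ = |energyE F C₀ w - energyE F C₀ w'| := by rw [← abs_mul, hprod]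
      _ ≤ _ := hd.trans (le_of_eq (by ring))
  have hA0 : 0 ≤ C1 * P / s := by positivity
  have hL0 : 0 ≤ C3 / s + C1 * P * (C2 * P / s) / (s * s) := by positivity
  refine ⟨C1 * P + C1 * P / s + C3 +
    (C3 / s + C1 * P * (C2 * P / s) / (s * s)), by positivity, ?_, ?_, ?_, ?_⟩
  · intro w hw φ
    refine (A w hw φ).trans ?_
    gcongr
    linarith
  · intro w hw φ
    have : |forceF F C₀ w φ| ≤ C1 * P / s * ‖φ‖ := by
      rw [forceF, abs_div, abs_of_nonneg (Real.sqrt_nonneg _), div_mul_eq_mul_div]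
      exact div_le_div₀ (by positivity) (A w hw φ) hs0 (hsE w hw)
    refine this.trans ?_
    gcongr
    have : 0 ≤ C1 * P := by positivity
    linarith
  · intro w w' hw hw' φ
    refine (B w w' hw hw' φ).trans ?_
    gcongr
    have : 0 ≤ C1 * P := by positivity
    linarith
  · intro w w' hw hw' φ
    have k1 := hsE w hw
    have k2 := hsE w' hw'
    have p1 := hs0.trans_le k1
    have p2 := hs0.trans_le k2
    have : |forceF F C₀ w φ - forceF F C₀ w' φ|
        ≤ (C3 / s + C1 * P * (C2 * P / s) / (s * s)) * (‖w - w'‖ * ‖φ‖) := by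
      have hsplit : forceF F C₀ w φ - forceF F C₀ w' φ
          = (pairF' F w φ - pairF' F w' φ) / √(energyE F C₀ w)
            - pairF' F w' φ * (√(energyE F C₀ w) - √(energyE F C₀ w'))
              / (√(energyE F C₀ w) * √(energyE F C₀ w')) := by
        unfold forceF
        field_simp
        ring
      rw [hsplit]
      refine (abs_sub _ _).trans ?_
      rw [abs_div, abs_div, abs_mul, abs_mul, abs_of_pos p1, abs_of_pos p2, add_mul]
      refine add_le_add ?_ ?_
      · rw [div_mul_eq_mul_div]
        exact div_le_div₀ (by positivity) (B w w' hw hw' φ) hs0 k1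
      · rw [div_mul_eq_mul_div]
        refine div_le_div₀ (by positivity) ?_ (by positivity) (mul_le_mul k1 k2 hs0.le p1.le)
        calc |pairF' F w' φ| * |√(energyE F C₀ w) - √(energyE F C₀ w')|
            ≤ (C1 * P * ‖φ‖) * (C2 * P / s * ‖w - w'‖) :=
              mul_le_mul (A w' hw' φ) (D w w' hw hw') (abs_nonneg _) (by positivity)
          _ = _ := by ring
    refine this.trans ?_
    have : 0 ≤ C1 * P := by positivity
    refine mul_le_mul_of_nonneg_right ?_ (by positivity)
    linarith

end nonlinear

end

end SAVWave

/-! ### Half a derivative of F'(w), and expansions of E and F'. -/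

namespace SAVWave

noncomputable section

/-- The two coordinate directions suffice, because |k| ≤ |k₁| + |k₂|. -/
lemma SemiBound.of_shift {a : ℝ} (ha : 1 / 2 < a) : ∃ C, 0 ≤ C ∧ ∀ (f : L2per) (D : ℝ), 0 ≤ D →
    (∀ (H : ℝ → Torus) (c : ℤ × ℤ → ℤ), ShiftLine H c → ∀ θ, 0 ≤ θ →
      ‖shift (H θ) f - f‖ ≤ D * θ ^ a) → SemiBound (1 / 4) (C * D) f := by
  obtain ⟨C, hC0, hC⟩ := exists_sum_abs_le ha
  refine ⟨√(2 * C), Real.sqrt_nonneg _, fun f D hD h N => ?_⟩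
  refine le_of_sq_le_sq ?_ (by positivity)
  rw [mul_pow, Real.sq_sqrt (by positivity)]
  refine hasSum_le_of_sum_le (norm_sq_specOp N (1 / 4) f) fun S => ?_
  have h1 := hC _ _ shiftLine_fst f D (h _ _ shiftLine_fst) S
  have h2 := hC _ _ shiftLine_snd f D (h _ _ shiftLine_snd) S
  rw [two_mul, add_mul]
  refine le_trans ?_ (add_le_add h1 h2)
  rw [← Finset.sum_add_distrib]
  refine Finset.sum_le_sum fun k _ => ?_
  rw [← add_mul, mul_left_comm]
  refine mul_le_mul_of_nonneg_right ?_ (by positivity)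
  by_cases hk : SymMode N k
  · rw [modeMul_of_mem hk, rpow_two_mul_freqSq]
    norm_num
    rw [← Real.sqrt_eq_rpow, freqSq]
    refine Real.sqrt_le_iff.2 ⟨by positivity, ?_⟩
    nlinarith [sq_abs (k.1 : ℝ), sq_abs (k.2 : ℝ), abs_nonneg (k.1 : ℝ), abs_nonneg (k.2 : ℝ),
      mul_nonneg (abs_nonneg (k.1 : ℝ)) (abs_nonneg (k.2 : ℝ))]
  · rw [modeMul_of_not_mem hk, zero_pow two_ne_zero]
    positivity

variable {F : ℝ → ℝ} {C₀ : ℝ}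

/-- The half-derivative estimate of the nonlinear term. -/
lemma exists_pairF'_half_bound (hF : ContDiff ℝ 3 F) {α : ℝ} (hα₁ : 1 < α) (hα₂ : α ≤ 2) (M : ℝ) :
    ∃ C, 0 ≤ C ∧ ∀ (w : L2per) (B : ℝ), AEBound M w → SemiBound (α / 4) B w →
      ∀ (N : ℕ) (φ : L2per), |pairF' F w (specOp N (1 / 2) φ)| ≤ C * B * ‖specOp N (1 / 4) φ‖ := by
  have hF' : ContDiff ℝ 2 (deriv F) := contDiff_deriv (by exact_mod_cast hF)
  obtain ⟨C3, hC3, h3⟩ := exists_lipschitz_bound (hF'.of_le (by norm_num) : ContDiff ℝ 1 (deriv F)) M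
  -- The Hölder exponent is α/2, above the critical value 1/2; this is where α > 1 enters the
  -- estimate.
  obtain ⟨C, hC0, hC⟩ := SemiBound.of_shift (a := α / 2) (by linarith)
  refine ⟨C * (C3 * 2), by positivity, fun w B hw hB N φ => ?_⟩
  have hB0 := hB.nonneg
  obtain ⟨f, hf⟩ := exists_comp hF'.continuous hw
  have hf2 : SemiBound (1 / 4) (C * (C3 * (2 * B))) f := by
    refine hC f _ (by positivity) fun H c hH θ hθ => ?_
    have hB' : SemiBound (α / 2 / 2) B w := by
      rw [show α / 2 / 2 = α / 4 by ring]; exact hB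
    have h1 := hB'.norm_shift_sub_le hH (by linarith) (by linarith) hθ
    -- Composition with a locally Lipschitz function preserves Hölder continuity in the mean, as
    -- translates of w obey the same pointwise bound.
    have h2 : ‖shift (H θ) f - f‖ ≤ C3 * ‖shift (H θ) w - w‖ := by
      apply Lp.norm_le_mul_norm_of_ae_le_mul
      have hqm := (measurePreserving_shift (H θ)).quasiMeasurePreserving
      filter_upwards [Lp.coeFn_sub (shift (H θ) f) f, Lp.coeFn_sub (shift (H θ) w) w,
        coeFn_shift (H θ) f, coeFn_shift (H θ) w, hf, hw, hqm.ae hf, hqm.ae hw]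
        with x e1 e2 e3 e4 e5 e6 e7 e8
      rw [e1, e2, Pi.sub_apply, Pi.sub_apply, e3, e4, e5, e7]
      exact h3 _ _ e8 e6
    calc _ ≤ C3 * (2 * B * θ ^ (α / 2)) := h2.trans (by gcongr)
      _ = _ := by ring
  -- One quarter power of -Δ is left on φ and the other is moved to F'(w).
  rw [pairF'_eq_inner hf, show (1 / 2 : ℝ) = 1 / 4 + 1 / 4 by norm_num,
    ← specOp_specOp (by norm_num) (by norm_num), ← inner_specOp_left]
  refine (abs_real_inner_le_norm _ _).trans ?_
  calc ‖specOp N (1 / 4) f‖ * ‖specOp N (1 / 4) φ‖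
      ≤ C * (C3 * (2 * B)) * ‖specOp N (1 / 4) φ‖ := by gcongr; exact hf2 N
    _ = _ := by ring

/-- First-order expansion of the energy. -/
lemma exists_energyE_taylor (hF : ContDiff ℝ 3 F) (M : ℝ) :
    ∃ C, 0 ≤ C ∧ ∀ w w', AEBound M w → AEBound M w' →
      |energyE F C₀ w - energyE F C₀ w' - pairF' F w' (w - w')| ≤ C * ‖w - w'‖ ^ 2 := by
  have hF' : ContDiff ℝ 2 (deriv F) := contDiff_deriv (by exact_mod_cast hF)
  obtain ⟨C, hC0, hC⟩ := exists_taylor_bound (hF.of_le (by norm_num) : ContDiff ℝ 2 F) M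
  refine ⟨C, hC0, fun w w' hw hw' => ?_⟩
  obtain ⟨f, hf⟩ := exists_comp hF'.continuous hw'
  have hint : Integrable (fun x => deriv F (w' x) * (w - w') x) (volume : Measure Torus) := by
    refine (integrable_mul_L2 f (w - w')).congr ?_
    filter_upwards [hf] with x hx
    rw [hx]
  have hi1 := hw.integrable_comp hF.continuous
  have hi2 := hw'.integrable_comp hF.continuous
  have : energyE F C₀ w - energyE F C₀ w' - pairF' F w' (w - w')
      = ∫ x : Torus, (F (w x) - F (w' x) - deriv F (w' x) * (w - w') x) := by
    rw [integral_sub (f := fun x => F (w x) - F (w' x)) (hi1.sub hi2) hint, integral_sub hi1 hi2,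
      energyE, energyE, pairF']
    ring
  rw [this, pow_two]
  refine abs_integral_le_mul hC0 ?_
  filter_upwards [hw, hw', Lp.coeFn_sub w w'] with x h1 h2 h3
  rw [h3, Pi.sub_apply, ← pow_two]
  exact hC _ _ h1 h2

/-- First-order expansion of the nonlinear term, with a quadratic remainder. -/
lemma exists_pairF'_taylor (hF : ContDiff ℝ 3 F) (M : ℝ) :
    ∃ C, 0 ≤ C ∧ ∀ w', AEBound M w' → ∀ φ : L2per, ∃ G : L2per, ‖G‖ ≤ C * ‖φ‖ ∧
      ∀ (w : L2per) (b : ℝ), AEBound M w → AEBound b (w - w') →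
        |pairF' F w φ - pairF' F w' φ - inner ℝ G (w - w')| ≤ C * b * (‖w - w'‖ * ‖φ‖) := by
  have hF' : ContDiff ℝ 2 (deriv F) := contDiff_deriv (by exact_mod_cast hF)
  have hF'' : Continuous (deriv (deriv F)) := (contDiff_deriv (n := 1) hF').continuous
  obtain ⟨C1, hC1, h1⟩ := exists_taylor_bound hF' M
  obtain ⟨C2, hC2, h2⟩ := exists_const_bound hF'' M
  refine ⟨C1 + C2, by positivity, fun w' hw' φ => ?_⟩
  have hm : AEStronglyMeasurable (fun x => deriv (deriv F) (w' x) * φ x) (volume : Measure Torus) :=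
    (hF''.comp_aestronglyMeasurable (Lp.aestronglyMeasurable w')).mul (Lp.aestronglyMeasurable φ)
  have hL : MemLp (fun x => deriv (deriv F) (w' x) * φ x) 2 (volume : Measure Torus) := by
    refine MemLp.of_le_mul (c := C2) (Lp.memLp φ) hm ?_
    filter_upwards [hw'] with x hx
    rw [norm_mul]
    gcongr
    exact h2 _ hx
  -- The derivative of the pairing at w' is represented by G = F''(w') φ. In the remainder one
  -- factor w - w' is taken in L^∞ and the other in L².
  refine ⟨hL.toLp _, ?_, fun w b hw hb => ?_⟩
  · have : ‖hL.toLp _‖ ≤ C2 * ‖φ‖ := by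
      apply Lp.norm_le_mul_norm_of_ae_le_mul
      filter_upwards [hw', hL.coeFn_toLp] with x hx h
      rw [h, norm_mul]
      gcongr
      exact h2 _ hx
    refine this.trans ?_
    gcongr
    linarith
  · have hb0 : 0 ≤ b := by
      obtain ⟨x, hx⟩ := hb.exists
      exact (abs_nonneg _).trans hx
    obtain ⟨f, hf⟩ := exists_comp hF'.continuous hw
    obtain ⟨f', hf'⟩ := exists_comp hF'.continuous hw'
    rw [pairF'_eq_inner hf, pairF'_eq_inner hf', ← inner_sub_left, inner_eq_integral,
      inner_eq_integral, ← integral_sub (integrable_mul_L2 _ _) (integrable_mul_L2 _ _)]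
    refine abs_integral_le_mul (by positivity) ?_
    filter_upwards [hw, hw', hf, hf', Lp.coeFn_sub w w', hb, hL.coeFn_toLp, Lp.coeFn_sub f f']
      with x e1 e2 e3 e4 e5 e6 e7 e8
    rw [e8, Pi.sub_apply, e3, e4, e7, e5, Pi.sub_apply]
    rw [e5, Pi.sub_apply] at e6
    have e := h1 _ _ e1 e2
    have key : (deriv F (w x) - deriv F (w' x)) * φ x
        - deriv (deriv F) (w' x) * φ x * (w x - w' x)
        = (deriv F (w x) - deriv F (w' x) - deriv (deriv F) (w' x) * (w x - w' x)) * φ x := by ring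
    rw [key, abs_mul]
    calc _ ≤ C1 * |w x - w' x| ^ 2 * |φ x| := by gcongr
      _ = C1 * |w x - w' x| * (|w x - w' x| * |φ x|) := by ring
      _ ≤ (C1 + C2) * b * (|w x - w' x| * |φ x|) := by gcongr; linarith

end

end SAVWave

/-! ### Absolutely continuous functions of time and quadrature errors. -/

namespace SAVWave

noncomputable section

variable {E : Type*} [NormedAddCommGroup E] [NormedSpace ℝ E] {T : ℝ} {f f' f'' : ℝ → E}

lemma uIcc_subset_Icc_zero {s t : ℝ} (hs : s ∈ Icc 0 T) (ht : t ∈ Icc 0 T) :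
    uIcc s t ⊆ Icc 0 T := (ordConnected_Icc).uIcc_subset hs ht

lemma IsTimeDeriv.intervalIntegrable (h : IsTimeDeriv T f f') {s t : ℝ} (hs : s ∈ Icc 0 T)
    (ht : t ∈ Icc 0 T) : IntervalIntegrable f' volume s t := by
  refine h.1.mono_set ?_
  rw [uIcc_of_le (hs.1.trans hs.2)]
  exact uIcc_subset_Icc_zero hs ht

lemma IsTimeDeriv.sub_eq (h : IsTimeDeriv T f f') {s t : ℝ} (hs : s ∈ Icc 0 T)
    (ht : t ∈ Icc 0 T) : f t - f s = ∫ x in s..t, f' x := by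
  have h0 : (0 : ℝ) ∈ Icc 0 T := ⟨le_rfl, hs.1.trans hs.2⟩
  rw [h.2 t ht, h.2 s hs, add_sub_add_left_eq_sub,
    intervalIntegral.integral_interval_sub_left (h.intervalIntegrable h0 ht)
      (h.intervalIntegrable h0 hs)]

/-- The essential bound `‖g(t)‖ ≤ B` for almost every `t ∈ (0, T)`. -/
def TimeBound (T B : ℝ) (g : ℝ → E) : Prop := ∀ᵐ t ∂(volume.restrict (Ioo 0 T)), ‖g t‖ ≤ B

lemma timeBound_of_forall {G : Type*} [NormedAddCommGroup G] {B : ℝ} {g : ℝ → G}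
    (h : ∀ t ∈ Icc 0 T, ‖g t‖ ≤ B) : TimeBound T B g :=
  (ae_restrict_iff' measurableSet_Ioo).2 (ae_of_all _ fun t ht => h t (Ioo_subset_Icc_self ht))

lemma TimeBound.norm_integral_le {B : ℝ} {g : ℝ → E} (h : TimeBound T B g) {s t : ℝ}
    (hs : s ∈ Icc 0 T) (ht : t ∈ Icc 0 T) : ‖∫ x in s..t, g x‖ ≤ B * |t - s| := by
  apply intervalIntegral.norm_integral_le_of_norm_le_const_ae
  have h1 := (ae_restrict_iff' measurableSet_Ioo).1 h
  have hT : ∀ᵐ x : ℝ, x ≠ T := Measure.ae_ne volume T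
  filter_upwards [h1, hT] with x hx hxT hmem
  have h2 := uIcc_subset_Icc_zero hs ht
  apply hx
  refine ⟨?_, lt_of_le_of_ne (h2 (uIoc_subset_uIcc hmem)).2 hxT⟩
  have h3 : min s t < x := hmem.1
  exact lt_of_le_of_lt (le_min hs.1 ht.1) h3

lemma IsTimeDeriv.norm_sub_le (h : IsTimeDeriv T f f') {B : ℝ} (hB : TimeBound T B f') {s t : ℝ}
    (hs : s ∈ Icc 0 T) (ht : t ∈ Icc 0 T) : ‖f t - f s‖ ≤ B * |t - s| := by
  rw [h.sub_eq hs ht]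
  exact hB.norm_integral_le hs ht

lemma IsTimeDeriv.continuousOn (h : IsTimeDeriv T f f') (hT : 0 ≤ T) :
    ContinuousOn f (Icc 0 T) := by
  have h1 := intervalIntegral.continuousOn_primitive_interval'
    (μ := volume) (f := f') (a := 0) (b₁ := 0) (b₂ := T) h.1 left_mem_uIcc
  rw [uIcc_of_le hT] at h1
  exact (continuousOn_const.add h1).congr fun t ht => h.2 t ht

lemma IsTimeDeriv.intervalIntegrable_self (h : IsTimeDeriv T f f') {s t : ℝ}
    (hs : s ∈ Icc 0 T) (ht : t ∈ Icc 0 T) : IntervalIntegrable f volume s t :=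
  ((h.continuousOn (hs.1.trans hs.2)).mono (uIcc_subset_Icc_zero hs ht)).intervalIntegrable

/-- Lets the quadrature estimates below be applied in stronger norms, after composition with
`specOp`. -/
lemma IsTimeDeriv.clm [CompleteSpace E] {G : Type*} [NormedAddCommGroup G] [NormedSpace ℝ G]
    [CompleteSpace G]
    (A : E →L[ℝ] G) (h : IsTimeDeriv T f f') :
    IsTimeDeriv T (fun t => A (f t)) (fun t => A (f' t)) := by
  refine ⟨⟨A.integrable_comp h.1.1, A.integrable_comp h.1.2⟩, fun t ht => ?_⟩
  have h0 : (0 : ℝ) ∈ Icc 0 T := ⟨le_rfl, ht.1.trans ht.2⟩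
  change A (f t) = A (f 0) + ∫ x in (0 : ℝ)..t, A (f' x)
  rw [h.2 t ht, map_add, ← A.intervalIntegral_comp_comm (h.intervalIntegrable h0 ht)]

/-- Taylor's formula in time. -/
lemma IsTimeDeriv.norm_taylor_le [CompleteSpace E] (h : IsTimeDeriv T f f')
    (h' : IsTimeDeriv T f' f'') {B : ℝ}
    (hB : TimeBound T B f'') {s t : ℝ} (hs : s ∈ Icc 0 T) (ht : t ∈ Icc 0 T) :
    ‖f t - f s - (t - s) • f' s‖ ≤ B * (t - s) ^ 2 := by
  have h1 : f t - f s - (t - s) • f' s = ∫ x in s..t, (f' x - f' s) := by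
    rw [intervalIntegral.integral_sub (h.intervalIntegrable hs ht) intervalIntegrable_const,
      intervalIntegral.integral_const, h.sub_eq hs ht]
  have hB0 : 0 ≤ B * |t - s| := (norm_nonneg _).trans (h'.norm_sub_le hB hs ht)
  have h2 : ‖∫ x in s..t, (f' x - f' s)‖ ≤ (B * |t - s|) * |t - s| := by
    apply intervalIntegral.norm_integral_le_of_norm_le_const
    intro x hx
    have hx' := uIoc_subset_uIcc hx
    refine (h'.norm_sub_le hB hs (uIcc_subset_Icc_zero hs ht hx')).trans ?_
    rcases eq_or_ne t s with hts | hts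
    · subst hts; simp at hx
    have hB1 : 0 ≤ B := by
      by_contra! hneg
      have : 0 < |t - s| := abs_pos.2 (sub_ne_zero.2 hts)
      nlinarith
    exact mul_le_mul_of_nonneg_left (abs_sub_left_of_mem_uIcc hx') hB1
  rw [h1]
  refine h2.trans (le_of_eq ?_)
  rw [mul_assoc, abs_mul_abs_self]; ring

variable [CompleteSpace E]

lemma mid_mem {a τ : ℝ} (ha : a ∈ Icc 0 T) (hτ : 0 < τ) (hb : a + τ ∈ Icc 0 T) :
    a + τ / 2 ∈ Icc 0 T :=
  ⟨by linarith [ha.1], by linarith [hb.2]⟩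

/-- No sign of B is assumed; a step of positive length inside [0, T] forces it. -/
lemma TimeBound.nonneg_of_step (h : IsTimeDeriv T f f') (h' : IsTimeDeriv T f' f'') {B : ℝ}
    (hB : TimeBound T B f'') {a τ : ℝ} (ha : a ∈ Icc 0 T) (hτ : 0 < τ) (hb : a + τ ∈ Icc 0 T) :
    0 ≤ B := by
  have := (norm_nonneg _).trans (h.norm_taylor_le h' hB ha hb)
  have h2 : 0 < (a + τ - a) ^ 2 := by rw [add_sub_cancel_left]; positivity
  exact nonneg_of_mul_nonneg_left this h2

/-- After subtraction of the Taylor polynomial at the midpoint only the remainder is left, since the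
linear term has integral zero over the step. -/
lemma IsTimeDeriv.norm_midpoint_le (h : IsTimeDeriv T f f') (h' : IsTimeDeriv T f' f'') {B : ℝ}
    (hB : TimeBound T B f'') {a τ : ℝ} (ha : a ∈ Icc 0 T) (hτ : 0 < τ) (hb : a + τ ∈ Icc 0 T) :
    ‖(∫ x in a..a + τ, f x) - τ • f (a + τ / 2)‖ ≤ B * τ ^ 3 := by
  have hm := mid_mem ha hτ hb
  have hB0 := TimeBound.nonneg_of_step h h' hB ha hτ hb
  have hlin : ∫ x in a..a + τ, (x - (a + τ / 2)) = 0 := by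
    rw [intervalIntegral.integral_sub (by simp) (by simp), integral_id,
      intervalIntegral.integral_const]
    simp only [smul_eq_mul]; ring
  have h1 : (∫ x in a..a + τ, f x) - τ • f (a + τ / 2)
      = ∫ x in a..a + τ, (f x - f (a + τ / 2) - (x - (a + τ / 2)) • f' (a + τ / 2)) := by
    rw [intervalIntegral.integral_sub ((h.intervalIntegrable_self ha hb).sub
      intervalIntegrable_const) (Continuous.intervalIntegrable (by fun_prop) _ _),
      intervalIntegral.integral_sub (h.intervalIntegrable_self ha hb) intervalIntegrable_const,
      intervalIntegral.integral_const, intervalIntegral.integral_smul_const, hlin, zero_smul,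
      sub_zero, add_sub_cancel_left]
  rw [h1]
  have h2 : ‖∫ x in a..a + τ, (f x - f (a + τ / 2) - (x - (a + τ / 2)) • f' (a + τ / 2))‖
      ≤ (B * τ ^ 2) * |a + τ - a| := by
    apply intervalIntegral.norm_integral_le_of_norm_le_const
    intro x hx
    rw [uIoc_of_le (by linarith)] at hx
    refine (h.norm_taylor_le h' hB hm ⟨by linarith [ha.1, hx.1], hx.2.trans hb.2⟩).trans ?_
    refine mul_le_mul_of_nonneg_left ?_ hB0
    rw [sq_le_sq, abs_of_pos hτ, abs_le]
    constructor <;> linarith [hx.1, hx.2]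
  refine h2.trans (le_of_eq ?_)
  rw [add_sub_cancel_left, abs_of_pos hτ]; ring

/-- The first-order Taylor terms at the two endpoints are opposite and cancel. -/
lemma IsTimeDeriv.norm_average_le (h : IsTimeDeriv T f f') (h' : IsTimeDeriv T f' f'') {B : ℝ}
    (hB : TimeBound T B f'') {a τ : ℝ} (ha : a ∈ Icc 0 T) (hτ : 0 < τ) (hb : a + τ ∈ Icc 0 T) :
    ‖(1 / 2 : ℝ) • (f (a + τ) + f a) - f (a + τ / 2)‖ ≤ B * τ ^ 2 := by
  have hm := mid_mem ha hτ hb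
  have hB0 := TimeBound.nonneg_of_step h h' hB ha hτ hb
  have e1 := h.norm_taylor_le h' hB hm hb
  have e2 := h.norm_taylor_le h' hB hm ha
  have key : (1 / 2 : ℝ) • (f (a + τ) + f a) - f (a + τ / 2)
      = (1 / 2 : ℝ) • ((f (a + τ) - f (a + τ / 2) - (a + τ - (a + τ / 2)) • f' (a + τ / 2))
        + (f a - f (a + τ / 2) - (a - (a + τ / 2)) • f' (a + τ / 2))) := by
    module
  rw [key, norm_smul, Real.norm_of_nonneg (by norm_num)]
  have := norm_add_le (f (a + τ) - f (a + τ / 2) - (a + τ - (a + τ / 2)) • f' (a + τ / 2))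
    (f a - f (a + τ / 2) - (a - (a + τ / 2)) • f' (a + τ / 2))
  nlinarith [mul_nonneg hB0 (sq_nonneg τ)]

lemma IsTimeDeriv.norm_trapezoid_le (h : IsTimeDeriv T f f') (h' : IsTimeDeriv T f' f'') {B : ℝ}
    (hB : TimeBound T B f'') {a τ : ℝ} (ha : a ∈ Icc 0 T) (hτ : 0 < τ) (hb : a + τ ∈ Icc 0 T) :
    ‖(∫ x in a..a + τ, f x) - τ • ((1 / 2 : ℝ) • (f (a + τ) + f a))‖ ≤ 2 * B * τ ^ 3 := by
  have e1 := h.norm_midpoint_le h' hB ha hτ hb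
  have e2 := h.norm_average_le h' hB ha hτ hb
  have key : (∫ x in a..a + τ, f x) - τ • ((1 / 2 : ℝ) • (f (a + τ) + f a))
      = ((∫ x in a..a + τ, f x) - τ • f (a + τ / 2))
        - τ • ((1 / 2 : ℝ) • (f (a + τ) + f a) - f (a + τ / 2)) := by module
  rw [key]
  refine (_root_.norm_sub_le _ _).trans ?_
  rw [norm_smul, Real.norm_of_nonneg hτ.le]
  nlinarith [mul_le_mul_of_nonneg_left e2 hτ.le]

/-- The weights 3/2 and -1/2 reproduce affine functions at the midpoint of the next step, so only
second-order remainders survive. -/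
lemma IsTimeDeriv.norm_extrapolation_le (h : IsTimeDeriv T f f') (h' : IsTimeDeriv T f' f'') {B : ℝ}
    (hB : TimeBound T B f'') {a τ : ℝ} (ha : a ∈ Icc 0 T) (hτ : 0 < τ) (hb : a + τ ∈ Icc 0 T)
    (hc : a - τ ∈ Icc 0 T) :
    ‖f (a + τ / 2) - (1 / 2 : ℝ) • ((3 : ℝ) • f a - f (a - τ))‖ ≤ 2 * B * τ ^ 2 := by
  have hm := mid_mem ha hτ hb
  have hB0 := TimeBound.nonneg_of_step h h' hB ha hτ hb
  have e1 := h.norm_taylor_le h' hB hm ha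
  have e2 := h.norm_taylor_le h' hB hm hc
  have key : f (a + τ / 2) - (1 / 2 : ℝ) • ((3 : ℝ) • f a - f (a - τ))
      = (1 / 2 : ℝ) • ((f (a - τ) - f (a + τ / 2) - (a - τ - (a + τ / 2)) • f' (a + τ / 2))
        - (3 : ℝ) • (f a - f (a + τ / 2) - (a - (a + τ / 2)) • f' (a + τ / 2))) := by
    module
  rw [key, norm_smul, Real.norm_of_nonneg (by norm_num)]
  have := _root_.norm_sub_le (f (a - τ) - f (a + τ / 2) - (a - τ - (a + τ / 2)) • f' (a + τ / 2))
    ((3 : ℝ) • (f a - f (a + τ / 2) - (a - (a + τ / 2)) • f' (a + τ / 2)))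
  rw [norm_smul, Real.norm_of_nonneg (by norm_num : (0 : ℝ) ≤ 3)] at this
  nlinarith [mul_nonneg hB0 (sq_nonneg τ)]

end

end SAVWave

/-! ### Quantitative data of the exact solution. -/

namespace SAVWave

noncomputable section

variable {κ α γ₁ γ₂ T C₀ m L B M : ℝ} {F : ℝ → ℝ} {u ut utt uttt : ℝ → L2per}
  {r rt rtt rttt : ℝ → ℝ}

/-- The quantitative facts on the exact solution that enter the error analysis. -/
structure ExactData (κ α γ₁ γ₂ : ℝ) (F : ℝ → ℝ) (C₀ T m B M : ℝ) (u ut utt uttt : ℝ → L2per)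
    (r rt rtt rttt : ℝ → ℝ) : Prop where
  du : IsTimeDeriv T u ut
  dut : IsTimeDeriv T ut utt
  dutt : IsTimeDeriv T utt uttt
  dr : IsTimeDeriv T r rt
  drt : IsTimeDeriv T rt rtt
  drtt : IsTimeDeriv T rtt rttt
  weak : ∀ N, ∀ t ∈ Ioc 0 T, ∀ φ ∈ XN N, inner ℝ (utt t) φ
    + κ * inner ℝ (u t) (specOp N (α / 2) φ) + γ₁ * inner ℝ (ut t) (specOp N (α / 2) φ)
    + γ₂ * inner ℝ (ut t) φ + pairF' F (u t) φ = 0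
  sup : ∀ t ∈ Icc 0 T, AEBound M (u t)
  sup_sub : ∀ s ∈ Icc 0 T, ∀ t ∈ Icc 0 T, AEBound (B * |t - s|) (u t - u s)
  norm_u : ∀ t ∈ Icc 0 T, ‖u t‖ ≤ B
  norm_ut : ∀ t ∈ Icc 0 T, ‖ut t‖ ≤ B
  norm_utt : ∀ t ∈ Icc 0 T, ‖utt t‖ ≤ B
  norm_uttt : TimeBound T B uttt
  semi_u : ∀ t ∈ Icc 0 T, ∀ β, 0 ≤ β → β ≤ α / 2 → SemiBound β B (u t)
  semi_ut : ∀ t ∈ Icc 0 T, ∀ β, 0 ≤ β → β ≤ α / 2 → SemiBound β B (ut t)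
  semi_utt : ∀ t ∈ Icc 0 T, ∀ β, 0 ≤ β → β ≤ α / 2 → SemiBound β B (utt t)
  semi_uttt : ∀ N, TimeBound T B fun t => specOp N (α / 4) (uttt t)
  proj_u : ∀ t ∈ Icc 0 T, ∀ N, 4 ≤ N → ‖u t - specOp N 0 (u t)‖ ≤ B * (N : ℝ) ^ (-m)
  proj_ut : ∀ t ∈ Icc 0 T, ∀ N, 4 ≤ N → ‖ut t - specOp N 0 (ut t)‖ ≤ B * (N : ℝ) ^ (-m)
  bound_r : ∀ t ∈ Icc 0 T, |r t| ≤ B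
  bound_rtt : TimeBound T B rtt
  bound_rttt : TimeBound T B rttt
  r_eq : ∀ t ∈ Icc 0 T, r t = √(energyE F C₀ (u t))
  rt_eq : ∀ t ∈ Icc 0 T, rt t = 1 / 2 * forceF F C₀ (u t) (ut t)

lemma TimeBound.mono {E : Type*} [NormedAddCommGroup E] {B' : ℝ} {g : ℝ → E}
    (h : TimeBound T B g) (hB : B ≤ B') : TimeBound T B' g :=
  Filter.Eventually.mono h fun _ ht => le_trans ht hB

lemma SemiBound.mono {β B' : ℝ} {f : L2per} (h : SemiBound β B f) (hB : B ≤ B') :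
    SemiBound β B' f := fun N => (h N).trans hB

lemma AEBound.mono {M' : ℝ} {f : L2per} (h : AEBound M f) (hM : M ≤ M') : AEBound M' f := by
  filter_upwards [h] with x hx
  exact hx.trans hM

lemma timeBound_of_linfNorm {q : ℝ → ℝ} (h : linfNorm T q ≤ ENNReal.ofReal L) :
    TimeBound T (max L 0) q := by
  rw [linfNorm, eLpNorm_exponent_top] at h
  have h1 := ae_le_eLpNormEssSup (f := q) (μ := volume.restrict (Ioo 0 T))
  filter_upwards [h1] with t ht
  have h2 := ht.trans h
  rw [← ofReal_norm] at h2
  have h3 : ENNReal.ofReal L ≤ ENNReal.ofReal (max L 0) :=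
    ENNReal.ofReal_le_ofReal (le_max_left _ _)
  exact (ENNReal.ofReal_le_ofReal_iff (le_max_right _ _)).1 (h2.trans h3)

lemma sobNorm_le_of_supNorm {ρ : ℝ} {w : ℝ → L2per} (h : supNorm T ρ w ≤ ENNReal.ofReal L) {t : ℝ}
    (ht : t ∈ Icc 0 T) : sobNorm ρ (w t) ≤ ENNReal.ofReal L :=
  (le_iSup₂ (f := fun t (_ : t ∈ Icc 0 T) => sobNorm ρ (w t)) t ht).trans h

lemma ae_sobNorm_le_of_essSupNorm {ρ : ℝ} {w : ℝ → L2per}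
    (h : essSupNorm T ρ w ≤ ENNReal.ofReal L) :
    ∀ᵐ t ∂(volume.restrict (Ioo 0 T)), sobNorm ρ (w t) ≤ ENNReal.ofReal L := by
  filter_upwards [ENNReal.ae_le_essSup (μ := volume.restrict (Ioo 0 T))
    (fun t => sobNorm ρ (w t))] with t ht
  exact ht.trans h

lemma RegularityBound.components {φ₀ : L2per}
    (h : RegularityBound m α T L φ₀ u ut utt uttt r rt rtt rttt) :
    supNorm T m u ≤ ENNReal.ofReal L ∧ linfNorm T rt ≤ ENNReal.ofReal L ∧
    linfNorm T rtt ≤ ENNReal.ofReal L ∧ linfNorm T rttt ≤ ENNReal.ofReal L ∧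
    supNorm T m ut ≤ ENNReal.ofReal L ∧ supNorm T α u ≤ ENNReal.ofReal L ∧
    supNorm T α ut ≤ ENNReal.ofReal L ∧ supNorm T α utt ≤ ENNReal.ofReal L ∧
    essSupNorm T (α / 2) uttt ≤ ENNReal.ofReal L := by
  unfold RegularityBound at h
  have h1 := le_self_add.trans h
  have h2 := le_self_add.trans h1
  have h3 := le_self_add.trans h2
  have h4 := le_self_add.trans h3
  have h5 := le_self_add.trans h4
  have h6 := le_self_add.trans h5
  have h7 := le_self_add.trans h6
  have h8 := le_self_add.trans h7
  have h9 := le_self_add.trans h8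
  exact ⟨le_add_self.trans h9, le_add_self.trans h7, le_add_self.trans h6, le_add_self.trans h5,
    le_add_self.trans h4, le_add_self.trans h3, le_add_self.trans h2, le_add_self.trans h1,
    le_add_self.trans h⟩

/-- A number that is `O(|s - t|)` for `s` in a nontrivial interval containing `t` is zero. -/
lemma eq_zero_of_abs_mul_le {C X t : ℝ} (hT : 0 < T) (ht : t ∈ Icc 0 T) (hC : 0 ≤ C)
    (h : ∀ s ∈ Icc 0 T, |(s - t) * X| ≤ C * (s - t) ^ 2) : X = 0 := by
  by_contra hX
  have hX' : 0 < |X| := abs_pos.2 hX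
  -- At most T/2, so that t + d or t - d stays in [0, T], and small enough that C d < |X|.
  set d := min (T / 2) (|X| / (2 * (C + 1))) with hd
  have hd0 : 0 < d := by positivity
  have hd1 : d ≤ T / 2 := min_le_left _ _
  have hd2 : d * (2 * (C + 1)) ≤ |X| := by
    rw [← le_div_iff₀ (by positivity)]; exact min_le_right _ _
  obtain ⟨s, hs, hsd⟩ : ∃ s ∈ Icc 0 T, |s - t| = d := by
    rcases le_total t (T / 2) with h1 | h1
    · exact ⟨t + d, ⟨by linarith [ht.1], by linarith⟩, by rw [add_sub_cancel_left, abs_of_pos hd0]⟩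
    · refine ⟨t - d, ⟨by linarith, by linarith [ht.2]⟩, ?_⟩
      rw [sub_sub_cancel_left, abs_neg, abs_of_pos hd0]
  have h1 := h s hs
  rw [abs_mul, hsd, ← sq_abs (s - t), hsd, pow_two, mul_left_comm] at h1
  have h2 := le_of_mul_le_mul_left h1 hd0
  nlinarith

/-- The chain rule for `r = √E(u)`. -/
lemma two_mul_mul_deriv_sqrt_energy (hT : 0 < T) (hF : ContDiff ℝ 3 F)
    (hE : ∀ w : L2per, (∃ M : ℝ, ∀ᵐ x : Torus, |w x| ≤ M) → 0 < energyE F C₀ w)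
    (hM : 0 ≤ M) (hB0 : 0 ≤ B)
    (hr : ∀ t ∈ Icc 0 T, r t = √(energyE F C₀ (u t)))
    (du : IsTimeDeriv T u ut) (dut : IsTimeDeriv T ut utt)
    (dr : IsTimeDeriv T r rt) (drt : IsTimeDeriv T rt rtt)
    (hut : TimeBound T B ut) (hutt : TimeBound T B utt) (hrt : TimeBound T B rt)
    (hrtt : TimeBound T B rtt) (hsup : ∀ t ∈ Icc 0 T, AEBound M (u t)) {t : ℝ}
    (ht : t ∈ Icc 0 T) : 2 * r t * rt t = pairF' F (u t) (ut t) := by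
  obtain ⟨Cf, hCf, hC1, -, -, -⟩ := exists_force_bounds hF hE hM
  obtain ⟨CE, hCE, hC2⟩ := exists_energyE_taylor (C₀ := C₀) hF M
  have hF' : Continuous (deriv F) := (contDiff_deriv (n := 2) (by exact_mod_cast hF)).continuous
  obtain ⟨f, hf⟩ := exists_comp hF' (hsup t ht)
  have hr0 : 0 ≤ r t := by rw [hr t ht]; exact Real.sqrt_nonneg _
  rw [← sub_eq_zero]
  -- The increment r(s)² - r(t)² is expanded in two ways, through E(u) and through r. The four terms
  -- of C come from the Taylor remainders of E, of u and of r, and from (r(s) - r(t))².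
  refine eq_zero_of_abs_mul_le (C := CE * B ^ 2 + Cf * B + 2 * r t * B + B ^ 2) hT ht (by positivity)
    fun s hs => ?_
  have sq : ∀ t ∈ Icc 0 T, r t ^ 2 = energyE F C₀ (u t) := fun t ht => by
    rw [hr t ht, Real.sq_sqrt (hE _ ⟨M, hsup t ht⟩).le]
  have e1 := hC2 _ _ (hsup s hs) (hsup t ht)
  rw [← sq s hs, ← sq t ht] at e1
  have e2 := du.norm_sub_le hut ht hs
  have e3 := du.norm_taylor_le dut hutt ht hs
  have e4 := dr.norm_sub_le hrt ht hs
  have e5 := dr.norm_taylor_le drt hrtt ht hs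
  have e6 := hC1 _ (hsup t ht) (u s - u t - (s - t) • ut t)
  rw [pairF'_eq_inner hf, inner_sub_right, inner_smul_right, ← pairF'_eq_inner hf,
    ← pairF'_eq_inner hf] at e6
  rw [Real.norm_eq_abs] at e4 e5
  rw [smul_eq_mul] at e5
  set p := pairF' F (u t) (u s - u t)
  set q := pairF' F (u t) (ut t)
  have e7 : ‖u s - u t‖ ^ 2 ≤ B ^ 2 * (s - t) ^ 2 := by
    rw [← sq_abs (s - t), ← mul_pow]; exact pow_le_pow_left₀ (norm_nonneg _) e2 2
  have e8 : (r s - r t) ^ 2 ≤ B ^ 2 * (s - t) ^ 2 := by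
    rw [← sq_abs (s - t), ← mul_pow, ← sq_abs (r s - r t)]
    exact pow_le_pow_left₀ (abs_nonneg _) e4 2
  have e9 : |r s ^ 2 - r t ^ 2 - p| ≤ CE * (B ^ 2 * (s - t) ^ 2) :=
    e1.trans (by gcongr)
  have e10 : |p - (s - t) * q| ≤ Cf * (B * (s - t) ^ 2) := e6.trans (by gcongr)
  have e11 : |2 * r t * (r s - r t - (s - t) * rt t)| ≤ 2 * r t * (B * (s - t) ^ 2) := by
    rw [abs_mul, abs_of_nonneg (by positivity : 0 ≤ 2 * r t)]
    gcongr
  rw [abs_le] at e9 e10 e11 ⊢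
  constructor <;> nlinarith [e9.1, e9.2, e10.1, e10.2, e11.1, e11.2, sq_nonneg (r s - r t)]

/-- The assumptions of the convergence theorem provide the data of the error analysis, with the
spatial regularity `max m α`. -/
lemma exists_exactData (hα₁ : 1 < α)
    (hT : 0 < T) (hm : 0 ≤ m) (hF : ContDiff ℝ 3 F)
    (hE : ∀ w : L2per, (∃ M : ℝ, ∀ᵐ x : Torus, |w x| ≤ M) → 0 < energyE F C₀ w)
    {φ₀ φ₁ : L2per} (hu : IsExactSolution κ α γ₁ γ₂ F T φ₀ φ₁ u ut utt)
    (huttt : IsTimeDeriv T utt uttt) (hr : ∀ t ∈ Set.Icc 0 T, r t = √(energyE F C₀ (u t)))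
    (hrt : IsTimeDeriv T r rt) (hrtt : IsTimeDeriv T rt rtt) (hrttt : IsTimeDeriv T rtt rttt)
    (hL : RegularityBound m α T L φ₀ u ut utt uttt r rt rtt rttt) :
    ∃ B M, 0 ≤ B ∧ 0 ≤ M ∧
      ExactData κ α γ₁ γ₂ F C₀ T (max m α) B M u ut utt uttt r rt rtt rttt := by
  obtain ⟨l1, l2, l3, l4, l5, l6, l7, l8, l9⟩ := hL.components
  have hp := Real.pi_pos
  have hL0 : 0 ≤ max L 0 := le_max_right _ _
  set B₀ := 2 * Real.pi * max L 0 with hB₀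
  have hB₀0 : 0 ≤ B₀ := by positivity
  have hα0 : 0 ≤ α := by linarith
  obtain ⟨Cs, hCs, hsup⟩ := exists_sup_bound hα₁ one_pos
  -- The L^∞ bound on r holds only almost everywhere; by continuity a bound holds at every time.
  obtain ⟨Br, hBr⟩ := isCompact_Icc.exists_bound_of_continuousOn (hrt.continuousOn hT.le)
  have semi : ∀ {w : ℝ → L2per}, supNorm T α w ≤ ENNReal.ofReal L → ∀ t ∈ Icc 0 T, ∀ β, 0 ≤ β →
      β ≤ α / 2 → SemiBound β B₀ (w t) := fun hw t ht β hβ hβα =>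
    semiBound_of_sobNorm_le hβ (by linarith) (sobNorm_le_of_supNorm hw ht)
  have nrm : ∀ {w : ℝ → L2per}, supNorm T α w ≤ ENNReal.ofReal L → ∀ t ∈ Icc 0 T, ‖w t‖ ≤ B₀ :=
    fun hw t ht => norm_le_of_sobNorm_le hα0 (sobNorm_le_of_supNorm hw ht)
  have hmax : ∀ {w : ℝ → L2per}, supNorm T α w ≤ ENNReal.ofReal L →
      supNorm T m w ≤ ENNReal.ofReal L → ∀ t ∈ Icc 0 T,
      sobNorm (max m α) (w t) ≤ ENNReal.ofReal L := by
    intro w h1 h2 t ht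
    rcases max_choice m α with h | h <;> rw [h]
    · exact sobNorm_le_of_supNorm h2 ht
    · exact sobNorm_le_of_supNorm h1 ht
  set M := Cs * B₀ + B₀ with hM
  have hM0 : 0 ≤ M := by positivity
  have sup : ∀ t ∈ Icc 0 T, AEBound M (u t) := by
    intro t ht
    filter_upwards [hsup (u t) B₀ (semi l6 t ht _ (by linarith) le_rfl)] with x hx
    refine hx.trans ?_
    rw [one_mul, hM]
    have := nrm l6 t ht
    gcongr
  -- A single constant that dominates all norms, the bound on r and the projection constants.
  set B := M + |Br| + max L 0 + 4 ^ (max m α) * B₀ with hB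
  have h4 : 1 ≤ (4 : ℝ) ^ (max m α) :=
    Real.one_le_rpow (by norm_num) (hm.trans (le_max_left _ _))
  have hBB₀ : B₀ ≤ B := by
    have := abs_nonneg Br
    nlinarith [mul_le_mul_of_nonneg_right h4 hB₀0]
  have h40 : 0 ≤ 4 ^ (max m α) * B₀ := by positivity
  have hBM : M ≤ B := by linarith [abs_nonneg Br]
  have hBr' : |Br| ≤ B := by linarith
  have hBL : max L 0 ≤ B := by linarith [abs_nonneg Br]
  have hB4 : 4 ^ (max m α) * B₀ ≤ B := by linarith [abs_nonneg Br]
  have hB0 : 0 ≤ B := hB₀0.trans hBB₀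
  have hut : TimeBound T B ut := timeBound_of_forall fun t ht => (nrm l7 t ht).trans hBB₀
  have hutt : TimeBound T B utt := timeBound_of_forall fun t ht => (nrm l8 t ht).trans hBB₀
  have hrtB := (timeBound_of_linfNorm l2).mono hBL
  have hrttB := (timeBound_of_linfNorm l3).mono hBL
  refine ⟨B, M, hB0, hM0, hu.deriv_u, hu.deriv_ut, huttt, hrt, hrtt, hrttt, ?_, sup, ?_,
    fun t ht => (nrm l6 t ht).trans hBB₀, fun t ht => (nrm l7 t ht).trans hBB₀,
    fun t ht => (nrm l8 t ht).trans hBB₀, ?_,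
    fun t ht β h0 h1 => (semi l6 t ht β h0 h1).mono hBB₀,
    fun t ht β h0 h1 => (semi l7 t ht β h0 h1).mono hBB₀,
    fun t ht β h0 h1 => (semi l8 t ht β h0 h1).mono hBB₀, ?_, ?_, ?_, ?_,
    hrttB, (timeBound_of_linfNorm l4).mono hBL, hr, ?_⟩
  · intro N t ht φ hφ
    have ht' : t ∈ Icc 0 T := Ioc_subset_Icc_self ht
    have hF' : Continuous (deriv F) := (contDiff_deriv (n := 2) (by exact_mod_cast hF)).continuous
    obtain ⟨f, hf⟩ := exists_comp hF' (sup t ht')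
    have hzero : utt t + κ • fracLap (α / 2) (u t) + γ₁ • fracLap (α / 2) (ut t) + γ₂ • ut t + f
        = 0 := by
      apply Lp.ext
      filter_upwards [hu.pde t ht, hf, Lp.coeFn_zero ℝ 2 (volume : Measure Torus),
        Lp.coeFn_add (utt t + κ • fracLap (α / 2) (u t) + γ₁ • fracLap (α / 2) (ut t) + γ₂ • ut t) f,
        Lp.coeFn_add (utt t + κ • fracLap (α / 2) (u t) + γ₁ • fracLap (α / 2) (ut t)) (γ₂ • ut t),
        Lp.coeFn_add (utt t + κ • fracLap (α / 2) (u t)) (γ₁ • fracLap (α / 2) (ut t)),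
        Lp.coeFn_add (utt t) (κ • fracLap (α / 2) (u t)),
        Lp.coeFn_smul κ (fracLap (α / 2) (u t)), Lp.coeFn_smul γ₁ (fracLap (α / 2) (ut t)),
        Lp.coeFn_smul γ₂ (ut t)] with x h1 h2 h3 a1 a2 a3 a4 s1 s2 s3
      rw [a1, Pi.add_apply, a2, Pi.add_apply, a3, Pi.add_apply, a4, Pi.add_apply, s1, s2, s3, h2, h3]
      exact h1
    have h1 := congrArg (fun g => inner ℝ g φ) hzero
    simp only [inner_add_left, inner_zero_left, real_inner_smul_left] at h1
    -- The functions u(t) and u_t(t) lie in the domain of (-Δ)^{α/2}, so the power can be moved onto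
    -- the test function.
    rw [inner_fracLap (semi l6 t ht' _ (by linarith) le_rfl).exists_fracLap hφ,
      inner_fracLap (semi l7 t ht' _ (by linarith) le_rfl).exists_fracLap hφ] at h1
    rw [pairF'_eq_inner hf]
    exact h1
  · intro s hs t ht
    -- As u_t is bounded in H^α with α > 1, u is Lipschitz in time with values in H^α, and by the
    -- embedding also in L^∞.
    have h1 : SemiBound (α / 2) (B₀ * |t - s|) (u t - u s) := by
      intro N
      rw [map_sub]
      exact (hu.deriv_u.clm (specOp N (α / 2))).norm_sub_le
        (timeBound_of_forall fun t ht => semi l7 t ht _ (by linarith) le_rfl N) hs ht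
    have h2 := hu.deriv_u.norm_sub_le (timeBound_of_forall fun t ht => nrm l7 t ht) hs ht
    filter_upwards [hsup _ _ h1] with x hx
    refine hx.trans ?_
    calc Cs * ‖u t - u s‖ + 1 * (B₀ * |t - s|) ≤ Cs * (B₀ * |t - s|) + 1 * (B₀ * |t - s|) := by gcongr
      _ = M * |t - s| := by rw [hM]; ring
      _ ≤ _ := by gcongr
  · filter_upwards [ae_sobNorm_le_of_essSupNorm l9] with t ht
    exact (norm_le_of_sobNorm_le (by linarith) ht).trans hBB₀
  · intro N
    filter_upwards [ae_sobNorm_le_of_essSupNorm l9] with t ht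
    exact (semiBound_of_sobNorm_le (by linarith) (by linarith) ht N).trans hBB₀
  · intro t ht N hN
    refine (norm_sub_specOp_zero_le hN (hm.trans (le_max_left _ _)) (hmax l6 l1 t ht)).trans ?_
    gcongr
  · intro t ht N hN
    refine (norm_sub_specOp_zero_le hN (hm.trans (le_max_left _ _)) (hmax l7 l5 t ht)).trans ?_
    gcongr
  · intro t ht
    exact ((hBr t ht).trans (le_abs_self _)).trans hBr'
  · intro t ht
    have h1 := two_mul_mul_deriv_sqrt_energy hT hF hE hM0 hB0 hr hu.deriv_u hu.deriv_ut hrt hrtt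
      hut hutt hrtB hrttB sup ht
    have h2 : 0 < r t := by rw [hr t ht]; exact Real.sqrt_pos.2 (hE _ ⟨M, sup t ht⟩)
    rw [forceF, ← hr t ht, ← h1]
    field_simp

end

end SAVWave

/-! ### The scheme in increments and its discrete energy law. -/

namespace SAVWave

noncomputable section

variable {κ α γ₁ γ₂ T C₀ m B M τ : ℝ} {F : ℝ → ℝ} {u ut utt uttt : ℝ → L2per}
  {r rt rtt rttt : ℝ → ℝ} {K N : ℕ}

/-- One step of the main scheme, written with increments. -/
structure StepEq (κ α γ₁ γ₂ : ℝ) (F : ℝ → ℝ) (C₀ τ : ℝ) (N : ℕ) (w : L2per)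
    (u v : L2per) (R : ℝ) (u' v' : L2per) (R' : ℝ) : Prop where
  mem_u : u ∈ XN N
  mem_v : v ∈ XN N
  mem_u' : u' ∈ XN N
  mem_v' : v' ∈ XN N
  eq_u : u' - u = τ • ((1 / 2 : ℝ) • (v' + v))
  eq_v : ∀ φ ∈ XN N, inner ℝ (v' - v) φ
      + τ * (κ * inner ℝ ((1 / 2 : ℝ) • (u' + u)) (specOp N (α / 2) φ)
      + γ₁ * inner ℝ ((1 / 2 : ℝ) • (v' + v)) (specOp N (α / 2) φ)
      + γ₂ * inner ℝ ((1 / 2 : ℝ) • (v' + v)) φ + (R' + R) / 2 * forceF F C₀ w φ) = 0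
  eq_R : R' - R = τ / 2 * forceF F C₀ w ((1 / 2 : ℝ) • (v' + v))

/-- The starting step, written with increments. -/
structure StartEq (κ α γ₁ γ₂ : ℝ) (F : ℝ → ℝ) (C₀ τ : ℝ) (N : ℕ)
    (u v : L2per) (R : ℝ) (u' v' : L2per) (R' : ℝ) : Prop where
  mem_u : u ∈ XN N
  mem_v : v ∈ XN N
  mem_u' : u' ∈ XN N
  mem_v' : v' ∈ XN N
  eq_u : u' - u = (τ / 2) • v'
  eq_v : ∀ φ ∈ XN N, inner ℝ (v' - v) φ
      + τ / 2 * (κ * inner ℝ u' (specOp N (α / 2) φ) + γ₁ * inner ℝ v' (specOp N (α / 2) φ)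
      + γ₂ * inner ℝ v' φ + R' * forceF F C₀ u φ) = 0
  eq_R : R' - R = τ / 4 * forceF F C₀ u v'

lemma inner_fracLap_of_mem {β : ℝ} {f φ : L2per} (hf : f ∈ XN N) :
    inner ℝ (fracLap β f) φ = inner ℝ f (specOp N β φ) := by
  rw [fracLap_of_mem_XN hf, inner_specOp_left]

/-- Both sides of the first equation lie in X_N, so it holds as an identity; it then replaces the
difference quotient of u by the averaged velocity in the equation for R. -/
lemma IsMainStep.stepEq {w u v u' v' : L2per} {R R' : ℝ} (hτ : 0 < τ)
    (h : IsMainStep κ α γ₁ γ₂ F C₀ τ N w u v R u' v' R') (hu : u ∈ XN N) (hv : v ∈ XN N)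
    (hu' : u' ∈ XN N) (hv' : v' ∈ XN N) :
    StepEq κ α γ₁ γ₂ F C₀ τ N w u v R u' v' R' := by
  have hvm : (1 / 2 : ℝ) • (v' + v) ∈ XN N := smul_mem_XN _ (add_mem_XN hv' hv)
  have hum : (1 / 2 : ℝ) • (u' + u) ∈ XN N := smul_mem_XN _ (add_mem_XN hu' hu)
  have hd : τ⁻¹ • (u' - u) = (1 / 2 : ℝ) • (v' + v) :=
    eq_of_inner_eq (smul_mem_XN _ (sub_mem_XN hu' hu)) hvm h.eq_u
  refine ⟨hu, hv, hu', hv', ?_, fun φ hφ => ?_, ?_⟩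
  · rw [← hd, smul_smul, mul_inv_cancel₀ hτ.ne', one_smul]
  · have := h.eq_v φ hφ
    rw [inner_fracLap_of_mem hum, inner_fracLap_of_mem hvm, real_inner_smul_left] at this
    rw [forceF]
    have h2 : inner ℝ (v' - v) φ = τ * (τ⁻¹ * inner ℝ (v' - v) φ) := by
      rw [mul_inv_cancel_left₀ hτ.ne']
    rw [h2]
    linear_combination τ * this
  · have := h.eq_R
    rw [hd, div_eq_iff hτ.ne'] at this
    rw [this, forceF]
    ring

lemma IsStartStep.startEq {u v u' v' : L2per} {R R' : ℝ} (hτ : 0 < τ)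
    (h : IsStartStep κ α γ₁ γ₂ F C₀ τ N u v R u' v' R') (hu : u ∈ XN N) (hv : v ∈ XN N) :
    StartEq κ α γ₁ γ₂ F C₀ τ N u v R u' v' R' := by
  have hτ2 : τ / 2 ≠ 0 := by positivity
  have hd : (τ / 2)⁻¹ • (u' - u) = v' :=
    eq_of_inner_eq (smul_mem_XN _ (sub_mem_XN h.mem_u hu)) h.mem_v h.eq_u
  refine ⟨hu, hv, h.mem_u, h.mem_v, ?_, fun φ hφ => ?_, ?_⟩
  · rw [← hd, smul_smul, mul_inv_cancel₀ hτ2, one_smul]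
  · have := h.eq_v φ hφ
    rw [inner_fracLap_of_mem h.mem_u, inner_fracLap_of_mem h.mem_v, real_inner_smul_left] at this
    rw [forceF]
    have h2 : inner ℝ (v' - v) φ = τ / 2 * ((τ / 2)⁻¹ * inner ℝ (v' - v) φ) := by
      rw [mul_inv_cancel_left₀ hτ2]
    rw [h2]
    linear_combination τ / 2 * this
  · have := h.eq_R
    rw [hd, div_eq_iff hτ2] at this
    rw [this, forceF]
    ring

/-- The discrete energy of order `β`. -/
def discEnergy (κ α : ℝ) (N : ℕ) (β : ℝ) (u v : L2per) : ℝ :=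
  ‖specOp N β v‖ ^ 2 + κ * ‖specOp N (β + α / 4) u‖ ^ 2

lemma discEnergy_nonneg (hκ : 0 ≤ κ) (β : ℝ) (u v : L2per) : 0 ≤ discEnergy κ α N β u v := by
  unfold discEnergy; positivity

lemma inner_specOp_two_mul {β : ℝ} (hβ : 0 ≤ β) (f g : L2per) :
    inner ℝ f (specOp N (2 * β) g) = inner ℝ (specOp N β f) (specOp N β g) := by
  rw [two_mul β, ← specOp_specOp hβ hβ, inner_specOp_left]

lemma inner_specOp_half_specOp {β : ℝ} (hα : 0 ≤ α) (hβ : 0 ≤ β) (f g : L2per) :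
    inner ℝ f (specOp N (α / 2) (specOp N (2 * β) g))
      = inner ℝ (specOp N (β + α / 4) f) (specOp N (β + α / 4) g) := by
  rw [specOp_specOp (by positivity) (by positivity), ← inner_specOp_two_mul (by positivity)]
  congr 3
  ring

lemma inner_half_add_sub (f g : L2per) :
    inner ℝ ((1 / 2 : ℝ) • (f + g)) (f - g) = (‖f‖ ^ 2 - ‖g‖ ^ 2) / 2 := by
  rw [real_inner_smul_left, inner_add_left, inner_sub_right, inner_sub_right,
    real_inner_self_eq_norm_sq, real_inner_self_eq_norm_sq, real_inner_comm f g]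
  ring

/-- Test with (-Δ)^{2β} of the averaged velocity: averages paired with differences give exact
differences of squares, and the damping terms have a sign. The case β = 0 yields the energy law, β =
1/4 the higher regularity. -/
lemma StepEq.discEnergy_le {w u v u' v' : L2per} {R R' : ℝ} (hα : 0 ≤ α) (hγ₁ : 0 ≤ γ₁)
    (hγ₂ : 0 ≤ γ₂) (hτ : 0 < τ) (h : StepEq κ α γ₁ γ₂ F C₀ τ N w u v R u' v' R') {β : ℝ}
    (hβ : 0 ≤ β) :
    discEnergy κ α N β u' v' ≤ discEnergy κ α N β u v
      - 2 * τ * ((R' + R) / 2) * forceF F C₀ w (specOp N (2 * β) ((1 / 2 : ℝ) • (v' + v))) := by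
  have h1 := h.eq_v _ (specOp_mem_XN N (by positivity : 0 ≤ 2 * β) ((1 / 2 : ℝ) • (v' + v)))
  rw [inner_specOp_half_specOp hα hβ, inner_specOp_half_specOp hα hβ, inner_specOp_two_mul hβ,
    inner_specOp_two_mul hβ, real_inner_self_eq_norm_sq, real_inner_self_eq_norm_sq] at h1
  have h2 : inner ℝ (specOp N β (v' - v)) (specOp N β ((1 / 2 : ℝ) • (v' + v)))
      = (‖specOp N β v'‖ ^ 2 - ‖specOp N β v‖ ^ 2) / 2 := by
    rw [real_inner_comm, map_smul, map_add, map_sub, inner_half_add_sub]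
  have h3 : τ * inner ℝ (specOp N (β + α / 4) ((1 / 2 : ℝ) • (u' + u)))
        (specOp N (β + α / 4) ((1 / 2 : ℝ) • (v' + v)))
      = (‖specOp N (β + α / 4) u'‖ ^ 2 - ‖specOp N (β + α / 4) u‖ ^ 2) / 2 := by
    rw [← real_inner_smul_right, ← map_smul _ τ, ← h.eq_u, map_smul, map_add, map_sub,
      inner_half_add_sub]
  rw [h2] at h1
  unfold discEnergy
  have p1 : 0 ≤ τ * (γ₁ * ‖specOp N (β + α / 4) ((1 / 2 : ℝ) • (v' + v))‖ ^ 2) := by positivity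
  have p2 : 0 ≤ τ * (γ₂ * ‖specOp N β ((1 / 2 : ℝ) • (v' + v))‖ ^ 2) := by positivity
  linear_combination 2 * h1 - 2 * κ * h3 + 2 * p1 + 2 * p2

lemma sq_norm_sub_le_inner (f g : L2per) : (‖f‖ ^ 2 - ‖g‖ ^ 2) / 2 ≤ inner ℝ (f - g) f := by
  rw [inner_sub_left, real_inner_self_eq_norm_sq]
  have := real_inner_le_norm g f
  nlinarith [sq_nonneg (‖f‖ - ‖g‖)]

/-- As for the main step, but backward Euler only gives an inequality; the discarded squares of
differences are nonnegative. -/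
lemma StartEq.discEnergy_le {u v u' v' : L2per} {R R' : ℝ} (hα : 0 ≤ α) (hκ : 0 ≤ κ)
    (hγ₁ : 0 ≤ γ₁)
    (hγ₂ : 0 ≤ γ₂) (hτ : 0 < τ) (h : StartEq κ α γ₁ γ₂ F C₀ τ N u v R u' v' R') {β : ℝ}
    (hβ : 0 ≤ β) :
    discEnergy κ α N β u' v' ≤ discEnergy κ α N β u v
      - τ * R' * forceF F C₀ u (specOp N (2 * β) v') := by
  have h1 := h.eq_v _ (specOp_mem_XN N (by positivity : 0 ≤ 2 * β) v')
  rw [inner_specOp_half_specOp hα hβ, inner_specOp_half_specOp hα hβ, inner_specOp_two_mul hβ,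
    inner_specOp_two_mul hβ, real_inner_self_eq_norm_sq, real_inner_self_eq_norm_sq] at h1
  have h2 : (‖specOp N β v'‖ ^ 2 - ‖specOp N β v‖ ^ 2) / 2
      ≤ inner ℝ (specOp N β (v' - v)) (specOp N β v') := by
    rw [map_sub]; exact sq_norm_sub_le_inner _ _
  have h3 : (‖specOp N (β + α / 4) u'‖ ^ 2 - ‖specOp N (β + α / 4) u‖ ^ 2) / 2
      ≤ τ / 2 * inner ℝ (specOp N (β + α / 4) u') (specOp N (β + α / 4) v') := by
    rw [← real_inner_smul_right, ← map_smul _ (τ / 2), ← h.eq_u, map_sub, real_inner_comm]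
    exact sq_norm_sub_le_inner _ _
  unfold discEnergy
  have p1 : 0 ≤ τ * (γ₁ * ‖specOp N (β + α / 4) v'‖ ^ 2) := by positivity
  have p2 : 0 ≤ τ * (γ₂ * ‖specOp N β v'‖ ^ 2) := by positivity
  linear_combination 2 * h1 + 2 * h2 + 2 * κ * h3 + p1 + p2

/-- A discrete solution with its starting values, in terms of increments. -/
structure SchemeData (κ α γ₁ γ₂ : ℝ) (F : ℝ → ℝ) (C₀ T τ : ℝ) (K N : ℕ) (φ₀ φ₁ : L2per) (r₀ : ℝ)
    (uN vN : ℕ → L2per) (R : ℕ → ℝ) (uh vh : L2per) (Rh : ℝ) : Prop where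
  pos : 0 < τ
  mul_eq : K * τ = T
  init_u : uN 0 = specOp N 0 φ₀
  init_v : vN 0 = specOp N 0 φ₁
  init_R : R 0 = r₀
  start : StartEq κ α γ₁ γ₂ F C₀ τ N (uN 0) (vN 0) (R 0) uh vh Rh
  step : ∀ n < K, StepEq κ α γ₁ γ₂ F C₀ τ N (extrap uh uN n)
    (uN n) (vN n) (R n) (uN (n + 1)) (vN (n + 1)) (R (n + 1))

lemma IsSAVSolution.exists_schemeData {φ₀ φ₁ : L2per} {r₀ : ℝ} {uN vN : ℕ → L2per} {R : ℕ → ℝ}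
    (hT : 0 < T) (hK : 1 ≤ K) (hτ : τ = T / K)
    (h : IsSAVSolution κ α γ₁ γ₂ F C₀ τ K N φ₀ φ₁ r₀ uN vN R) :
    ∃ uh vh Rh, SchemeData κ α γ₁ γ₂ F C₀ T τ K N φ₀ φ₁ r₀ uN vN R uh vh Rh := by
  obtain ⟨uh, vh, Rh, hs, hm⟩ := h.steps
  have hK' : (0 : ℝ) < K := by exact_mod_cast hK
  have hτ0 : 0 < τ := by rw [hτ]; positivity
  refine ⟨uh, vh, Rh, hτ0, by rw [hτ]; field_simp, h.init_u.eq, h.init_v.eq, h.init_R,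
    hs.startEq hτ0 (h.mem_u 0 (Nat.zero_le _)) (h.mem_v 0 (Nat.zero_le _)), fun n hn => ?_⟩
  exact (hm n hn).stepEq hτ0 (h.mem_u n hn.le) (h.mem_v n hn.le) (h.mem_u _ hn) (h.mem_v _ hn)

namespace SchemeData

variable {φ₀ φ₁ : L2per} {r₀ : ℝ} {uN vN : ℕ → L2per} {R : ℕ → ℝ} {uh vh : L2per} {Rh : ℝ}

lemma mem_u (h : SchemeData κ α γ₁ γ₂ F C₀ T τ K N φ₀ φ₁ r₀ uN vN R uh vh Rh) {n : ℕ} (hn : n ≤ K) :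
    uN n ∈ XN N := by
  rcases n with _ | n
  · exact h.start.mem_u
  · exact (h.step n hn).mem_u'

lemma mem_v (h : SchemeData κ α γ₁ γ₂ F C₀ T τ K N φ₀ φ₁ r₀ uN vN R uh vh Rh) {n : ℕ} (hn : n ≤ K) :
    vN n ∈ XN N := by
  rcases n with _ | n
  · exact h.start.mem_v
  · exact (h.step n hn).mem_v'

/-- The discrete energy law of the scheme. -/
lemma energy_le (h : SchemeData κ α γ₁ γ₂ F C₀ T τ K N φ₀ φ₁ r₀ uN vN R uh vh Rh) (hα : 0 ≤ α)
    (hγ₁ : 0 ≤ γ₁) (hγ₂ : 0 ≤ γ₂) {n : ℕ} (hn : n ≤ K) :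
    discEnergy κ α N 0 (uN n) (vN n) + 2 * R n ^ 2
      ≤ discEnergy κ α N 0 (uN 0) (vN 0) + 2 * R 0 ^ 2 := by
  induction n with
  | zero => exact le_rfl
  | succ n ih =>
    refine le_trans ?_ (ih (by omega))
    have hs := h.step n hn
    have h1 := hs.discEnergy_le hα hγ₁ hγ₂ h.pos le_rfl
    rw [mul_zero, specOp_zero_of_mem (smul_mem_XN _ (add_mem_XN hs.mem_v' hs.mem_v))] at h1
    have h2 := hs.eq_R
    -- The equation for R times 2(R' + R) cancels the force term exactly: this is the purpose of the
    -- auxiliary variable.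
    linear_combination h1 + 2 * (R (n + 1) + R n) * h2

lemma start_energy_le (h : SchemeData κ α γ₁ γ₂ F C₀ T τ K N φ₀ φ₁ r₀ uN vN R uh vh Rh) (hα : 0 ≤ α)
    (hκ : 0 ≤ κ) (hγ₁ : 0 ≤ γ₁) (hγ₂ : 0 ≤ γ₂) :
    discEnergy κ α N 0 uh vh + 2 * Rh ^ 2
      ≤ discEnergy κ α N 0 (uN 0) (vN 0) + 2 * R 0 ^ 2 := by
  have h1 := h.start.discEnergy_le hα hκ hγ₁ hγ₂ h.pos le_rfl
  rw [mul_zero, specOp_zero_of_mem h.start.mem_v'] at h1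
  have h2 := h.start.eq_R
  linear_combination h1 + 4 * Rh * h2 + 2 * sq_nonneg (Rh - R 0)

end SchemeData

/-- The unconditional bounds provided by the discrete energy law. -/
structure StableData (α τ : ℝ) (K N : ℕ) (Cs : ℝ) (uN vN : ℕ → L2per) (R : ℕ → ℝ) (uh : L2per)
    (Rh : ℝ) : Prop where
  norm_u : ∀ n ≤ K, ‖uN n‖ ≤ Cs
  norm_v : ∀ n ≤ K, ‖vN n‖ ≤ Cs
  semi_u : ∀ n ≤ K, ‖specOp N (α / 4) (uN n)‖ ≤ Cs
  bound_R : ∀ n ≤ K, |R n| ≤ Cs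
  bound_Rh : |Rh| ≤ Cs
  semi_w : ∀ n < K, SemiBound (α / 4) Cs (extrap uh uN n)
  start : ‖uh - uN 0‖ ≤ Cs * τ

lemma exists_stableData (hκ : 0 < κ) (hα : 0 ≤ α) (hγ₁ : 0 ≤ γ₁) (hγ₂ : 0 ≤ γ₂) (hT : 0 < T)
    (hB : 0 ≤ B) (hX : ExactData κ α γ₁ γ₂ F C₀ T m B M u ut utt uttt r rt rtt rttt) :
    ∃ Cs, 0 ≤ Cs ∧ ∀ (K N : ℕ) (τ : ℝ) (uN vN : ℕ → L2per) (R : ℕ → ℝ) (uh vh : L2per) (Rh : ℝ),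
      SchemeData κ α γ₁ γ₂ F C₀ T τ K N (u 0) (ut 0) (r 0) uN vN R uh vh Rh →
      StableData α τ K N Cs uN vN R uh Rh := by
  have h0 : (0 : ℝ) ∈ Icc 0 T := ⟨le_rfl, hT.le⟩
  -- Bounds the initial discrete energy through the exact data, uniformly in N.
  set E₀ := B ^ 2 + κ * B ^ 2 + 2 * B ^ 2 with hE₀
  have hE₀0 : 0 ≤ E₀ := by positivity
  set c := √E₀ + √(E₀ / κ) with hc
  have hc0 : 0 ≤ c := by positivity
  refine ⟨B + T * c + 2 * c, by positivity, fun K N τ uN vN R uh vh Rh h => ?_⟩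
  have hτ := h.pos
  have hTc : 0 ≤ T * c := by positivity
  have hinit : discEnergy κ α N 0 (uN 0) (vN 0) + 2 * R 0 ^ 2 ≤ E₀ := by
    have e1 : ‖specOp N 0 (vN 0)‖ ≤ B := by
      rw [h.init_v, specOp_specOp le_rfl le_rfl, zero_add]
      exact (norm_specOp_zero_le N _).trans (hX.norm_ut 0 h0)
    have e2 : ‖specOp N (0 + α / 4) (uN 0)‖ ≤ B := by
      rw [h.init_u, zero_add, specOp_specOp (by positivity) le_rfl, add_zero]
      exact hX.semi_u 0 h0 _ (by positivity) (by linarith) N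
    have e3 : R 0 ^ 2 ≤ B ^ 2 := by
      rw [h.init_R, ← sq_abs]; exact pow_le_pow_left₀ (abs_nonneg _) (hX.bound_r 0 h0) 2
    rw [hE₀, discEnergy]
    gcongr
  have bounds : ∀ {f g : L2per} {q : ℝ}, f ∈ XN N → g ∈ XN N →
      discEnergy κ α N 0 f g + 2 * q ^ 2 ≤ E₀ →
      ‖specOp N (α / 4) f‖ ≤ c ∧ ‖g‖ ≤ c ∧ |q| ≤ c := by
    intro f g q hf hg hfg
    unfold discEnergy at hfg
    rw [specOp_zero_of_mem hg, zero_add] at hfg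
    have s1 := Real.sqrt_nonneg E₀
    have s2 := Real.sqrt_nonneg (E₀ / κ)
    have t1 : 0 ≤ κ * ‖specOp N (α / 4) f‖ ^ 2 := by positivity
    refine ⟨?_, ?_, ?_⟩
    · have : ‖specOp N (α / 4) f‖ ≤ √(E₀ / κ) := by
        apply Real.le_sqrt_of_sq_le
        rw [le_div_iff₀' hκ]
        nlinarith [sq_nonneg ‖g‖, sq_nonneg q]
      linarith
    · have : ‖g‖ ≤ √E₀ := Real.le_sqrt_of_sq_le (by nlinarith [sq_nonneg q])
      linarith
    · have : |q| ≤ √E₀ := Real.abs_le_sqrt (by nlinarith [sq_nonneg ‖g‖, sq_nonneg q])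
      linarith
  have bn : ∀ n ≤ K, ‖specOp N (α / 4) (uN n)‖ ≤ c ∧ ‖vN n‖ ≤ c ∧ |R n| ≤ c := fun n hn =>
    bounds (h.mem_u hn) (h.mem_v hn) ((h.energy_le hα hγ₁ hγ₂ hn).trans hinit)
  have bh : ‖specOp N (α / 4) uh‖ ≤ c ∧ ‖vh‖ ≤ c ∧ |Rh| ≤ c :=
    bounds h.start.mem_u' h.start.mem_v' ((h.start_energy_le hα hκ.le hγ₁ hγ₂).trans hinit)
  -- The energy contains only a semi-norm of u, so the L² norm is obtained by summing the increments
  -- τ · (averaged velocity).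
  have hu : ∀ n ≤ K, ‖uN n‖ ≤ B + n * τ * c := by
    intro n
    induction n with
    | zero =>
      intro _
      rw [h.init_u]
      simpa using (norm_specOp_zero_le N _).trans (hX.norm_u 0 h0)
    | succ n ih =>
      intro hn
      have e1 := ih (by omega)
      have e2 := (h.step n hn).eq_u
      have e3 : ‖uN (n + 1) - uN n‖ ≤ τ * c := by
        rw [e2, norm_smul, norm_smul, Real.norm_of_nonneg hτ.le, Real.norm_of_nonneg (by norm_num)]
        have := norm_add_le (vN (n + 1)) (vN n)
        have := (bn n (by omega)).2.1
        have := (bn (n + 1) hn).2.1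
        gcongr
        linarith
      have e4 := norm_le_norm_add_norm_sub' (uN (n + 1)) (uN n)
      push_cast
      linarith
  have hcC : c ≤ B + T * c + 2 * c := by linarith
  refine ⟨fun n hn => ?_, fun n hn => (bn n hn).2.1.trans hcC, fun n hn => (bn n hn).1.trans hcC,
    fun n hn => (bn n hn).2.2.trans hcC, bh.2.2.trans hcC, fun n hn => ?_, ?_⟩
  · have hn' : (n : ℝ) ≤ K := by exact_mod_cast hn
    have : n * τ ≤ T := by rw [← h.mul_eq]; gcongr
    have : n * τ * c ≤ T * c := by gcongr
    linarith [hu n hn]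
  · rcases n with _ | n
    · exact SemiBound.of_mem_XN h.start.mem_u' (bh.1.trans hcC)
    -- The extrapolation weights have absolute sum 3/2 + 1/2 = 2, whence the term 2c in the
    -- constant.
    · refine SemiBound.of_mem_XN (N := N) (smul_mem_XN _ (sub_mem_XN
        (smul_mem_XN _ (h.mem_u hn.le)) (h.mem_u (by omega)))) ?_
      rw [extrap, map_smul, map_sub, map_smul, norm_smul, Real.norm_of_nonneg (by norm_num)]
      have e1 := _root_.norm_sub_le ((3 : ℝ) • specOp N (α / 4) (uN (n + 1)))
        (specOp N (α / 4) (uN n))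
      rw [norm_smul, Real.norm_of_nonneg (by norm_num)] at e1
      have e2 := (bn (n + 1) hn.le).1
      have e3 := (bn n (by omega)).1
      linarith
  · rw [h.start.eq_u, norm_smul, Real.norm_of_nonneg (by positivity)]
    have := bh.2.1
    have h2 : 0 ≤ τ * c := by positivity
    have h3 : τ / 2 * ‖vh‖ ≤ τ / 2 * c := by gcongr
    nlinarith [mul_nonneg hτ.le hB, mul_nonneg hτ.le hTc]

end

end SAVWave

/-! ### Higher regularity of the discrete solution. -/

namespace SAVWave

noncomputable section

variable {κ α γ₁ γ₂ T C₀ m B M τ Cs : ℝ} {F : ℝ → ℝ} {u ut utt uttt : ℝ → L2per}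
  {r rt rtt rttt : ℝ → ℝ} {K N : ℕ}

lemma exists_forceF_half_bound (hF : ContDiff ℝ 3 F)
    (hE : ∀ w : L2per, (∃ M : ℝ, ∀ᵐ x : Torus, |w x| ≤ M) → 0 < energyE F C₀ w)
    (hα₁ : 1 < α) (hα₂ : α ≤ 2) (hM : 0 ≤ M) (hCs : 0 ≤ Cs) :
    ∃ C, 0 ≤ C ∧ ∀ w : L2per, AEBound M w → SemiBound (α / 4) Cs w →
      ∀ (N : ℕ) (φ : L2per), |forceF F C₀ w (specOp N (1 / 2) φ)| ≤ C * ‖specOp N (1 / 4) φ‖ := by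
  obtain ⟨C, hC0, hC⟩ := exists_pairF'_half_bound hF hα₁ hα₂ M
  obtain ⟨e, he, hEe⟩ := exists_energyE_pos hF.continuous hE hM
  refine ⟨C * Cs / √e, by positivity, fun w hw hs N φ => ?_⟩
  rw [forceF, abs_div, abs_of_nonneg (Real.sqrt_nonneg _), div_mul_eq_mul_div]
  exact div_le_div₀ (by positivity) (hC w Cs hw hs N φ) (Real.sqrt_pos.2 he)
    (Real.sqrt_le_sqrt (hEe w hw))

/-- Divides x² - y² ≤ d(x + y) by x + y. The square root of the energy thus grows additively over a
step. -/
lemma le_add_of_sq_le {x y d : ℝ} (hy : 0 ≤ y) (hd : 0 ≤ d)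
    (h : x ^ 2 ≤ y ^ 2 + d * (x + y)) : x ≤ y + d := by
  by_contra! hlt
  nlinarith

lemma norm_le_sqrt_discEnergy (hκ : 0 ≤ κ) (β : ℝ) (f g : L2per) :
    ‖specOp N β g‖ ≤ √(discEnergy κ α N β f g) := by
  apply Real.le_sqrt_of_sq_le
  unfold discEnergy
  have : 0 ≤ κ * ‖specOp N (β + α / 4) f‖ ^ 2 := by positivity
  linarith

lemma norm_le_sqrt_discEnergy_div (hκ : 0 < κ) (β : ℝ) (f g : L2per) :
    ‖specOp N (β + α / 4) f‖ ≤ √(discEnergy κ α N β f g) / √κ := by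
  rw [← Real.sqrt_div (discEnergy_nonneg hκ.le _ _ _)]
  apply Real.le_sqrt_of_sq_le
  rw [le_div_iff₀' hκ, discEnergy]
  nlinarith [sq_nonneg ‖specOp N β g‖]

/-- The initial data are regular enough because (1 + α)/4 ≤ α/2 and 1/4 ≤ α/2 for α > 1. -/
lemma SchemeData.sqrt_discEnergy_init_le (hκ : 0 < κ) (hα₁ : 1 < α) (hT : 0 < T) (hB : 0 ≤ B)
    (hX : ExactData κ α γ₁ γ₂ F C₀ T m B M u ut utt uttt r rt rtt rttt)
    {uN vN : ℕ → L2per} {R : ℕ → ℝ} {uh vh : L2per} {Rh : ℝ}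
    (h : SchemeData κ α γ₁ γ₂ F C₀ T τ K N (u 0) (ut 0) (r 0) uN vN R uh vh Rh) :
    √(discEnergy κ α N (1 / 4) (uN 0) (vN 0)) ≤ (1 + κ) * B := by
  have h0 : (0 : ℝ) ∈ Icc 0 T := ⟨le_rfl, hT.le⟩
  rw [Real.sqrt_le_left (by positivity), discEnergy, h.init_u, h.init_v,
    specOp_specOp (by norm_num) le_rfl, specOp_specOp (by positivity) le_rfl, add_zero, add_zero]
  have e1 := hX.semi_ut 0 h0 (1 / 4) (by norm_num) (by linarith) N
  have e2 := hX.semi_u 0 h0 (1 / 4 + α / 4) (by linarith) (by linarith) N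
  calc _ ≤ B ^ 2 + κ * B ^ 2 := by gcongr
    _ ≤ ((1 + κ) * B) ^ 2 := by nlinarith [mul_nonneg hκ.le (sq_nonneg B), sq_nonneg (κ * B)]

/-- The arguments of the nonlinear terms of the starting phase are bounded uniformly. -/
lemma exists_start_sup (hκ : 0 < κ) (hα₁ : 1 < α) (hα₂ : α ≤ 2) (hγ₁ : 0 ≤ γ₁) (hγ₂ : 0 ≤ γ₂)
    (hT : 0 < T) (hF : ContDiff ℝ 3 F)
    (hE : ∀ w : L2per, (∃ M : ℝ, ∀ᵐ x : Torus, |w x| ≤ M) → 0 < energyE F C₀ w)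
    (hB : 0 ≤ B) (hCs : 0 ≤ Cs)
    (hX : ExactData κ α γ₁ γ₂ F C₀ T m B M u ut utt uttt r rt rtt rttt) :
    ∃ M₀, 0 ≤ M₀ ∧ ∀ (K N : ℕ) (τ : ℝ) (uN vN : ℕ → L2per) (R : ℕ → ℝ) (uh vh : L2per) (Rh : ℝ),
      1 ≤ K → SchemeData κ α γ₁ γ₂ F C₀ T τ K N (u 0) (ut 0) (r 0) uN vN R uh vh Rh →
      StableData α τ K N Cs uN vN R uh Rh → AEBound M₀ uh := by
  have h0 : (0 : ℝ) ∈ Icc 0 T := ⟨le_rfl, hT.le⟩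
  -- Here σ = (1 + α)/2 > 1 is the order controlled by the energy with β = 1/4.
  obtain ⟨C, hC0, hC⟩ := exists_sup_bound (σ := 2 * (1 / 4 + α / 4)) (by linarith) one_pos
  obtain ⟨C', hC'0, hC'⟩ := exists_forceF_half_bound (M := C * B + 1 * B) hF hE hα₁ hα₂
    (by positivity) hCs
  set D := C' * Cs * T with hD
  have hD0 : 0 ≤ D := by positivity
  refine ⟨C * (Cs + Cs * T) + 1 * (((1 + κ) * B + D) / √κ), by positivity,
    fun K N τ uN vN R uh vh Rh hK h hs => ?_⟩
  have hτ := h.pos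
  have hτT : τ ≤ T := by
    rw [← h.mul_eq]
    have : (1 : ℝ) ≤ K := by exact_mod_cast hK
    nlinarith
  have hu0 : AEBound (C * B + 1 * B) (uN 0) := by
    have e1 : SemiBound (2 * (1 / 4 + α / 4) / 2) B (uN 0) := by
      refine SemiBound.of_mem_XN (N := N) (h.mem_u (Nat.zero_le _)) ?_
      rw [h.init_u, specOp_specOp (by linarith) le_rfl, add_zero]
      exact hX.semi_u 0 h0 _ (by linarith) (by linarith) N
    have e2 : ‖uN 0‖ ≤ B := by
      rw [h.init_u]; exact (norm_specOp_zero_le N _).trans (hX.norm_u 0 h0)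
    filter_upwards [hC _ _ e1] with x hx
    refine hx.trans ?_
    gcongr
  have hs0 : SemiBound (α / 4) Cs (uN 0) :=
    SemiBound.of_mem_XN (N := N) (h.mem_u (Nat.zero_le _)) (hs.semi_u 0 (Nat.zero_le _))
  have e1 := h.start.discEnergy_le (by linarith) hκ.le hγ₁ hγ₂ hτ (β := 1 / 4) (by norm_num)
  rw [show 2 * (1 / 4 : ℝ) = 1 / 2 by norm_num] at e1
  have e2 := hC' _ hu0 hs0 N vh
  have e3 := norm_le_sqrt_discEnergy (N := N) (α := α) hκ.le (1 / 4) uh vh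
  have e4 := h.sqrt_discEnergy_init_le hκ hα₁ hT hB hX
  set x := √(discEnergy κ α N (1 / 4) uh vh) with hx
  set y := √(discEnergy κ α N (1 / 4) (uN 0) (vN 0)) with hy
  have hx0 : 0 ≤ x := Real.sqrt_nonneg _
  have hy0 : 0 ≤ y := Real.sqrt_nonneg _
  have hxx : x ^ 2 = discEnergy κ α N (1 / 4) uh vh :=
    Real.sq_sqrt (discEnergy_nonneg hκ.le _ _ _)
  have hyy : y ^ 2 = discEnergy κ α N (1 / 4) (uN 0) (vN 0) :=
    Real.sq_sqrt (discEnergy_nonneg hκ.le _ _ _)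
  rw [← hxx, ← hyy] at e1
  have e5 : |τ * Rh * forceF F C₀ (uN 0) (specOp N (1 / 2) vh)| ≤ D * x := by
    rw [abs_mul, abs_mul, abs_of_pos hτ]
    calc τ * |Rh| * |forceF F C₀ (uN 0) (specOp N (1 / 2) vh)| ≤ T * Cs * (C' * x) := by
          gcongr
          · exact hs.bound_Rh
          · exact e2.trans (by gcongr)
      _ = D * x := by rw [hD]; ring
  -- The force of the starting step acts at P_N u_0, whose bound is known, so its output is
  -- controlled without any a priori bound on it.
  have e6 : x ≤ y + D := by
    refine le_add_of_sq_le hy0 hD0 ?_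
    have := neg_le_of_abs_le e5
    nlinarith [mul_nonneg hD0 hy0]
  have e7 := norm_le_sqrt_discEnergy_div (N := N) (α := α) hκ (1 / 4) uh vh
  rw [← hx] at e7
  have e8 : SemiBound (2 * (1 / 4 + α / 4) / 2) (((1 + κ) * B + D) / √κ) uh := by
    refine SemiBound.of_mem_XN (N := N) h.start.mem_u' ?_
    rw [show 2 * (1 / 4 + α / 4) / 2 = 1 / 4 + α / 4 by ring]
    refine e7.trans ?_
    gcongr
    linarith
  have e9 : ‖uh‖ ≤ Cs + Cs * T := by
    have a1 := norm_le_norm_add_norm_sub' uh (uN 0)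
    have a2 := hs.norm_u 0 (Nat.zero_le _)
    have a3 := hs.start
    have a4 : Cs * τ ≤ Cs * T := by gcongr
    linarith
  filter_upwards [hC _ _ e8] with x hx
  refine hx.trans ?_
  gcongr

/-- Regularity of the discrete solution, as long as the arguments of the nonlinear terms are
bounded. -/
lemma exists_high_regularity (hκ : 0 < κ) (hα₁ : 1 < α) (hα₂ : α ≤ 2) (hγ₁ : 0 ≤ γ₁)
    (hγ₂ : 0 ≤ γ₂) (hT : 0 < T) (hF : ContDiff ℝ 3 F)
    (hE : ∀ w : L2per, (∃ M : ℝ, ∀ᵐ x : Torus, |w x| ≤ M) → 0 < energyE F C₀ w)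
    (hB : 0 ≤ B) (hCs : 0 ≤ Cs)
    (hX : ExactData κ α γ₁ γ₂ F C₀ T m B M u ut utt uttt r rt rtt rttt) {M' : ℝ} (hM' : 0 ≤ M') :
    ∃ H, 0 ≤ H ∧ ∀ (K N : ℕ) (τ : ℝ) (uN vN : ℕ → L2per) (R : ℕ → ℝ) (uh vh : L2per) (Rh : ℝ),
      SchemeData κ α γ₁ γ₂ F C₀ T τ K N (u 0) (ut 0) (r 0) uN vN R uh vh Rh →
      StableData α τ K N Cs uN vN R uh Rh → ∀ n ≤ K, (∀ i < n, AEBound M' (extrap uh uN i)) →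
      ‖specOp N (1 / 4 + α / 4) (uN n)‖ ≤ H := by
  obtain ⟨C', hC'0, hC'⟩ := exists_forceF_half_bound (M := M') hF hE hα₁ hα₂ hM' hCs
  -- Initial value plus at most K increments τ Cs C', where Kτ = T; the division by √κ passes from
  -- the energy to the norm of u.
  refine ⟨((1 + κ) * B + T * (Cs * C')) / √κ, by positivity,
    fun K N τ uN vN R uh vh Rh h hs n hn hw => ?_⟩
  have hτ := h.pos
  have key : ∀ j ≤ n, √(discEnergy κ α N (1 / 4) (uN j) (vN j))
      ≤ (1 + κ) * B + j * τ * (Cs * C') := by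
    intro j
    induction j with
    | zero =>
      intro _
      simpa using h.sqrt_discEnergy_init_le hκ hα₁ hT hB hX
    | succ j ih =>
      intro hj
      have e0 := ih (by omega)
      have hjK : j < K := by omega
      have e1 := (h.step j hjK).discEnergy_le (by linarith) hγ₁ hγ₂ hτ (β := 1 / 4) (by norm_num)
      rw [show 2 * (1 / 4 : ℝ) = 1 / 2 by norm_num] at e1
      have e2 := hC' _ (hw j (by omega)) (hs.semi_w j hjK) N ((1 / 2 : ℝ) • (vN (j + 1) + vN j))
      have e3 := norm_le_sqrt_discEnergy (N := N) (α := α) hκ.le (1 / 4) (uN j) (vN j)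
      have e4 := norm_le_sqrt_discEnergy (N := N) (α := α) hκ.le (1 / 4) (uN (j + 1)) (vN (j + 1))
      have hxx := Real.sq_sqrt (discEnergy_nonneg (N := N) (α := α) hκ.le (1 / 4) (uN (j + 1))
        (vN (j + 1)))
      have hyy := Real.sq_sqrt (discEnergy_nonneg (N := N) (α := α) hκ.le (1 / 4) (uN j) (vN j))
      rw [← hxx, ← hyy] at e1
      set x := √(discEnergy κ α N (1 / 4) (uN (j + 1)) (vN (j + 1)))
      set y := √(discEnergy κ α N (1 / 4) (uN j) (vN j))
      have hx0 : 0 ≤ x := Real.sqrt_nonneg _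
      have hy0 : 0 ≤ y := Real.sqrt_nonneg _
      have e5 : ‖specOp N (1 / 4) ((1 / 2 : ℝ) • (vN (j + 1) + vN j))‖ ≤ 1 / 2 * (x + y) := by
        rw [map_smul, map_add, norm_smul, Real.norm_of_nonneg (by norm_num)]
        have := norm_add_le (specOp N (1 / 4) (vN (j + 1))) (specOp N (1 / 4) (vN j))
        gcongr
        linarith
      have e6 : |(R (j + 1) + R j) / 2| ≤ Cs := by
        have a1 := abs_le.1 (hs.bound_R (j + 1) hjK)
        have a2 := abs_le.1 (hs.bound_R j hjK.le)
        rw [abs_le]; constructor <;> linarith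
      have e7 : |2 * τ * ((R (j + 1) + R j) / 2) * forceF F C₀ (extrap uh uN j)
          (specOp N (1 / 2) ((1 / 2 : ℝ) • (vN (j + 1) + vN j)))| ≤ τ * (Cs * C') * (x + y) := by
        rw [abs_mul, abs_mul, abs_of_pos (by positivity : 0 < 2 * τ)]
        calc _ ≤ 2 * τ * Cs * (C' * (1 / 2 * (x + y))) := by
              gcongr
              exact e2.trans (by gcongr)
          _ = _ := by ring
      have e8 : x ≤ y + τ * (Cs * C') := by
        refine le_add_of_sq_le hy0 (by positivity) ?_
        have := neg_le_of_abs_le e7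
        linarith
      push_cast
      linarith
  have e1 := norm_le_sqrt_discEnergy_div (N := N) (α := α) hκ (1 / 4) (uN n) (vN n)
  refine e1.trans ?_
  gcongr
  refine (key n le_rfl).trans ?_
  have hn' : (n : ℝ) ≤ K := by exact_mod_cast hn
  have : n * τ ≤ T := by rw [← h.mul_eq]; gcongr
  gcongr

end

end SAVWave

/-! ### The exact equation integrated over a step, and the midpoint rule for F'(u). -/

namespace SAVWave

noncomputable section

variable {κ α γ₁ γ₂ T C₀ m B M τ Cs a : ℝ} {F : ℝ → ℝ} {u ut utt uttt : ℝ → L2per}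
  {r rt rtt rttt : ℝ → ℝ} {N : ℕ}

namespace ExactData

lemma continuousOn_pairF' (hT : 0 ≤ T) (hF : ContDiff ℝ 3 F)
    (hE : ∀ w : L2per, (∃ M : ℝ, ∀ᵐ x : Torus, |w x| ≤ M) → 0 < energyE F C₀ w) (hM : 0 ≤ M)
    (hX : ExactData κ α γ₁ γ₂ F C₀ T m B M u ut utt uttt r rt rtt rttt) (φ : L2per) :
    ContinuousOn (fun t => pairF' F (u t) φ) (Icc 0 T) := by
  obtain ⟨C, hC0, -, -, hC, -⟩ := exists_force_bounds hF hE hM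
  have hu := hX.du.continuousOn hT
  intro t ht
  have h1 : Tendsto (fun s => C * (‖u s - u t‖ * ‖φ‖)) (nhdsWithin t (Icc 0 T)) (nhds 0) := by
    have h2 : Tendsto (fun s => ‖u s - u t‖) (nhdsWithin t (Icc 0 T)) (nhds 0) :=
      tendsto_iff_norm_sub_tendsto_zero.1 (hu t ht)
    simpa using (h2.mul_const ‖φ‖).const_mul C
  refine tendsto_iff_norm_sub_tendsto_zero.2 ?_
  refine squeeze_zero' (Eventually.of_forall fun _ => norm_nonneg _) ?_ h1
  filter_upwards [self_mem_nhdsWithin] with s hs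
  exact hC _ _ (hX.sup s hs) (hX.sup t ht) φ

/-- The weak form of the equation, integrated over a time step. -/
lemma integrated_weak (hF : ContDiff ℝ 3 F)
    (hE : ∀ w : L2per, (∃ M : ℝ, ∀ᵐ x : Torus, |w x| ≤ M) → 0 < energyE F C₀ w) (hM : 0 ≤ M)
    (hX : ExactData κ α γ₁ γ₂ F C₀ T m B M u ut utt uttt r rt rtt rttt)
    (ha : a ∈ Icc 0 T) (hτ : 0 < τ) (hb : a + τ ∈ Icc 0 T) {φ : L2per} (hφ : φ ∈ XN N) :
    inner ℝ (ut (a + τ) - ut a) φ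
      + κ * inner ℝ (∫ s in a..a + τ, u s) (specOp N (α / 2) φ)
      + γ₁ * inner ℝ (∫ s in a..a + τ, ut s) (specOp N (α / 2) φ)
      + γ₂ * inner ℝ (∫ s in a..a + τ, ut s) φ + ∫ s in a..a + τ, pairF' F (u s) φ = 0 := by
  have hT : 0 ≤ T := ha.1.trans ha.2
  have comm : ∀ {f : ℝ → L2per} (g : L2per), IntervalIntegrable f volume a (a + τ) →
      inner ℝ (∫ s in a..a + τ, f s) g = ∫ s in a..a + τ, inner ℝ (f s) g ∧
      IntervalIntegrable (fun s => inner ℝ (f s) g) volume a (a + τ) := by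
    intro f g hf
    have h1 := (innerSL ℝ g).intervalIntegral_comp_comm hf
    simp only [innerSL_apply_apply] at h1
    have h2 : IntervalIntegrable (fun s => inner ℝ g (f s)) volume a (a + τ) :=
      ⟨(innerSL ℝ g).integrable_comp hf.1, (innerSL ℝ g).integrable_comp hf.2⟩
    simp only [real_inner_comm g]
    exact ⟨h1.symm, h2⟩
  have i0 := comm φ (hX.dut.intervalIntegrable ha hb)
  have i1 := comm (specOp N (α / 2) φ) (hX.du.intervalIntegrable_self ha hb)
  have i2 := comm (specOp N (α / 2) φ) (hX.dut.intervalIntegrable_self ha hb)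
  have i3 := comm φ (hX.dut.intervalIntegrable_self ha hb)
  have i4 : IntervalIntegrable (fun s => pairF' F (u s) φ) volume a (a + τ) :=
    ((hX.continuousOn_pairF' hT hF hE hM φ).mono (uIcc_subset_Icc_zero ha hb)).intervalIntegrable
  rw [hX.dut.sub_eq ha hb, i0.1, i1.1, i2.1, i3.1, ← intervalIntegral.integral_const_mul,
    ← intervalIntegral.integral_const_mul, ← intervalIntegral.integral_const_mul,
    ← intervalIntegral.integral_add i0.2 (i1.2.const_mul κ),
    ← intervalIntegral.integral_add (i0.2.add (i1.2.const_mul κ)) (i2.2.const_mul γ₁),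
    ← intervalIntegral.integral_add ((i0.2.add (i1.2.const_mul κ)).add (i2.2.const_mul γ₁))
      (i3.2.const_mul γ₂),
    ← intervalIntegral.integral_add (((i0.2.add (i1.2.const_mul κ)).add (i2.2.const_mul γ₁)).add
      (i3.2.const_mul γ₂)) i4]
  apply intervalIntegral.integral_zero_ae
  refine ae_of_all _ fun s hs => ?_
  -- The interval excludes its left endpoint, so s > 0 even if a = 0, where the equation is not
  -- assumed.
  rw [uIoc_of_le (by linarith)] at hs
  exact hX.weak N s ⟨lt_of_le_of_lt ha.1 hs.1, hs.2.trans hb.2⟩ φ hφ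

/-- The midpoint rule for the nonlinear term. -/
lemma exists_pairF'_midpoint (hF : ContDiff ℝ 3 F)
    (hE : ∀ w : L2per, (∃ M : ℝ, ∀ᵐ x : Torus, |w x| ≤ M) → 0 < energyE F C₀ w) (hM : 0 ≤ M)
    (hB : 0 ≤ B) (hX : ExactData κ α γ₁ γ₂ F C₀ T m B M u ut utt uttt r rt rtt rttt) :
    ∃ C, 0 ≤ C ∧ ∀ a τ : ℝ, a ∈ Icc 0 T → 0 < τ → a + τ ∈ Icc 0 T → ∀ φ : L2per,
      |(∫ s in a..a + τ, pairF' F (u s) φ) - τ * pairF' F (u (a + τ / 2)) φ| ≤ C * τ ^ 3 * ‖φ‖ := by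
  obtain ⟨C, hC0, hC⟩ := exists_pairF'_taylor hF M
  refine ⟨C * B ^ 2 + C * B, by positivity, fun a τ ha hτ hb φ => ?_⟩
  have hT : 0 ≤ T := ha.1.trans ha.2
  have hm := mid_mem ha hτ hb
  obtain ⟨G, hG, hG'⟩ := hC _ (hX.sup _ hm) φ
  have hsub : ∀ s ∈ uIoc a (a + τ), s ∈ Icc 0 T ∧ |s - (a + τ / 2)| ≤ τ := by
    intro s hs
    rw [uIoc_of_le (by linarith)] at hs
    refine ⟨⟨by linarith [ha.1, hs.1], hs.2.trans hb.2⟩, ?_⟩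
    rw [abs_le]; constructor <;> linarith [hs.1, hs.2]
  have iu := hX.du.intervalIntegrable_self ha hb
  have i1 : IntervalIntegrable (fun s => pairF' F (u s) φ) volume a (a + τ) :=
    ((hX.continuousOn_pairF' hT hF hE hM φ).mono (uIcc_subset_Icc_zero ha hb)).intervalIntegrable
  have iu2 : IntervalIntegrable (fun s => u s - u (a + τ / 2)) volume a (a + τ) :=
    iu.sub intervalIntegrable_const
  have i2 : IntervalIntegrable (fun s => inner ℝ G (u s - u (a + τ / 2))) volume a (a + τ) :=
    ⟨(innerSL ℝ G).integrable_comp iu2.1, (innerSL ℝ G).integrable_comp iu2.2⟩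
  have e2 : ∫ s in a..a + τ, inner ℝ G (u s - u (a + τ / 2))
      = inner ℝ G ((∫ s in a..a + τ, u s) - τ • u (a + τ / 2)) := by
    have := (innerSL ℝ G).intervalIntegral_comp_comm iu2
    simp only [innerSL_apply_apply] at this
    rw [this, intervalIntegral.integral_sub iu intervalIntegrable_const,
      intervalIntegral.integral_const, add_sub_cancel_left]
  -- The linearization at the midpoint is split off: its integral is the midpoint error of u paired
  -- with G, while the remainder is quadratic in s - (a + τ/2).
  have e1 : (∫ s in a..a + τ, pairF' F (u s) φ) - τ * pairF' F (u (a + τ / 2)) φ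
      = (∫ s in a..a + τ, (pairF' F (u s) φ - pairF' F (u (a + τ / 2)) φ
          - inner ℝ G (u s - u (a + τ / 2))))
        + inner ℝ G ((∫ s in a..a + τ, u s) - τ • u (a + τ / 2)) := by
    rw [intervalIntegral.integral_sub (i1.sub intervalIntegrable_const) i2,
      intervalIntegral.integral_sub i1 intervalIntegrable_const, intervalIntegral.integral_const,
      add_sub_cancel_left, e2, smul_eq_mul]
    ring
  have b1 : ‖∫ s in a..a + τ, (pairF' F (u s) φ - pairF' F (u (a + τ / 2)) φ
          - inner ℝ G (u s - u (a + τ / 2)))‖ ≤ (C * B ^ 2 * τ ^ 2 * ‖φ‖) * |a + τ - a| := by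
    apply intervalIntegral.norm_integral_le_of_norm_le_const
    intro s hs
    obtain ⟨hs1, hs2⟩ := hsub s hs
    have c1 := hG' _ (B * |s - (a + τ / 2)|) (hX.sup s hs1) (hX.sup_sub _ hm _ hs1)
    have c2 := hX.du.norm_sub_le (timeBound_of_forall hX.norm_ut) hm hs1
    refine c1.trans ?_
    calc C * (B * |s - (a + τ / 2)|) * (‖u s - u (a + τ / 2)‖ * ‖φ‖)
        ≤ C * (B * τ) * ((B * τ) * ‖φ‖) := by
          gcongr
          exact c2.trans (by gcongr)
      _ = _ := by ring
  rw [Real.norm_eq_abs, add_sub_cancel_left, abs_of_pos hτ] at b1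
  have b2 : |inner ℝ G ((∫ s in a..a + τ, u s) - τ • u (a + τ / 2))| ≤ C * ‖φ‖ * (B * τ ^ 3) := by
    refine (abs_real_inner_le_norm _ _).trans ?_
    gcongr
    exact hX.du.norm_midpoint_le hX.dut (timeBound_of_forall hX.norm_utt) ha hτ hb
  rw [e1]
  refine (abs_add_le _ _).trans ?_
  linarith

end ExactData

lemma forceF_sub {w : L2per} (hF : ContDiff ℝ 3 F) (hw : AEBound M w) (φ ψ : L2per) :
    forceF F C₀ w (φ - ψ) = forceF F C₀ w φ - forceF F C₀ w ψ := by
  have hF' : Continuous (deriv F) := (contDiff_deriv (n := 2) (by exact_mod_cast hF)).continuous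
  obtain ⟨f, hf⟩ := exists_comp hF' hw
  rw [forceF, forceF, forceF, pairF'_eq_inner hf, pairF'_eq_inner hf, pairF'_eq_inner hf,
    inner_sub_right, sub_div]

end

end SAVWave

/-! ### Consistency and the error growth over one step. -/

namespace SAVWave

noncomputable section

variable {κ α γ₁ γ₂ T C₀ m B M τ a : ℝ} {F : ℝ → ℝ} {u ut utt uttt : ℝ → L2per}
  {r rt rtt rttt : ℝ → ℝ} {N : ℕ}

/-- The energy of the error with components `f`, `g`, `q`. -/
def errEnergy (κ α : ℝ) (N : ℕ) (f g : L2per) (q : ℝ) : ℝ :=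
  ‖g‖ ^ 2 + κ * ‖specOp N (α / 4) f‖ ^ 2 + ‖f‖ ^ 2 + q ^ 2

lemma errEnergy_nonneg (hκ : 0 ≤ κ) (f g : L2per) (q : ℝ) : 0 ≤ errEnergy κ α N f g q := by
  unfold errEnergy; positivity

lemma le_sqrt_errEnergy (hκ : 0 ≤ κ) (f g : L2per) (q : ℝ) :
    ‖g‖ ≤ √(errEnergy κ α N f g q) ∧ √κ * ‖specOp N (α / 4) f‖ ≤ √(errEnergy κ α N f g q) ∧
      ‖f‖ ≤ √(errEnergy κ α N f g q) ∧ |q| ≤ √(errEnergy κ α N f g q) := by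
  have h1 : 0 ≤ κ * ‖specOp N (α / 4) f‖ ^ 2 := by positivity
  refine ⟨?_, ?_, ?_, ?_⟩
  · apply Real.le_sqrt_of_sq_le
    unfold errEnergy; nlinarith [sq_nonneg ‖f‖, sq_nonneg q]
  · apply Real.le_sqrt_of_sq_le
    rw [mul_pow, Real.sq_sqrt hκ]
    unfold errEnergy; nlinarith [sq_nonneg ‖f‖, sq_nonneg q, sq_nonneg ‖g‖]
  · apply Real.le_sqrt_of_sq_le
    unfold errEnergy; nlinarith [sq_nonneg ‖g‖, sq_nonneg q]
  · apply Real.abs_le_sqrt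
    unfold errEnergy; nlinarith [sq_nonneg ‖f‖, sq_nonneg ‖g‖]

lemma norm_half_add_le {X Y : ℝ} {f g : L2per} (hf : ‖f‖ ≤ X) (hg : ‖g‖ ≤ Y) :
    ‖(1 / 2 : ℝ) • (f + g)‖ ≤ (X + Y) / 2 := by
  rw [norm_smul, Real.norm_of_nonneg (by norm_num)]
  linarith [norm_add_le f g]

/-- The energy estimate for one step of the error equation, with consistency errors `S₀`, `S₁` and
nonlinear term `Φ`. -/
lemma linear_step_le (hκ : 0 ≤ κ) (hα : 0 ≤ α) (hγ₁ : 0 ≤ γ₁) (hγ₂ : 0 ≤ γ₂) (hτ : 0 < τ)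
    {f g f' g' S₀ S₁ : L2per} {Φ : L2per → ℝ} {D X X' : ℝ}
    (hg : g ∈ XN N) (hg' : g' ∈ XN N)
    (h1 : f' - f = τ • ((1 / 2 : ℝ) • (g' + g)) + specOp N 0 S₁)
    (h2 : ∀ φ ∈ XN N, inner ℝ (g' - g) φ
      = -τ * (κ * inner ℝ ((1 / 2 : ℝ) • (f' + f)) (specOp N (α / 2) φ)
        + γ₁ * inner ℝ ((1 / 2 : ℝ) • (g' + g)) (specOp N (α / 2) φ)
        + γ₂ * inner ℝ ((1 / 2 : ℝ) • (g' + g)) φ)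
        - κ * inner ℝ S₀ (specOp N (α / 2) φ) - γ₁ * inner ℝ S₁ (specOp N (α / 2) φ)
        - γ₂ * inner ℝ S₁ φ - Φ φ)
    (hS₀ : ‖specOp N (α / 2) S₀‖ ≤ D) (hS₁ : ‖S₁‖ ≤ D) (hS₁' : ‖specOp N (α / 4) S₁‖ ≤ D)
    (hgX : ‖g‖ ≤ X) (hgX' : ‖g'‖ ≤ X') (hfX : √κ * ‖specOp N (α / 4) f‖ ≤ X)
    (hfX' : √κ * ‖specOp N (α / 4) f'‖ ≤ X') (hfx : ‖f‖ ≤ X) (hfx' : ‖f'‖ ≤ X') :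
    ‖g'‖ ^ 2 + κ * ‖specOp N (α / 4) f'‖ ^ 2 + ‖f'‖ ^ 2
      ≤ ‖g‖ ^ 2 + κ * ‖specOp N (α / 4) f‖ ^ 2 + ‖f‖ ^ 2
        + (√κ + κ + γ₂ + 1) * D * (X' + X) + γ₁ * (D ^ 2 / (2 * τ)) + τ * (X' + X) ^ 2 / 2
        + 2 * |Φ ((1 / 2 : ℝ) • (g' + g))| := by
  have hα4 : 0 ≤ α / 4 := by positivity
  have half : ∀ p q : L2per, inner ℝ p (specOp N (α / 2) q)
      = inner ℝ (specOp N (α / 4) p) (specOp N (α / 4) q) := by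
    intro p q
    rw [← inner_specOp_two_mul hα4]; congr 3; ring
  set G := (1 / 2 : ℝ) • (g' + g) with hG
  set H := (1 / 2 : ℝ) • (f' + f) with hH
  have hGm : G ∈ XN N := smul_mem_XN _ (add_mem_XN hg' hg)
  have hD : 0 ≤ D := (norm_nonneg _).trans hS₁
  have e := h2 G hGm
  have e1 : inner ℝ (g' - g) G = (‖g'‖ ^ 2 - ‖g‖ ^ 2) / 2 := by
    rw [real_inner_comm, hG, inner_half_add_sub]
  -- τG is the increment of f up to the projected defect, so the elastic term is again a difference
  -- of squares plus a term in S₁.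
  have hτG : τ • G = f' - f - specOp N 0 S₁ := by rw [h1]; abel
  have e2 : τ * inner ℝ H (specOp N (α / 2) G)
      = (‖specOp N (α / 4) f'‖ ^ 2 - ‖specOp N (α / 4) f‖ ^ 2) / 2
        - inner ℝ (specOp N (α / 4) H) (specOp N (α / 4) S₁) := by
    rw [half, ← real_inner_smul_right, ← map_smul, hτG, map_sub, map_sub,
      specOp_specOp hα4 le_rfl, add_zero, inner_sub_right]
    congr 1
    rw [hH, map_smul, map_add, inner_half_add_sub]
  have e3 : inner ℝ G (specOp N (α / 2) G) = ‖specOp N (α / 4) G‖ ^ 2 := by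
    rw [half, real_inner_self_eq_norm_sq]
  have e4 : inner ℝ G G = ‖G‖ ^ 2 := real_inner_self_eq_norm_sq _
  rw [e1, e3, e4, half S₁ G, ← inner_specOp_left N (α / 2) S₀ G] at e
  have bG : ‖G‖ ≤ (X' + X) / 2 := norm_half_add_le hgX' hgX
  have bH : ‖H‖ ≤ (X' + X) / 2 := norm_half_add_le hfx' hfx
  have bSH : √κ * ‖specOp N (α / 4) H‖ ≤ (X' + X) / 2 := by
    have t := norm_add_le (specOp N (α / 4) f') (specOp N (α / 4) f)
    have s := Real.sqrt_nonneg κ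
    have t2 := mul_le_mul_of_nonneg_left t s
    rw [hH, map_smul, map_add, norm_smul, Real.norm_of_nonneg (by norm_num)]
    linarith
  have hX : 0 ≤ (X' + X) / 2 := (norm_nonneg _).trans bG
  have c1 : κ * inner ℝ (specOp N (α / 4) H) (specOp N (α / 4) S₁) ≤ √κ * ((X' + X) / 2 * D) := by
    have t := real_inner_le_norm (specOp N (α / 4) H) (specOp N (α / 4) S₁)
    calc _ ≤ κ * (‖specOp N (α / 4) H‖ * ‖specOp N (α / 4) S₁‖) := by gcongr
      _ = √κ * ((√κ * ‖specOp N (α / 4) H‖) * ‖specOp N (α / 4) S₁‖) := by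
        nth_rewrite 1 [← Real.mul_self_sqrt hκ]; ring
      _ ≤ _ := by gcongr
  have c2 : -(κ * inner ℝ (specOp N (α / 2) S₀) G) ≤ κ * (D * ((X' + X) / 2)) := by
    have t := (abs_le.1 (abs_real_inner_le_norm (specOp N (α / 2) S₀) G)).1
    have t2 : ‖specOp N (α / 2) S₀‖ * ‖G‖ ≤ D * ((X' + X) / 2) := by gcongr
    rw [← mul_neg]
    gcongr
    linarith
  have c3 : -(γ₂ * inner ℝ S₁ G) ≤ γ₂ * (D * ((X' + X) / 2)) := by
    have t := (abs_le.1 (abs_real_inner_le_norm S₁ G)).1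
    have t2 : ‖S₁‖ * ‖G‖ ≤ D * ((X' + X) / 2) := by gcongr
    rw [← mul_neg]
    gcongr
    linarith
  -- The damping absorbs (-Δ)^{α/4}G by Young's inequality, since the error energy does not control
  -- it. The price D²/(4τ) is harmless for D = O(τ³).
  have c4 : γ₁ * (-inner ℝ (specOp N (α / 4) S₁) (specOp N (α / 4) G)
      - τ * ‖specOp N (α / 4) G‖ ^ 2) ≤ γ₁ * (D ^ 2 / (4 * τ)) := by
    have t := (abs_le.1 (abs_real_inner_le_norm (specOp N (α / 4) S₁) (specOp N (α / 4) G))).1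
    have t2 : ‖specOp N (α / 4) S₁‖ * ‖specOp N (α / 4) G‖ ≤ D * ‖specOp N (α / 4) G‖ := by gcongr
    gcongr
    rw [le_div_iff₀ (by positivity)]
    nlinarith [sq_nonneg (D - 2 * τ * ‖specOp N (α / 4) G‖)]
  have c5 : 0 ≤ τ * (γ₂ * ‖G‖ ^ 2) := by positivity
  have c6 := neg_abs_le (Φ G)
  -- The elastic energy misses the mean of f, so ‖f‖² is carried along separately; its growth
  -- follows from the first error equation.
  have c7 : (‖f'‖ ^ 2 - ‖f‖ ^ 2) / 2 ≤ (X' + X) / 2 * (τ * ((X' + X) / 2) + D) := by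
    rw [← inner_half_add_sub, h1, ← hH]
    refine (real_inner_le_norm _ _).trans ?_
    gcongr
    refine (norm_add_le _ _).trans ?_
    rw [norm_smul, Real.norm_of_nonneg hτ.le]
    gcongr
    exact (norm_specOp_zero_le N _).trans hS₁
  have c8 : D ^ 2 / (2 * τ) = 2 * (D ^ 2 / (4 * τ)) := by field_simp; norm_num
  rw [c8]
  linear_combination 2 * e - 2 * κ * e2 + 2 * c1 + 2 * c2 + 2 * c3 + 2 * c4 + 2 * c5 + 2 * c6 + 2 * c7

namespace ExactData

lemma norm_map_trapezoid_le {f f' f'' : ℝ → L2per} (A : L2per →L[ℝ] L2per) (h : IsTimeDeriv T f f')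
    (h' : IsTimeDeriv T f' f'') (hB : TimeBound T B fun t => A (f'' t)) (ha : a ∈ Icc 0 T)
    (hτ : 0 < τ) (hb : a + τ ∈ Icc 0 T) :
    ‖A ((∫ s in a..a + τ, f s) - τ • ((1 / 2 : ℝ) • (f (a + τ) + f a)))‖ ≤ 2 * B * τ ^ 3 := by
  have h1 := (h.clm A).norm_trapezoid_le (h'.clm A) hB ha hτ hb
  rw [A.intervalIntegral_comp_comm (h.intervalIntegrable_self ha hb)] at h1
  simpa only [map_sub, map_smul, map_add] using h1

/-- Consistency of the nonlinear term of the scheme. -/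
lemma exists_nonlinear_le (hF : ContDiff ℝ 3 F)
    (hE : ∀ w : L2per, (∃ M : ℝ, ∀ᵐ x : Torus, |w x| ≤ M) → 0 < energyE F C₀ w)
    (hM : 0 ≤ M) (hB : 0 ≤ B)
    (hX : ExactData κ α γ₁ γ₂ F C₀ T m B M u ut utt uttt r rt rtt rttt) {M' : ℝ} (hM' : M ≤ M') :
    ∃ C, 0 ≤ C ∧ ∀ a τ : ℝ, a ∈ Icc 0 T → 0 < τ → a + τ ∈ Icc 0 T → ∀ w : L2per, AEBound M' w →
      ∀ R R' X X' : ℝ, |r a - R| ≤ X → |r (a + τ) - R'| ≤ X' → ∀ φ : L2per,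
      |(∫ s in a..a + τ, pairF' F (u s) φ) - τ * ((R' + R) / 2 * forceF F C₀ w φ)|
        ≤ C * τ * ‖φ‖ * (X' + X + ‖u (a + τ / 2) - w‖ + τ ^ 2) := by
  obtain ⟨C1, hC1, h1⟩ := hX.exists_pairF'_midpoint hF hE hM hB
  obtain ⟨C2, hC2, -, h2, -, h3⟩ := exists_force_bounds hF hE (hM.trans hM')
  refine ⟨C1 + B * C2 + C2, by positivity, fun a τ ha hτ hb w hw R R' X X' hR hR' φ => ?_⟩
  have hm := mid_mem ha hτ hb
  have hum := (hX.sup _ hm).mono hM'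
  have b1 := h1 a τ ha hτ hb φ
  have b2 := h2 w hw φ
  have b3 := h3 _ w hum hw φ
  have b4 := hX.bound_r _ hm
  have b5 : |r (a + τ / 2) - (R' + R) / 2| ≤ B * τ ^ 2 + (X' + X) / 2 := by
    have t := hX.dr.norm_average_le hX.drt hX.bound_rtt ha hτ hb
    rw [Real.norm_eq_abs, smul_eq_mul] at t
    rw [abs_le] at t hR hR' ⊢
    constructor <;> linarith [t.1, t.2, hR.1, hR.2, hR'.1, hR'.2]
  have hX0 : 0 ≤ X := (abs_nonneg _).trans hR
  have hX0' : 0 ≤ X' := (abs_nonneg _).trans hR'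
  have hpos := hE _ ⟨M, hX.sup _ hm⟩
  -- F'(u) = r · F'(u)/√E(u) for the exact solution, in the form used by the scheme; the difference
  -- then splits into errors of the argument and of r.
  have e1 : pairF' F (u (a + τ / 2)) φ = r (a + τ / 2) * forceF F C₀ (u (a + τ / 2)) φ := by
    rw [hX.r_eq _ hm, forceF, mul_div_cancel₀ _ (Real.sqrt_pos.2 hpos).ne']
  set s := ‖u (a + τ / 2) - w‖ with hs
  have hs0 : 0 ≤ s := norm_nonneg _
  have e2 : (∫ s in a..a + τ, pairF' F (u s) φ) - τ * ((R' + R) / 2 * forceF F C₀ w φ)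
      = ((∫ s in a..a + τ, pairF' F (u s) φ) - τ * pairF' F (u (a + τ / 2)) φ)
        + τ * (r (a + τ / 2) * (forceF F C₀ (u (a + τ / 2)) φ - forceF F C₀ w φ)
          + (r (a + τ / 2) - (R' + R) / 2) * forceF F C₀ w φ) := by
    rw [e1]; ring
  rw [e2]
  have b6 : |r (a + τ / 2) * (forceF F C₀ (u (a + τ / 2)) φ - forceF F C₀ w φ)|
      ≤ B * (C2 * (s * ‖φ‖)) := by rw [abs_mul]; gcongr
  have b7 : |(r (a + τ / 2) - (R' + R) / 2) * forceF F C₀ w φ|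
      ≤ (B * τ ^ 2 + (X' + X) / 2) * (C2 * ‖φ‖) := by rw [abs_mul]; gcongr
  have b8 := abs_add_le (r (a + τ / 2) * (forceF F C₀ (u (a + τ / 2)) φ - forceF F C₀ w φ))
    ((r (a + τ / 2) - (R' + R) / 2) * forceF F C₀ w φ)
  refine (abs_add_le _ _).trans ?_
  rw [abs_mul τ, abs_of_pos hτ]
  have b9 := mul_le_mul_of_nonneg_left (b8.trans (add_le_add b6 b7)) hτ.le
  refine (add_le_add b1 b9).trans ?_
  have p1 : 0 ≤ C1 * τ * ‖φ‖ * (X' + X + s) := by positivity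
  have p2 : 0 ≤ B * C2 * τ * ‖φ‖ * (X' + X) := by positivity
  have p3 : 0 ≤ C2 * τ * ‖φ‖ * ((X' + X) / 2 + s + τ ^ 2) := by positivity
  linear_combination p1 + p2 + p3

/-- Consistency of the equation for the auxiliary variable. -/
lemma exists_auxiliary_le (hF : ContDiff ℝ 3 F)
    (hE : ∀ w : L2per, (∃ M : ℝ, ∀ᵐ x : Torus, |w x| ≤ M) → 0 < energyE F C₀ w)
    (hM : 0 ≤ M) (hB : 0 ≤ B)
    (hX : ExactData κ α γ₁ γ₂ F C₀ T m B M u ut utt uttt r rt rtt rttt) {M' : ℝ} (hM' : M ≤ M') :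
    ∃ C, 0 ≤ C ∧ ∀ (N : ℕ) (a τ : ℝ), 4 ≤ N → a ∈ Icc 0 T → 0 < τ → a + τ ∈ Icc 0 T →
      ∀ w : L2per, AEBound M' w → ∀ (V V' : L2per) (X X' : ℝ),
      ‖specOp N 0 (ut a) - V‖ ≤ X → ‖specOp N 0 (ut (a + τ)) - V'‖ ≤ X' →
      |(r (a + τ) - r a) - τ / 2 * forceF F C₀ w ((1 / 2 : ℝ) • (V' + V))|
        ≤ C * τ * (X' + X + ‖u (a + τ / 2) - w‖ + (τ ^ 2 + (N : ℝ) ^ (-m))) := by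
  obtain ⟨C2, hC2, -, h2, -, h3⟩ := exists_force_bounds hF hE (hM.trans hM')
  refine ⟨B + C2 * B + C2, by positivity, fun N a τ hN ha hτ hb w hw V V' X X' hV hV' => ?_⟩
  have hm := mid_mem ha hτ hb
  have hum := (hX.sup _ hm).mono hM'
  set W := (1 / 2 : ℝ) • (V' + V) with hW
  set s := ‖u (a + τ / 2) - w‖ with hs
  have hs0 : 0 ≤ s := norm_nonneg _
  have hX0 : 0 ≤ X := (norm_nonneg _).trans hV
  have hX0' : 0 ≤ X' := (norm_nonneg _).trans hV'
  have hNm : 0 ≤ (N : ℝ) ^ (-m) := by positivity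
  have b1 : |(r (a + τ) - r a) - τ * rt (a + τ / 2)| ≤ B * τ ^ 3 := by
    rw [hX.dr.sub_eq ha hb]
    exact hX.drt.norm_midpoint_le hX.drtt hX.bound_rttt ha hτ hb
  -- Here u_t itself is paired with the force, not a test function of X_N, so its projection error
  -- N^{-m} enters.
  have b2 : ‖ut (a + τ / 2) - W‖ ≤ B * τ ^ 2 + B * (N : ℝ) ^ (-m) + (X' + X) / 2 := by
    have t1 := hX.dut.norm_average_le hX.dutt hX.norm_uttt ha hτ hb
    have t2 := norm_half_add_le (hX.proj_ut _ hb N hN) (hX.proj_ut _ ha N hN)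
    have t3 := norm_half_add_le hV' hV
    have e : ut (a + τ / 2) - W = -((1 / 2 : ℝ) • (ut (a + τ) + ut a) - ut (a + τ / 2))
        + (1 / 2 : ℝ) • ((ut (a + τ) - specOp N 0 (ut (a + τ))) + (ut a - specOp N 0 (ut a)))
        + (1 / 2 : ℝ) • ((specOp N 0 (ut (a + τ)) - V') + (specOp N 0 (ut a) - V)) := by
      rw [hW]; module
    rw [e]
    refine (norm_add₃_le).trans ?_
    rw [norm_neg]
    linarith
  have b3 := h3 _ w hum hw (ut (a + τ / 2))
  have b4 := h2 w hw (ut (a + τ / 2) - W)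
  rw [forceF_sub hF hw] at b4
  have b5 := hX.norm_ut _ hm
  have e2 : (r (a + τ) - r a) - τ / 2 * forceF F C₀ w W
      = ((r (a + τ) - r a) - τ * rt (a + τ / 2))
        + τ / 2 * ((forceF F C₀ (u (a + τ / 2)) (ut (a + τ / 2)) - forceF F C₀ w (ut (a + τ / 2)))
          + (forceF F C₀ w (ut (a + τ / 2)) - forceF F C₀ w W)) := by
    rw [hX.rt_eq _ hm]; ring
  rw [e2]
  refine (abs_add_le _ _).trans ?_
  rw [abs_mul (τ / 2), abs_of_pos (by positivity : 0 < τ / 2)]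
  have b6 : C2 * (s * ‖ut (a + τ / 2)‖) ≤ C2 * (s * B) := by gcongr
  have b7 : C2 * ‖ut (a + τ / 2) - W‖
      ≤ C2 * (B * τ ^ 2 + B * (N : ℝ) ^ (-m) + (X' + X) / 2) := by gcongr
  have b8 := mul_le_mul_of_nonneg_left ((abs_add_le _ _).trans
    (add_le_add (b3.trans b6) (b4.trans b7))) (by positivity : 0 ≤ τ / 2)
  refine (add_le_add b1 b8).trans ?_
  have p1 : 0 ≤ B * τ * (X' + X + s + (N : ℝ) ^ (-m)) := by positivity
  have p2 : 0 ≤ C2 * B * τ * (X' + X + s / 2 + (τ ^ 2 + (N : ℝ) ^ (-m)) / 2) := by positivity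
  have p3 : 0 ≤ C2 * τ * ((X' + X) * (3 / 4) + s + (τ ^ 2 + (N : ℝ) ^ (-m))) := by positivity
  linear_combination p1 + p2 + p3

end ExactData

/-- The energy of the error of the discrete values `U`, `V`, `R` at time `t`. -/
def solErr (κ α : ℝ) (N : ℕ) (u ut : ℝ → L2per) (r : ℝ → ℝ) (t : ℝ) (U V : L2per) (R : ℝ) : ℝ :=
  errEnergy κ α N (specOp N 0 (u t) - U) (specOp N 0 (ut t) - V) (r t - R)

/-- The estimate of the error growth over one step. -/
lemma ExactData.exists_step_le (hκ : 0 ≤ κ) (hα : 0 ≤ α) (hγ₁ : 0 ≤ γ₁) (hγ₂ : 0 ≤ γ₂)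
    (hF : ContDiff ℝ 3 F)
    (hE : ∀ w : L2per, (∃ M : ℝ, ∀ᵐ x : Torus, |w x| ≤ M) → 0 < energyE F C₀ w)
    (hM : 0 ≤ M) (hB : 0 ≤ B)
    (hX : ExactData κ α γ₁ γ₂ F C₀ T m B M u ut utt uttt r rt rtt rttt) {M' : ℝ} (hM' : M ≤ M') :
    ∃ C, 0 ≤ C ∧ ∀ (N : ℕ) (a τ : ℝ), 4 ≤ N → a ∈ Icc 0 T → 0 < τ → a + τ ∈ Icc 0 T →
      ∀ w : L2per, AEBound M' w → ∀ (U V U' V' : L2per) (R R' : ℝ),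
      StepEq κ α γ₁ γ₂ F C₀ τ N w U V R U' V' R' → ∀ X X' s δ : ℝ,
      X = √(solErr κ α N u ut r a U V R) → X' = √(solErr κ α N u ut r (a + τ) U' V' R') →
      s = ‖u (a + τ / 2) - w‖ → δ = τ ^ 2 + (N : ℝ) ^ (-m) →
      X' ^ 2 ≤ X ^ 2 + C * τ * ((X' + X) * (X' + X + s + δ) + δ ^ 2) := by
  obtain ⟨C1, hC1, h1⟩ := hX.exists_nonlinear_le hF hE hM hB hM'
  obtain ⟨C2, hC2, h2⟩ := hX.exists_auxiliary_le hF hE hM hB hM'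
  refine ⟨(√κ + κ + γ₂ + 1) * (2 * B) + γ₁ * (2 * B ^ 2) + 1 + C1 + C2, by positivity, ?_⟩
  intro N a τ hN ha hτ hb w hw U V U' V' R R' hS X X' s δ hXd hXd' hs hδ
  have hm := mid_mem ha hτ hb
  obtain ⟨x1, x2, x3, x4⟩ := le_sqrt_errEnergy (α := α) (N := N) hκ (specOp N 0 (u a) - U)
    (specOp N 0 (ut a) - V) (r a - R)
  obtain ⟨y1, y2, y3, y4⟩ := le_sqrt_errEnergy (α := α) (N := N) hκ (specOp N 0 (u (a + τ)) - U')
    (specOp N 0 (ut (a + τ)) - V') (r (a + τ) - R')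
  rw [← solErr, ← hXd] at x1 x2 x3 x4
  rw [← solErr, ← hXd'] at y1 y2 y3 y4
  have hX2 : X ^ 2 = solErr κ α N u ut r a U V R := by
    exact hXd ▸ Real.sq_sqrt (errEnergy_nonneg hκ _ _ _)
  have hX2' : X' ^ 2 = solErr κ α N u ut r (a + τ) U' V' R' := by
    exact hXd' ▸ Real.sq_sqrt (errEnergy_nonneg hκ _ _ _)
  have hX0 : 0 ≤ X := (norm_nonneg _).trans x1
  have hX0' : 0 ≤ X' := (norm_nonneg _).trans y1
  have hs0 : 0 ≤ s := hs ▸ norm_nonneg _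
  have hNm : 0 ≤ (N : ℝ) ^ (-m) := by positivity
  have hτδ : τ ^ 2 ≤ δ := by linarith
  have hδ0 : 0 ≤ δ := (sq_nonneg τ).trans hτδ
  set S₁ := (∫ s in a..a + τ, ut s) - τ • ((1 / 2 : ℝ) • (ut (a + τ) + ut a)) with hS₁
  set S₀ := (∫ s in a..a + τ, u s) - τ • ((1 / 2 : ℝ) • (u (a + τ) + u a)) with hS₀
  have n1 : ‖S₁‖ ≤ 2 * B * τ ^ 3 := hX.dut.norm_trapezoid_le hX.dutt hX.norm_uttt ha hτ hb
  have n2 : ‖specOp N (α / 4) S₁‖ ≤ 2 * B * τ ^ 3 :=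
    norm_map_trapezoid_le _ hX.dut hX.dutt (hX.semi_uttt N) ha hτ hb
  have n3 : ‖specOp N (α / 2) S₀‖ ≤ 2 * B * τ ^ 3 :=
    norm_map_trapezoid_le _ hX.du hX.dut (timeBound_of_forall fun t ht =>
      hX.semi_utt t ht _ (by positivity) le_rfl N) ha hτ hb
  have i0 : ∫ s in a..a + τ, u s = τ • ((1 / 2 : ℝ) • (u (a + τ) + u a)) + S₀ := by
    rw [hS₀]; abel
  have i1 : ∫ s in a..a + τ, ut s = τ • ((1 / 2 : ℝ) • (ut (a + τ) + ut a)) + S₁ := by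
    rw [hS₁]; abel
  set Φ : L2per → ℝ := fun φ => (∫ s in a..a + τ, pairF' F (u s) φ)
    - τ * ((R' + R) / 2 * forceF F C₀ w φ) with hΦ
  have proj : ∀ (p : L2per) {q : L2per}, q ∈ XN N → inner ℝ (specOp N 0 p) q = inner ℝ p q := by
    intro p q hq
    rw [inner_specOp_left, specOp_zero_of_mem hq]
  have hmem : ∀ p : L2per, specOp N 0 p ∈ XN N := fun p => specOp_mem_XN N le_rfl p
  have key := linear_step_le (N := N) hκ hα hγ₁ hγ₂ hτ (Φ := Φ) (S₀ := S₀) (S₁ := S₁)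
    (sub_mem_XN (hmem (ut a)) hS.mem_v) (sub_mem_XN (hmem (ut (a + τ))) hS.mem_v')
    (f := specOp N 0 (u a) - U) (f' := specOp N 0 (u (a + τ)) - U')
    (by
      have t1 := congrArg (specOp N 0) ((hX.du.sub_eq ha hb).trans i1)
      simp only [map_sub, map_add, map_smul] at t1
      have t2 := hS.eq_u
      have t3 : specOp N 0 (u (a + τ)) - U' - (specOp N 0 (u a) - U)
        = (specOp N 0 (u (a + τ)) - specOp N 0 (u a)) - (U' - U) := by abel
      rw [t3, t1, t2]
      module)
    (by
      intro φ hφ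
      have t1 := hX.integrated_weak hF hE hM ha hτ hb hφ
      have t2 := hS.eq_v φ hφ
      have hAφ : specOp N (α / 2) φ ∈ XN N := specOp_mem_XN N (by positivity) φ
      rw [i0, i1] at t1
      simp only [inner_add_left, inner_sub_left, real_inner_smul_left] at t1 t2 ⊢
      -- P_N drops out because the test functions lie in X_N; the linear terms contribute no
      -- projection error.
      rw [proj _ hφ, proj _ hφ, proj _ hAφ, proj _ hAφ, proj _ hAφ, proj _ hAφ, hΦ]
      linear_combination t1 - t2)
    n3 n1 n2 x1 y1 x2 y2 x3 y3
  set G := (1 / 2 : ℝ) • (specOp N 0 (ut (a + τ)) - V' + (specOp N 0 (ut a) - V)) with hG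
  have hGn : ‖G‖ ≤ (X' + X) / 2 := norm_half_add_le y1 x1
  have b1 : |Φ G| ≤ C1 * τ * ((X' + X) / 2) * (X' + X + s + δ) := by
    refine (h1 a τ ha hτ hb w hw R R' X X' x4 y4 G).trans ?_
    rw [← hs]
    gcongr
  have b2 := h2 N a τ hN ha hτ hb w hw V V' X X' x1 y1
  rw [← hs, ← hδ, ← hS.eq_R] at b2
  have b3 : (r (a + τ) - R') ^ 2 - (r a - R) ^ 2 ≤ (X' + X) * (C2 * τ * (X' + X + s + δ)) := by
    have t : (r (a + τ) - R') ^ 2 - (r a - R) ^ 2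
      = ((r (a + τ) - R') + (r a - R)) * ((r (a + τ) - r a) - (R' - R)) := by ring
    rw [t]
    refine (le_abs_self _).trans ?_
    rw [abs_mul]
    gcongr
    exact (abs_add_le _ _).trans (add_le_add y4 x4)
  have b4 : (√κ + κ + γ₂ + 1) * (2 * B * τ ^ 3) * (X' + X)
      ≤ (√κ + κ + γ₂ + 1) * (2 * B) * τ * ((X' + X) * δ) := by
    have : (√κ + κ + γ₂ + 1) * (2 * B * τ ^ 3) * (X' + X)
      = (√κ + κ + γ₂ + 1) * (2 * B) * τ * ((X' + X) * τ ^ 2) := by ring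
    rw [this]; gcongr
  -- With D = 2Bτ³ the Young term is τ · O(τ⁴), hence at most a multiple of τδ².
  have b5 : γ₁ * ((2 * B * τ ^ 3) ^ 2 / (2 * τ)) ≤ γ₁ * (2 * B ^ 2) * τ * δ ^ 2 := by
    have : γ₁ * ((2 * B * τ ^ 3) ^ 2 / (2 * τ)) = γ₁ * (2 * B ^ 2) * τ * (τ ^ 2) ^ 2 := by
      field_simp
    rw [this]; gcongr
  set K₁ := (√κ + κ + γ₂ + 1) * (2 * B) with hK₁
  have hK₁0 : 0 ≤ K₁ := by positivity
  set K₂ := γ₁ * (2 * B ^ 2) with hK₂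
  have hK₂0 : 0 ≤ K₂ := by positivity
  rw [hX2, hX2', solErr, solErr, errEnergy, errEnergy]
  have p1 : 0 ≤ K₁ * τ * ((X' + X) * (X' + X + s) + δ ^ 2) := by positivity
  have p2 : 0 ≤ K₂ * τ * ((X' + X) * (X' + X + s + δ)) := by positivity
  have p3 : 0 ≤ τ * ((X' + X) * ((X' + X) / 2 + s + δ) + δ ^ 2) := by positivity
  have p4 : 0 ≤ (C1 + C2) * τ * δ ^ 2 := by positivity
  linear_combination key + 2 * b1 + b3 + b4 + b5 + p1 + p2 + p3 + p4

end

end SAVWave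

/-! ### Gronwall's inequality and the bootstrap for the L^∞ bound. -/

namespace SAVWave

noncomputable section

variable {κ α γ₁ γ₂ T C₀ m B M τ Cs : ℝ} {F : ℝ → ℝ} {u ut utt uttt : ℝ → L2per}
  {r rt rtt rttt : ℝ → ℝ} {K N : ℕ}

/-- A three-level discrete Gronwall inequality. -/
lemma discrete_gronwall {E : ℕ → ℝ} {x A ε : ℝ} (hx : 0 ≤ x) (hx' : x ≤ 1 / 2)
    (hε : 0 ≤ ε) (hA : 1 ≤ A) (h0 : E 0 = 0) {n : ℕ} (h1 : 1 ≤ n → E 1 ≤ A * ε)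
    (h : ∀ i, i + 1 < n → E (i + 2) ≤ E (i + 1) + x * (E (i + 2) + E (i + 1) + E i + ε)) :
    ∀ j ≤ n, E j ≤ A * ε * (1 + 8 * x) ^ j := by
  have hAε : 0 ≤ A * ε := by positivity
  intro j
  induction j using Nat.strong_induction_on with
  | _ j ih =>
    intro hj
    match j, ih, hj with
    | 0, _, _ => rw [h0]; positivity
    | 1, _, hj =>
      refine (h1 hj).trans (le_mul_of_one_le_right hAε ?_)
      rw [pow_one]; linarith
    | i + 2, ih, hj =>
      have e1 := ih (i + 1) (by omega) (by omega)
      have e0 := ih i (by omega) (by omega)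
      have e2 := h i (by omega)
      set q := (1 + 8 * x) ^ i with hq
      have hq1 : 1 ≤ q := one_le_pow₀ (by linarith)
      rw [pow_succ, ← hq] at e1
      have e3 : (1 + 8 * x) ^ (i + 2) = q * (1 + 8 * x) * (1 + 8 * x) := by rw [hq]; ring
      rw [e3]
      set Q := A * ε * (q * (1 + 8 * x)) with hQ
      have hqQ : A * ε * q ≤ Q := by
        rw [hQ]; gcongr; nlinarith
      have hεQ : ε ≤ Q := by
        calc ε ≤ A * ε := le_mul_of_one_le_left hε hA
          _ ≤ A * ε * q := le_mul_of_one_le_right hAε hq1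
          _ ≤ Q := hqQ
      have hQ0 : 0 ≤ Q := hε.trans hεQ
      have e4 : (1 - x) * E (i + 2) ≤ (1 + 3 * x) * Q := by
        nlinarith [mul_le_mul_of_nonneg_left (e0.trans hqQ) hx, mul_le_mul_of_nonneg_left hεQ hx,
          mul_le_mul_of_nonneg_left e1 hx]
      -- The factor 8 is chosen for this: (1 - x)(1 + 8x) - (1 + 3x) = 4x(1 - 2x) ≥ 0 when x ≤ 1/2.
      have e5 : (1 + 3 * x) * Q ≤ (1 - x) * ((1 + 8 * x) * Q) := by
        have : 0 ≤ x * (1 - 2 * x) * Q := by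
          apply mul_nonneg (mul_nonneg hx (by linarith)) hQ0
        nlinarith
      have e6 := le_of_mul_le_mul_left (e4.trans e5) (by linarith)
      calc _ ≤ _ := e6
        _ = _ := by rw [hQ]; ring

/-- The Gronwall argument for the errors `X` with consistency defects `s`, `δ`. -/
lemma exists_gronwall {C c : ℝ} (hC : 0 ≤ C) (hc : 0 ≤ c) (T : ℝ) :
    ∃ C' τ₀, 0 ≤ C' ∧ 0 < τ₀ ∧ τ₀ ≤ 1 ∧ ∀ (X s : ℕ → ℝ) (τ δ : ℝ) (n : ℕ), (∀ i, 0 ≤ X i) →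
      0 < τ → τ ≤ τ₀ → n * τ ≤ T → 0 ≤ δ → X 0 = 0 → (1 ≤ n → τ * s 0 ≤ c * δ) →
      (∀ i, i + 1 < n → s (i + 1) ≤ c * (X (i + 1) + X i + δ)) →
      (∀ i < n, X (i + 1) ^ 2
        ≤ X i ^ 2 + C * τ * ((X (i + 1) + X i) * (X (i + 1) + X i + s i + δ) + δ ^ 2)) →
      ∀ j ≤ n, X j ≤ C' * δ := by
  -- D is the growth rate once s is eliminated from the recursion; A absorbs the exceptional first
  -- step, where only τ s₀ is O(δ).
  set D := C * (3 + 3 * c) with hD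
  set A := 1 + 2 * (C ^ 2 * (c + 1) ^ 2 + C) with hA
  have hD0 : 0 ≤ D := by positivity
  have hA1 : 1 ≤ A := by rw [hA]; linarith [(by positivity : 0 ≤ 2 * (C ^ 2 * (c + 1) ^ 2 + C))]
  refine ⟨√(A * Real.exp (8 * D * T)), 1 / (4 * (C + D + 1)), by positivity, by positivity, ?_, ?_⟩
  · rw [div_le_one (by positivity)]; linarith
  intro X s τ δ n hX hτ hτ₀ hn hδ h0 hs0 hs h
  have hτ2 : τ * (4 * (C + D + 1)) ≤ 1 := (le_div_iff₀ (by positivity)).1 hτ₀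
  have hCτ : C * τ ≤ 1 / 4 := by nlinarith
  have hDτ : D * τ ≤ 1 / 2 := by nlinarith
  have hτ1 : τ ≤ 1 := by nlinarith [mul_nonneg hτ.le hC, mul_nonneg hτ.le hD0]
  have key := discrete_gronwall (E := fun i => X i ^ 2) (x := D * τ) (A := A) (ε := δ ^ 2) (n := n)
    (by positivity) hDτ (by positivity) hA1 (by simp [h0]) ?_ ?_
  · intro j hj
    have hj' : (j : ℝ) ≤ n := by exact_mod_cast hj
    refine (pow_le_pow_iff_left₀ (hX j) (by positivity) two_ne_zero).1 ?_
    rw [mul_pow, Real.sq_sqrt (by positivity)]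
    refine (key j hj).trans ?_
    have e1 : (1 + 8 * (D * τ)) ^ j ≤ Real.exp (8 * D * T) := by
      calc (1 + 8 * (D * τ)) ^ j ≤ Real.exp (8 * (D * τ)) ^ j := by
            gcongr
            linarith [Real.add_one_le_exp (8 * (D * τ))]
        _ = Real.exp (8 * D * (j * τ)) := by rw [← Real.exp_nat_mul]; congr 1; ring
        _ ≤ _ := by
            gcongr
            exact (mul_le_mul_of_nonneg_right hj' hτ.le).trans hn
    calc _ ≤ A * δ ^ 2 * Real.exp (8 * D * T) := by gcongr
      _ = _ := by ring
  · intro hn1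
    have e := h 0 hn1
    rw [h0] at e
    have e0 := hs0 hn1
    have x1 := hX 1
    have e1 : C * X 1 * (τ * s 0) ≤ C * X 1 * (c * δ) := by gcongr
    have e2 : C * X 1 * δ * τ ≤ C * X 1 * δ * 1 := by gcongr
    have e3 : C * τ * X 1 ^ 2 ≤ 1 / 4 * X 1 ^ 2 := by gcongr
    have e4 : C * δ ^ 2 * τ ≤ C * δ ^ 2 * 1 := by gcongr
    -- Young's inequality absorbs C(c + 1)δ X₁ into the left side.
    have e5 := sq_nonneg (X 1 / 2 - C * (c + 1) * δ)
    change X 1 ^ 2 ≤ A * δ ^ 2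
    have e6 : (0 : ℝ) ≤ δ ^ 2 := sq_nonneg _
    simp only [zero_add] at e
    rw [hA]
    nlinarith
  · intro i hi
    have e := h (i + 1) hi
    have e1 := hs i hi
    have p := hX (i + 2)
    have q := hX (i + 1)
    have t := hX i
    change X (i + 2) ^ 2 ≤ X (i + 1) ^ 2 + D * τ * (X (i + 2) ^ 2 + X (i + 1) ^ 2 + X i ^ 2 + δ ^ 2)
    refine e.trans ?_
    rw [hD, show C * (3 + 3 * c) * τ * (X (i + 2) ^ 2 + X (i + 1) ^ 2 + X i ^ 2 + δ ^ 2)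
      = C * τ * ((3 + 3 * c) * (X (i + 2) ^ 2 + X (i + 1) ^ 2 + X i ^ 2 + δ ^ 2)) by ring]
    gcongr
    change (X (i + 2) + X (i + 1)) * (X (i + 2) + X (i + 1) + s (i + 1) + δ) + δ ^ 2 ≤ _
    generalize X (i + 2) = P at *
    generalize X (i + 1) = Q at *
    generalize X i = R at *
    have f1 : (P + Q) * s (i + 1) ≤ (P + Q) * (c * (Q + R + δ)) := by gcongr
    have f2 : (P + Q) * (Q + R + δ) ≤ P ^ 2 + Q ^ 2 + 3 / 2 * (Q ^ 2 + R ^ 2 + δ ^ 2) := by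
      nlinarith [sq_nonneg (P + Q - (Q + R + δ)), sq_nonneg (P - Q), sq_nonneg (Q - R),
        sq_nonneg (R - δ), sq_nonneg (Q - δ)]
    have f3 := mul_le_mul_of_nonneg_left f2 hc
    have f4 : 0 ≤ c * (2 * P ^ 2 + Q ^ 2 / 2 + 3 / 2 * R ^ 2 + 3 / 2 * δ ^ 2) := by positivity
    nlinarith [sq_nonneg (P - Q), sq_nonneg (P - δ), sq_nonneg (Q - δ), sq_nonneg R, sq_nonneg δ]

section

variable {uN vN : ℕ → L2per} {R : ℕ → ℝ} {uh vh : L2per} {Rh : ℝ}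

lemma SchemeData.time_mem {φ₀ φ₁ : L2per} {r₀ : ℝ}
    (h : SchemeData κ α γ₁ γ₂ F C₀ T τ K N φ₀ φ₁ r₀ uN vN R uh vh Rh) {n : ℕ} (hn : n ≤ K) :
    n * τ ∈ Icc 0 T := by
  have := h.pos
  have hn' : (n : ℝ) ≤ K := by exact_mod_cast hn
  exact ⟨by positivity, h.mul_eq ▸ mul_le_mul_of_nonneg_right hn' this.le⟩

/-- The square root of the energy of the error at time level `n`. -/
def errAt (κ α τ : ℝ) (N : ℕ) (u ut : ℝ → L2per) (r : ℝ → ℝ) (uN vN : ℕ → L2per) (R : ℕ → ℝ)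
    (n : ℕ) : ℝ :=
  √(solErr κ α N u ut r (n * τ) (uN n) (vN n) (R n))

lemma SchemeData.errAt_zero
    (h : SchemeData κ α γ₁ γ₂ F C₀ T τ K N (u 0) (ut 0) (r 0) uN vN R uh vh Rh) :
    errAt κ α τ N u ut r uN vN R 0 = 0 := by
  simp [errAt, solErr, errEnergy, h.init_u, h.init_v, h.init_R]

lemma norm_sub_le_errAt (hκ : 0 ≤ κ) (n : ℕ) :
    ‖specOp N 0 (u (n * τ)) - uN n‖ ≤ errAt κ α τ N u ut r uN vN R n :=
  (le_sqrt_errEnergy hκ _ _ _).2.2.1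

/-- The error of the starting value of the nonlinear terms. -/
lemma ExactData.norm_sub_start_le (hB : 0 ≤ B)
    (hX : ExactData κ α γ₁ γ₂ F C₀ T m B M u ut utt uttt r rt rtt rttt) (hN : 4 ≤ N) (hK : 1 ≤ K)
    (h : SchemeData κ α γ₁ γ₂ F C₀ T τ K N (u 0) (ut 0) (r 0) uN vN R uh vh Rh)
    (hs : StableData α τ K N Cs uN vN R uh Rh) :
    ‖u (0 + τ / 2) - uh‖ ≤ (B + Cs) * τ + B * (N : ℝ) ^ (-m) := by
  have h0 := h.time_mem (Nat.zero_le K)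
  have h1 := h.time_mem hK
  have hτ := h.pos
  rw [Nat.cast_zero, zero_mul] at h0
  rw [Nat.cast_one, one_mul] at h1
  have hm : 0 + τ / 2 ∈ Icc 0 T := mid_mem h0 hτ (by rwa [zero_add])
  have e1 := hX.du.norm_sub_le (timeBound_of_forall hX.norm_ut) h0 hm
  rw [add_sub_cancel_left, abs_of_pos (by positivity)] at e1
  have e2 := hX.proj_u 0 h0 N hN
  rw [← h.init_u] at e2
  have e3 := hs.start
  rw [norm_sub_rev] at e3
  -- The starting argument is within O(τ) of u_N⁰, itself a projection of u(0). First order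
  -- suffices, because this defect occurs once and carries a factor τ.
  have e : u (0 + τ / 2) - uh = (u (0 + τ / 2) - u 0) + (u 0 - uN 0) + (uN 0 - uh) := by abel
  rw [e]
  refine norm_add₃_le.trans ?_
  nlinarith [mul_nonneg hB hτ.le]

/-- The error of the extrapolated argument of the nonlinear terms. -/
lemma ExactData.norm_sub_extrap_le (hκ : 0 < κ)
    (hX : ExactData κ α γ₁ γ₂ F C₀ T m B M u ut utt uttt r rt rtt rttt) (hN : 4 ≤ N)
    (h : SchemeData κ α γ₁ γ₂ F C₀ T τ K N (u 0) (ut 0) (r 0) uN vN R uh vh Rh) {i : ℕ}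
    (hi : i + 1 < K) :
    ‖u ((i + 1 : ℕ) * τ + τ / 2) - extrap uh uN (i + 1)‖
      ≤ 2 * B * (τ ^ 2 + (N : ℝ) ^ (-m)) + 2 * (errAt κ α τ N u ut r uN vN R (i + 1)
        + errAt κ α τ N u ut r uN vN R i) := by
  have h0 := h.time_mem (show i ≤ K by omega)
  have h1 := h.time_mem (show i + 1 ≤ K by omega)
  have h2 := h.time_mem (show i + 2 ≤ K by omega)
  have e0 := norm_sub_le_errAt (N := N) (u := u) (uN := uN) (α := α) (τ := τ) (ut := ut) (r := r)
    (vN := vN) (R := R) hκ.le i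
  have e1 := norm_sub_le_errAt (N := N) (u := u) (uN := uN) (α := α) (τ := τ) (ut := ut) (r := r)
    (vN := vN) (R := R) hκ.le (i + 1)
  have p0 := hX.proj_u _ h0 N hN
  have p1 := hX.proj_u _ h1 N hN
  have c2 : ((i + 2 : ℕ) : ℝ) * τ = (i + 1 : ℕ) * τ + τ := by push_cast; ring
  have c0 : (i : ℝ) * τ = (i + 1 : ℕ) * τ - τ := by push_cast; ring
  have t := hX.du.norm_extrapolation_le hX.dut (timeBound_of_forall hX.norm_utt) h1 h.pos
    (c2 ▸ h2) (c0 ▸ h0)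
  rw [← c0] at t
  set a := ((i + 1 : ℕ) : ℝ) * τ
  set b := (i : ℝ) * τ
  have e : u (a + τ / 2) - extrap uh uN (i + 1)
      = (u (a + τ / 2) - (1 / 2 : ℝ) • ((3 : ℝ) • u a - u b))
        + ((3 / 2 : ℝ) • (u a - specOp N 0 (u a)) + (3 / 2 : ℝ) • (specOp N 0 (u a) - uN (i + 1)))
        + -((1 / 2 : ℝ) • (u b - specOp N 0 (u b)) + (1 / 2 : ℝ) • (specOp N 0 (u b) - uN i)) := by
    rw [extrap]; module
  have g1 := norm_add_le ((3 / 2 : ℝ) • (u a - specOp N 0 (u a)))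
    ((3 / 2 : ℝ) • (specOp N 0 (u a) - uN (i + 1)))
  have g2 := norm_add_le ((1 / 2 : ℝ) • (u b - specOp N 0 (u b)))
    ((1 / 2 : ℝ) • (specOp N 0 (u b) - uN i))
  simp only [norm_smul, Real.norm_of_nonneg (by norm_num : (0 : ℝ) ≤ 3 / 2),
    Real.norm_of_nonneg (by norm_num : (0 : ℝ) ≤ 1 / 2)] at g1 g2
  rw [e]
  refine norm_add₃_le.trans ?_
  rw [norm_neg]
  have q0 := (norm_nonneg _).trans e0
  have q1 := (norm_nonneg _).trans e1
  linarith

/-- The error estimate as long as the arguments of the nonlinear terms stay bounded. -/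
lemma ExactData.exists_error_le_of_bounded (hκ : 0 < κ) (hα : 0 ≤ α) (hγ₁ : 0 ≤ γ₁) (hγ₂ : 0 ≤ γ₂)
    (hF : ContDiff ℝ 3 F)
    (hE : ∀ w : L2per, (∃ M : ℝ, ∀ᵐ x : Torus, |w x| ≤ M) → 0 < energyE F C₀ w)
    (hM : 0 ≤ M) (hB : 0 ≤ B) (hCs : 0 ≤ Cs)
    (hX : ExactData κ α γ₁ γ₂ F C₀ T m B M u ut utt uttt r rt rtt rttt) {M' : ℝ} (hM' : M ≤ M') :
    ∃ C τ₀, 0 ≤ C ∧ 0 < τ₀ ∧ τ₀ ≤ 1 ∧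
      ∀ (K N : ℕ) (τ : ℝ) (uN vN : ℕ → L2per) (R : ℕ → ℝ) (uh vh : L2per) (Rh : ℝ),
      4 ≤ N → SchemeData κ α γ₁ γ₂ F C₀ T τ K N (u 0) (ut 0) (r 0) uN vN R uh vh Rh →
      StableData α τ K N Cs uN vN R uh Rh → τ ≤ τ₀ →
      ∀ n ≤ K, (∀ i < n, AEBound M' (extrap uh uN i)) →
      ∀ j ≤ n, errAt κ α τ N u ut r uN vN R j ≤ C * (τ ^ 2 + (N : ℝ) ^ (-m)) := by
  obtain ⟨C1, hC1, h1⟩ := hX.exists_step_le hκ.le hα hγ₁ hγ₂ hF hE hM hB hM'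
  obtain ⟨C, τ₀, hC, hτ₀, hτ₀', hG⟩ := exists_gronwall hC1
    (by positivity : 0 ≤ 2 * B + Cs + 2) T
  refine ⟨C, τ₀, hC, hτ₀, hτ₀', fun K N τ uN vN R uh vh Rh hN h hs hτ n hn hw => ?_⟩
  have hτ0 := h.pos
  have hNm : 0 ≤ (N : ℝ) ^ (-m) := by positivity
  have hX0 : ∀ i, 0 ≤ errAt κ α τ N u ut r uN vN R i := fun i => Real.sqrt_nonneg _
  refine hG (errAt κ α τ N u ut r uN vN R)
    (fun i => ‖u ((i : ℕ) * τ + τ / 2) - extrap uh uN i‖) τ (τ ^ 2 + (N : ℝ) ^ (-m)) n hX0 hτ0 hτ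
    (h.time_mem hn).2 (by positivity) h.errAt_zero (fun hn1 => ?_) (fun i hi => ?_) (fun i hi => ?_)
  -- Multiplied by τ, the first-order part becomes O(τ²); the part N^{-m} only needs τ ≤ 1.
  · have e := hX.norm_sub_start_le hB hN (hn1.trans hn) h hs
    have e1 : τ * B * (N : ℝ) ^ (-m) ≤ 1 * B * (N : ℝ) ^ (-m) := by
      gcongr; exact hτ.trans hτ₀'
    have e2 := mul_le_mul_of_nonneg_left e hτ0.le
    simp only [Nat.cast_zero, zero_mul, extrap]
    have p1 : 0 ≤ (B + 2) * τ ^ 2 + (B + Cs + 2) * (N : ℝ) ^ (-m) := by positivity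
    linear_combination e2 + e1 + p1
  · have e := hX.norm_sub_extrap_le hκ hN h (lt_of_lt_of_le hi hn)
    refine e.trans ?_
    have p1 : 0 ≤ (2 * B + Cs) * (errAt κ α τ N u ut r uN vN R (i + 1)
        + errAt κ α τ N u ut r uN vN R i) :=
      mul_nonneg (by positivity) (add_nonneg (hX0 _) (hX0 _))
    have p2 : 0 ≤ (Cs + 2) * (τ ^ 2 + (N : ℝ) ^ (-m)) := by positivity
    linear_combination p1 + p2
  · have hi' : i < K := lt_of_lt_of_le hi hn
    have c1 : ((i + 1 : ℕ) : ℝ) * τ = (i : ℝ) * τ + τ := by push_cast; ring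
    have m1 := h.time_mem (show i + 1 ≤ K from hi')
    rw [c1] at m1
    exact h1 N (i * τ) τ hN (h.time_mem hi'.le) hτ0 m1 _ (hw i hi) _ _ _ _ _ _ (h.step i hi')
      _ _ _ _ rfl (by rw [errAt, c1]) rfl rfl

lemma SemiBound.specOp_zero {β : ℝ} (hβ : 0 ≤ β) {f : L2per} (h : SemiBound β B f) :
    SemiBound β B (specOp N 0 f) := by
  refine SemiBound.of_mem_XN (N := N) (specOp_mem_XN N le_rfl f) ?_
  rw [specOp_specOp hβ le_rfl, add_zero]
  exact h N

/-- The error estimate for small step sizes. -/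
lemma ExactData.exists_error_le (hκ : 0 < κ) (hα₁ : 1 < α) (hα₂ : α ≤ 2) (hγ₁ : 0 ≤ γ₁)
    (hγ₂ : 0 ≤ γ₂) (hT : 0 < T) (hF : ContDiff ℝ 3 F)
    (hE : ∀ w : L2per, (∃ M : ℝ, ∀ᵐ x : Torus, |w x| ≤ M) → 0 < energyE F C₀ w)
    (hM : 0 ≤ M) (hB : 0 ≤ B) (hCs : 0 ≤ Cs)
    (hX : ExactData κ α γ₁ γ₂ F C₀ T m B M u ut utt uttt r rt rtt rttt) :
    ∃ C δ₀, 0 ≤ C ∧ 0 < δ₀ ∧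
      ∀ (K N : ℕ) (τ : ℝ) (uN vN : ℕ → L2per) (R : ℕ → ℝ) (uh vh : L2per) (Rh : ℝ),
      1 ≤ K → 4 ≤ N → SchemeData κ α γ₁ γ₂ F C₀ T τ K N (u 0) (ut 0) (r 0) uN vN R uh vh Rh →
      StableData α τ K N Cs uN vN R uh Rh → τ ^ 2 + (N : ℝ) ^ (-m) ≤ δ₀ →
      ∀ n ≤ K, errAt κ α τ N u ut r uN vN R n ≤ C * (τ ^ 2 + (N : ℝ) ^ (-m)) := by
  have hα : 0 ≤ α := by linarith
  have hσ : 1 < 2 * (1 / 4 + α / 4) := by linarith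
  have hσ2 : 2 * (1 / 4 + α / 4) / 2 = 1 / 4 + α / 4 := by ring
  obtain ⟨S₁, hS₁, hsup₁⟩ := exists_sup_bound hσ one_pos
  obtain ⟨M₀, hM₀, hstart⟩ := exists_start_sup hκ hα₁ hα₂ hγ₁ hγ₂ hT hF hE hB hCs hX
  set P := S₁ * B + 1 * B with hP
  have hP0 : 0 ≤ P := by positivity
  -- P + 1 will bound u_N: P for P_N u and 1 for the error; the extrapolation doubles it. M' is
  -- fixed before H, C, η and the threshold, so there is no circularity.
  set M' := M + M₀ + 2 * (P + 1) with hM'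
  have hM'0 : 0 ≤ M' := by positivity
  obtain ⟨H, hH, hhigh⟩ := exists_high_regularity hκ hα₁ hα₂ hγ₁ hγ₂ hT hF hE hB hCs hX hM'0
  obtain ⟨C, τ₀, hC, hτ₀, -, herr⟩ := hX.exists_error_le_of_bounded hκ hα hγ₁ hγ₂ hF hE hM hB hCs
    (show M ≤ M' by rw [hM']; linarith)
  -- η makes the high-norm part of the error contribute at most 1/2; the other half comes from its
  -- small L² norm, by the choice of the threshold.
  obtain ⟨S₂, hS₂, hsup₂⟩ := exists_sup_bound hσ (by positivity : 0 < 1 / (2 * (B + H + 1)))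
  rw [hσ2] at hsup₁ hsup₂
  refine ⟨C, min (τ₀ ^ 2) (1 / (2 * (S₂ * C + 1))), hC, by positivity, ?_⟩
  intro K N τ uN vN R uh vh Rh hK hN h hs hδ
  have hNm : 0 ≤ (N : ℝ) ^ (-m) := by positivity
  have hτ : τ ≤ τ₀ := by
    refine (pow_le_pow_iff_left₀ h.pos.le hτ₀.le two_ne_zero).1 ?_
    linarith [hδ.trans (min_le_left _ _)]
  have hδ1 : S₂ * (C * (τ ^ 2 + (N : ℝ) ^ (-m))) ≤ 1 / 2 := by
    have e1 := hδ.trans (min_le_right _ _)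
    rw [le_div_iff₀ (by positivity)] at e1
    have : 0 ≤ τ ^ 2 + (N : ℝ) ^ (-m) := by positivity
    nlinarith
  have hη : 1 / (2 * (B + H + 1)) * (B + H) ≤ 1 / 2 := by
    rw [div_mul_eq_mul_div, div_le_iff₀ (by positivity)]; linarith
  -- The argument of step i + 1 involves only u_N at levels i and i + 1, for which the error and
  -- regularity estimates require bounds on the arguments of earlier steps alone.
  have hbd : ∀ n ≤ K, ∀ i < n, AEBound M' (extrap uh uN i) := by
    intro n
    induction n with
    | zero => intro _ i hi; omega
    | succ n ih =>
      intro hn i hi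
      have ih' := ih (by omega)
      rcases Nat.lt_succ_iff_lt_or_eq.1 hi with hlt | rfl
      · exact ih' i hlt
      rcases i with _ | i
      · exact (hstart K N τ uN vN R uh vh Rh hK h hs).mono (by rw [hM']; linarith)
      have hval : ∀ j ≤ i + 1, AEBound (P + 1) (uN j) := by
        intro j hj
        have hjK : j ≤ K := by omega
        have ht := h.time_mem hjK
        have e1 := hhigh K N τ uN vN R uh vh Rh h hs j hjK fun i hi => ih' i (by omega)
        have e2 := (norm_sub_le_errAt (N := N) (u := u) (uN := uN) (α := α) (τ := τ) (ut := ut)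
          (r := r) (vN := vN) (R := R) hκ.le j).trans
          (herr K N τ uN vN R uh vh Rh hN h hs hτ (i + 1) (by omega) ih' j hj)
        have e3 := hX.semi_u _ ht (1 / 4 + α / 4) (by positivity) (by linarith)
        have e4 := e3.specOp_zero (N := N) (by positivity)
        have e5 : SemiBound (1 / 4 + α / 4) (B + H) (specOp N 0 (u (j * τ)) - uN j) := by
          refine SemiBound.of_mem_XN (N := N)
            (sub_mem_XN (specOp_mem_XN N le_rfl _) (h.mem_u hjK)) ?_
          rw [map_sub]
          exact (_root_.norm_sub_le _ _).trans (add_le_add (e4 N) e1)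
        filter_upwards [hsup₁ _ _ e4, hsup₂ _ _ e5, Lp.coeFn_sub (specOp N 0 (u (j * τ))) (uN j)]
          with x x1 x2 x3
        rw [x3, Pi.sub_apply] at x2
        have y1 : S₁ * ‖specOp N 0 (u (j * τ))‖ ≤ S₁ * B := by
          gcongr; exact (norm_specOp_zero_le N _).trans (hX.norm_u _ ht)
        have y2 : S₂ * ‖specOp N 0 (u (j * τ)) - uN j‖ ≤ 1 / 2 :=
          (mul_le_mul_of_nonneg_left e2 hS₂).trans hδ1
        rw [abs_le] at x1 x2 ⊢
        constructor <;> linarith [x1.1, x1.2, x2.1, x2.2]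
      have v1 := hval (i + 1) le_rfl
      have v0 := hval i (by omega)
      rw [extrap]
      filter_upwards [v1, v0, Lp.coeFn_smul (1 / 2 : ℝ) ((3 : ℝ) • uN (i + 1) - uN i),
        Lp.coeFn_sub ((3 : ℝ) • uN (i + 1)) (uN i), Lp.coeFn_smul (3 : ℝ) (uN (i + 1))]
        with x x1 x0 y1 y2 y3
      rw [y1, Pi.smul_apply, y2, Pi.sub_apply, y3, Pi.smul_apply, smul_eq_mul, smul_eq_mul, hM']
      rw [abs_le] at x1 x0 ⊢
      constructor <;> linarith [x1.1, x1.2, x0.1, x0.2]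
  intro n hn
  exact herr K N τ uN vN R uh vh Rh hN h hs hτ n hn (hbd n hn) n le_rfl

end

end

end SAVWave

/-! ### All step sizes, and the theorem. -/

namespace SAVWave

noncomputable section

variable {κ α γ₁ γ₂ T C₀ m B M τ Cs : ℝ} {F : ℝ → ℝ} {u ut utt uttt : ℝ → L2per}
  {r rt rtt rttt : ℝ → ℝ} {K N : ℕ}

lemma SemiBound.sub {β B' : ℝ} {f g : L2per} (hf : SemiBound β B f) (hg : SemiBound β B' g) :
    SemiBound β (B + B') (f - g) := by
  intro N
  rw [map_sub]
  exact (_root_.norm_sub_le _ _).trans (add_le_add (hf N) (hg N))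

lemma SemiBound.sobSemi_sq_le {β : ℝ} {f : L2per} (h : SemiBound β B f) :
    sobSemi (2 * β) f ^ 2 ≤ ENNReal.ofReal (B ^ 2 / (4 * Real.pi ^ 2)) := by
  rw [sobSemi_sq, ← ENNReal.ofReal_tsum_of_nonneg
    (fun k => mul_nonneg (Real.rpow_nonneg (freqSq_nonneg k) _) (sq_nonneg _)) h.summable]
  exact ENNReal.ofReal_le_ofReal (h.summable.tsum_le_of_sum_le h.sum_le)

section

variable {uN vN : ℕ → L2per} {R : ℕ → ℝ} {uh vh : L2per} {Rh : ℝ}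

/-- The consequence of the energy law for the errors. -/
lemma StableData.error_le (hα : 0 ≤ α) (hκ : 0 ≤ κ)
    (hX : ExactData κ α γ₁ γ₂ F C₀ T m B M u ut utt uttt r rt rtt rttt) {φ₀ φ₁ : L2per} {r₀ : ℝ}
    (h : SchemeData κ α γ₁ γ₂ F C₀ T τ K N φ₀ φ₁ r₀ uN vN R uh vh Rh)
    (hs : StableData α τ K N Cs uN vN R uh Rh) {n : ℕ} (hn : n ≤ K) :
    ‖u (n * τ) - uN n‖ ^ 2 + ‖ut (n * τ) - vN n‖ ^ 2 + |r (n * τ) - R n| ^ 2 ≤ 3 * (B + Cs) ^ 2 ∧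
      ENNReal.ofReal κ * sobSemi (α / 2) (u (n * τ) - uN n) ^ 2
        ≤ ENNReal.ofReal (κ * (B + Cs) ^ 2) := by
  have ht := h.time_mem hn
  have e1 : ‖u (n * τ) - uN n‖ ≤ B + Cs :=
    (_root_.norm_sub_le _ _).trans (add_le_add (hX.norm_u _ ht) (hs.norm_u n hn))
  have e2 : ‖ut (n * τ) - vN n‖ ≤ B + Cs :=
    (_root_.norm_sub_le _ _).trans (add_le_add (hX.norm_ut _ ht) (hs.norm_v n hn))
  have e3 : |r (n * τ) - R n| ≤ B + Cs :=
    (abs_sub _ _).trans (add_le_add (hX.bound_r _ ht) (hs.bound_R n hn))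
  constructor
  · have f1 := pow_le_pow_left₀ (norm_nonneg _) e1 2
    have f2 := pow_le_pow_left₀ (norm_nonneg _) e2 2
    have f3 := pow_le_pow_left₀ (abs_nonneg _) e3 2
    linarith
  · have e4 := ((hX.semi_u _ ht (α / 4) (by positivity) (by linarith)).sub
      (SemiBound.of_mem_XN (h.mem_u hn) (hs.semi_u n hn))).sobSemi_sq_le
    rw [show 2 * (α / 4) = α / 2 by ring] at e4
    rw [ENNReal.ofReal_mul hκ]
    gcongr
    refine e4.trans (ENNReal.ofReal_le_ofReal (div_le_self (sq_nonneg _) ?_))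
    nlinarith [Real.pi_gt_three]

/-- The error bounds in terms of the error at time level `n`. -/
lemma ExactData.error_le_of_errAt_le (hα : 0 ≤ α) (hκ : 0 ≤ κ) (hαm : α / 2 ≤ m) {L C δ : ℝ}
    (hX : ExactData κ α γ₁ γ₂ F C₀ T m B M u ut utt uttt r rt rtt rttt) (hB : 0 ≤ B)
    (hL : ∀ t ∈ Icc 0 T, sobNorm m (u t) ≤ ENNReal.ofReal L) {φ₀ φ₁ : L2per} {r₀ : ℝ}
    (h : SchemeData κ α γ₁ γ₂ F C₀ T τ K N φ₀ φ₁ r₀ uN vN R uh vh Rh) (hN : 4 ≤ N)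
    (hδ : (N : ℝ) ^ (-m) ≤ δ) {n : ℕ}
    (hn : n ≤ K) (he : errAt κ α τ N u ut r uN vN R n ≤ C * δ) :
    ‖u (n * τ) - uN n‖ ^ 2 + ‖ut (n * τ) - vN n‖ ^ 2 + |r (n * τ) - R n| ^ 2
        ≤ 3 * (B + C) ^ 2 * δ ^ 2 ∧
      ENNReal.ofReal κ * sobSemi (α / 2) (u (n * τ) - uN n) ^ 2
        ≤ ENNReal.ofReal (C ^ 2 * δ ^ 2
          + κ * (4 ^ (2 * m - α) * (N : ℝ) ^ (α - 2 * m) * (max L 0) ^ 2)) := by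
  have ht := h.time_mem hn
  obtain ⟨x1, x2, x3, x4⟩ := le_sqrt_errEnergy (α := α) (N := N) hκ
    (specOp N 0 (u (n * τ)) - uN n) (specOp N 0 (ut (n * τ)) - vN n) (r (n * τ) - R n)
  have hNm : 0 ≤ (N : ℝ) ^ (-m) := by positivity
  have hδ0 : 0 ≤ δ := hNm.trans hδ
  have pB : B * (N : ℝ) ^ (-m) ≤ B * δ := by gcongr
  have e1 : ‖u (n * τ) - uN n‖ ≤ (B + C) * δ := by
    have t := norm_sub_le_norm_sub_add_norm_sub (u (n * τ)) (specOp N 0 (u (n * τ))) (uN n)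
    have t2 := hX.proj_u _ ht N hN
    linarith [x3.trans he]
  have e2 : ‖ut (n * τ) - vN n‖ ≤ (B + C) * δ := by
    have t := norm_sub_le_norm_sub_add_norm_sub (ut (n * τ)) (specOp N 0 (ut (n * τ))) (vN n)
    have t2 := hX.proj_ut _ ht N hN
    linarith [x1.trans he]
  have e3 : |r (n * τ) - R n| ≤ (B + C) * δ := by
    have : 0 ≤ B * δ := by positivity
    linarith [x4.trans he]
  constructor
  · have f1 := pow_le_pow_left₀ (norm_nonneg _) e1 2
    have f2 := pow_le_pow_left₀ (norm_nonneg _) e2 2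
    have f3 := pow_le_pow_left₀ (abs_nonneg _) e3 2
    linarith
  · have hm : 0 ≤ m := le_trans (by positivity) hαm
    have t := sobSemi_sub_sq_le hN hm hαm (h.mem_u hn) (hL _ ht)
    have t1 : specOp N (α / 2 / 2) (u (n * τ) - uN n)
        = specOp N (α / 4) (specOp N 0 (u (n * τ)) - uN n) := by
      rw [show α / 2 / 2 = α / 4 by ring, map_sub, map_sub,
        specOp_specOp (by positivity) le_rfl, add_zero]
    rw [t1, show 2 * (α / 2) = α by ring] at t
    have t2 : κ * ‖specOp N (α / 4) (specOp N 0 (u (n * τ)) - uN n)‖ ^ 2 ≤ C ^ 2 * δ ^ 2 := by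
      have := pow_le_pow_left₀ (by positivity) (x2.trans he) 2
      rwa [mul_pow, Real.sq_sqrt hκ, mul_pow] at this
    have hπ : (4 * Real.pi ^ 2)⁻¹ ≤ 1 := inv_le_one_of_one_le₀ (by nlinarith [Real.pi_gt_three])
    calc _ ≤ ENNReal.ofReal κ * _ := mul_le_mul_right t _
      _ = _ := (ENNReal.ofReal_mul hκ).symm
      _ ≤ _ := by
        apply ENNReal.ofReal_le_ofReal
        have : (4 * Real.pi ^ 2)⁻¹ * (κ * ‖specOp N (α / 4) (specOp N 0 (u (n * τ)) - uN n)‖ ^ 2)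
            ≤ 1 * (C ^ 2 * δ ^ 2) := by gcongr
        linear_combination this

end

/-- The error bound with the consistency error `τ² + N^{-m}`, for all step sizes. -/
lemma ExactData.exists_global_error_le (hκ : 0 < κ) (hα₁ : 1 < α) (hα₂ : α ≤ 2) (hγ₁ : 0 ≤ γ₁)
    (hγ₂ : 0 ≤ γ₂) (hT : 0 < T) (hF : ContDiff ℝ 3 F)
    (hE : ∀ w : L2per, (∃ M : ℝ, ∀ᵐ x : Torus, |w x| ≤ M) → 0 < energyE F C₀ w)
    (hM : 0 ≤ M) (hB : 0 ≤ B) (hαm : α / 2 ≤ m) {L : ℝ}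
    (hL : ∀ t ∈ Icc 0 T, sobNorm m (u t) ≤ ENNReal.ofReal L)
    (hX : ExactData κ α γ₁ γ₂ F C₀ T m B M u ut utt uttt r rt rtt rttt) :
    ∃ D, 0 ≤ D ∧
      ∀ (K N : ℕ) (τ : ℝ) (uN vN : ℕ → L2per) (R : ℕ → ℝ) (uh vh : L2per) (Rh : ℝ),
      1 ≤ K → 1 ≤ N → SchemeData κ α γ₁ γ₂ F C₀ T τ K N (u 0) (ut 0) (r 0) uN vN R uh vh Rh →
      ∀ n ≤ K,
      ‖u (n * τ) - uN n‖ ^ 2 + ‖ut (n * τ) - vN n‖ ^ 2 + |r (n * τ) - R n| ^ 2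
          ≤ D * (τ ^ 2 + (N : ℝ) ^ (-m)) ^ 2 ∧
        ENNReal.ofReal κ * sobSemi (α / 2) (u (n * τ) - uN n) ^ 2
          ≤ ENNReal.ofReal (D * ((τ ^ 2 + (N : ℝ) ^ (-m)) ^ 2 + (N : ℝ) ^ (α - 2 * m))) := by
  have hα : 0 ≤ α := by linarith
  have hm : 0 ≤ m := le_trans (by positivity) hαm
  obtain ⟨Cs, hCs, hst⟩ := exists_stableData hκ hα hγ₁ hγ₂ hT hB hX
  obtain ⟨C, δ₀, hC, hδ₀, herr⟩ := hX.exists_error_le hκ hα₁ hα₂ hγ₁ hγ₂ hT hF hE hM hB hCs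
  -- The second entry makes δ < δ₁ imply N ≥ 4, since N^{-m} ≥ 4^{-m} for smaller N.
  set δ₁ := min δ₀ (4 ^ (-m)) with hδ₁
  have hδ₁0 : 0 < δ₁ := lt_min hδ₀ (by positivity)
  set D₁ := 3 * (B + C) ^ 2 with hD₁
  set D₂ := κ * (4 ^ (2 * m - α) * (max L 0) ^ 2) with hD₂
  set D₃ := (3 + κ) * (B + Cs) ^ 2 / δ₁ ^ 2 with hD₃
  have hD₁0 : 0 ≤ D₁ := by positivity
  have hD₂0 : 0 ≤ D₂ := by positivity
  have hD₃0 : 0 ≤ D₃ := by positivity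
  refine ⟨D₁ + D₂ + D₃, by positivity, fun K N τ uN vN R uh vh Rh hK hN h n hn => ?_⟩
  have hs := hst K N τ uN vN R uh vh Rh h
  set δ := τ ^ 2 + (N : ℝ) ^ (-m) with hδ
  have hNm : 0 ≤ (N : ℝ) ^ (-m) := by positivity
  have hNδ : (N : ℝ) ^ (-m) ≤ δ := by linarith [sq_nonneg τ]
  have hNα : 0 ≤ (N : ℝ) ^ (α - 2 * m) := by positivity
  have hδ0 : 0 ≤ δ := hNm.trans hNδ
  by_cases hsmall : δ ≤ δ₁ ∧ 4 ≤ N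
  · have e := herr K N τ uN vN R uh vh Rh hK hsmall.2 h hs (hsmall.1.trans (min_le_left _ _)) n hn
    obtain ⟨e1, e2⟩ := hX.error_le_of_errAt_le hα hκ.le hαm hB hL h hsmall.2 hNδ hn e
    constructor
    · refine e1.trans ?_
      gcongr
      linarith
    · refine e2.trans (ENNReal.ofReal_le_ofReal ?_)
      have p1 : C ^ 2 * δ ^ 2 ≤ D₁ * δ ^ 2 := by
        gcongr
        rw [hD₁]; nlinarith [mul_nonneg hB hC]
      have p2 : 0 ≤ D₁ * (N : ℝ) ^ (α - 2 * m) := by positivity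
      have p3 : 0 ≤ D₂ * δ ^ 2 := by positivity
      have p4 : 0 ≤ D₃ * (δ ^ 2 + (N : ℝ) ^ (α - 2 * m)) := by positivity
      have p5 : κ * (4 ^ (2 * m - α) * (N : ℝ) ^ (α - 2 * m) * (max L 0) ^ 2)
        = D₂ * (N : ℝ) ^ (α - 2 * m) := by rw [hD₂]; ring
      rw [p5]
      linear_combination p1 + p2 + p3 + p4
  -- Here δ is bounded below, so the unconditional bounds from the energy law, divided by δ₁²,
  -- already have the required form.
  · have hlarge : δ₁ ≤ δ := by
      by_contra! hlt
      refine hsmall ⟨hlt.le, ?_⟩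
      by_contra! hN4
      have hN0 : (0 : ℝ) < N := by exact_mod_cast hN
      have : (4 : ℝ) ^ (-m) ≤ (N : ℝ) ^ (-m) :=
        Real.rpow_le_rpow_of_nonpos hN0 (by exact_mod_cast hN4.le) (by linarith)
      linarith [min_le_right δ₀ ((4 : ℝ) ^ (-m))]
    obtain ⟨e1, e2⟩ := hs.error_le hα hκ.le hX h hn
    have p0 : (3 + κ) * (B + Cs) ^ 2 ≤ D₃ * δ ^ 2 := by
      rw [hD₃, div_mul_eq_mul_div, le_div_iff₀ (by positivity)]
      gcongr
    have p1 : 0 ≤ (D₁ + D₂) * δ ^ 2 := by positivity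
    have p2 : 0 ≤ (D₁ + D₂ + D₃) * (N : ℝ) ^ (α - 2 * m) := by positivity
    have p3 : 0 ≤ κ * (B + Cs) ^ 2 := by positivity
    constructor
    · linarith
    · refine e2.trans (ENNReal.ofReal_le_ofReal ?_)
      have p4 : 0 ≤ 3 * (B + Cs) ^ 2 := by positivity
      linarith

end

end SAVWave

open SAVWave
theorem mainTheorem1
    (κ α γ₁ γ₂ T C₀ m L : ℝ) (F : ℝ → ℝ)
    (hκ : 0 < κ) (hα₁ : 1 < α) (hα₂ : α ≤ 2) (hγ₁ : 0 ≤ γ₁) (hγ₂ : 0 ≤ γ₂)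
    (hT : 0 < T) (hm : 0 ≤ m)
    (hF : ContDiff ℝ 3 F) (hF_nonneg : ∀ z, 0 ≤ F z)
    (hE : ∀ w : L2per, (∃ M : ℝ, ∀ᵐ x : Torus, |w x| ≤ M) → 0 < energyE F C₀ w)
    (φ₀ φ₁ : L2per) (u ut utt uttt : ℝ → L2per) (r rt rtt rttt : ℝ → ℝ)
    (hu : IsExactSolution κ α γ₁ γ₂ F T φ₀ φ₁ u ut utt)
    (huttt : IsTimeDeriv T utt uttt)
    (hr : ∀ t ∈ Set.Icc 0 T, r t = √(energyE F C₀ (u t)))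
    (hrt : IsTimeDeriv T r rt) (hrtt : IsTimeDeriv T rt rtt) (hrttt : IsTimeDeriv T rtt rttt)
    (hL : RegularityBound m α T L φ₀ u ut utt uttt r rt rtt rttt) :
    ∃ C : ℝ, 0 < C ∧
      ∀ (K N : ℕ), 1 ≤ K → 1 ≤ N → ∀ τ : ℝ, τ = T / K →
      ∀ (uN vN : ℕ → L2per) (R : ℕ → ℝ),
        IsSAVSolution κ α γ₁ γ₂ F C₀ τ K N φ₀ φ₁ (r 0) uN vN R →
        ∀ n ≤ K,
          ‖u (n * τ) - uN n‖ ^ 2 + ‖ut (n * τ) - vN n‖ ^ 2 + |r (n * τ) - R n| ^ 2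
              ≤ C * (τ ^ 4 + (N : ℝ) ^ (-2 * m)) ∧
          ENNReal.ofReal κ * sobSemi (α / 2) (u (n * τ) - uN n) ^ 2
              ≤ ENNReal.ofReal (C * (τ ^ 4 + (N : ℝ) ^ (α - 2 * m))) := by
  -- The solution is in H^α in any case. Working with max m α ensures α/2 ≤ max m α, needed for the
  -- semi-norm, and a larger exponent only improves the rate since N ≥ 1.
  have hm' : 0 ≤ max m α := hm.trans (le_max_left _ _)
  obtain ⟨B, M, hB, hM, hX⟩ := exists_exactData hα₁ hT hm hF hE hu huttt hr hrt hrtt hrttt hL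
  obtain ⟨l1, -, -, -, -, l6, -, -, -⟩ := hL.components
  have hreg : ∀ t ∈ Icc 0 T, sobNorm (max m α) (u t) ≤ ENNReal.ofReal L := by
    intro t ht
    rcases max_choice m α with h | h <;> rw [h]
    · exact sobNorm_le_of_supNorm l1 ht
    · exact sobNorm_le_of_supNorm l6 ht
  obtain ⟨D, hD, hbound⟩ := hX.exists_global_error_le hκ hα₁ hα₂ hγ₁ hγ₂ hT hF hE hM hB
    ((by linarith : α / 2 ≤ α).trans (le_max_right m α)) hreg
  -- A factor 2 comes from squaring τ² + N^{-m}, another 1 from the tail N^{α-2m}; the added 1 makes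
  -- the constant positive.
  refine ⟨3 * D + 1, by positivity, fun K N hK hN τ hτ uN vN R hsol n hn => ?_⟩
  obtain ⟨uh, vh, Rh, h⟩ := hsol.exists_schemeData hT hK hτ
  rw [← hu.init_u, ← hu.init_ut] at h
  obtain ⟨e1, e2⟩ := hbound K N τ uN vN R uh vh Rh hK hN h n hn
  have hN1 : (1 : ℝ) ≤ N := by exact_mod_cast hN
  have hle : m ≤ max m α := le_max_left _ _
  have a1 : ((N : ℝ) ^ (-(max m α))) ^ 2 = (N : ℝ) ^ (-2 * max m α) := by
    rw [← Real.rpow_natCast, ← Real.rpow_mul (by positivity)]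
    congr 1; push_cast; ring
  have a2 : (N : ℝ) ^ (-2 * max m α) ≤ (N : ℝ) ^ (-2 * m) :=
    Real.rpow_le_rpow_of_exponent_le hN1 (by linarith)
  have a3 : (N : ℝ) ^ (-2 * m) ≤ (N : ℝ) ^ (α - 2 * m) :=
    Real.rpow_le_rpow_of_exponent_le hN1 (by linarith)
  have a4 : (N : ℝ) ^ (α - 2 * max m α) ≤ (N : ℝ) ^ (α - 2 * m) :=
    Real.rpow_le_rpow_of_exponent_le hN1 (by linarith)
  have a5 : (τ ^ 2 + (N : ℝ) ^ (-(max m α))) ^ 2 ≤ 2 * (τ ^ 4 + (N : ℝ) ^ (-2 * m)) := by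
    nlinarith [sq_nonneg (τ ^ 2 - (N : ℝ) ^ (-(max m α)))]
  have a6 : 0 ≤ τ ^ 4 + (N : ℝ) ^ (-2 * m) := by positivity
  have a7 : 0 ≤ τ ^ 4 + (N : ℝ) ^ (α - 2 * m) := by positivity
  constructor
  · have := mul_le_mul_of_nonneg_left a5 hD
    linarith [mul_nonneg hD a6]
  · refine e2.trans (ENNReal.ofReal_le_ofReal ?_)
    have b1 : (τ ^ 2 + (N : ℝ) ^ (-(max m α))) ^ 2 + (N : ℝ) ^ (α - 2 * max m α)
        ≤ 3 * (τ ^ 4 + (N : ℝ) ^ (α - 2 * m)) := by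
      have : 0 ≤ τ ^ 4 := by positivity
      linarith
    have := mul_le_mul_of_nonneg_left b1 hD
    linarith
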